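/- Let $P\subset\mathbb R^2$ be a simple polygon, i.e. the closed region bounded by a simple closed polygonal curve $\partial P$, and let $k\ge 0$ be an even integer. For $m\ge 0$, two points $x,y\in P$ are called $m$-visible if the segment $xy$ meets $\partial P$ in at most $m$ points other than $x$ and $y$ themselves (so a segment that runs along an edge meets $\partial P$ infinitely often and its ends are not $m$-visible for any $m$). The $m$-visibility polygon of $x$ is the set of all points of $P$ that are $m$-visible from $x$. The partition lines of the $k$-cell decomposition are the boundaries of the $m$-visibility polygons of all vertices of $P$, for $m=0,2,4,\dots,k$, and the cells are the connected components of the interior of $P$ minus the partition lines. For a pursuer at $p$, a shadow of $p$ is a connected component of the set of points of $P$ that are not $k$-visible from $p$; it is of type 2 (an edge shadow) if it contains no vertex of $P$. Let a pursuer move continuously inside one cell, being at $\gamma(t)$ at time $t\in[a,b]$. For $a\le s\le t\le b$, say that a shadow $S$ of $\gamma(s)$ evolves into a shadow $T$ of $\gamma(t)$ if there is a continuous $\eta:[s,t]\to P$ with $\eta(s)\in S$, $\eta(t)\in T$ and $\eta(r)$ not $k$-visible from $\gamma(r)$ for every $r\in[s,t]$. **Theorem 2.** For all $a\le s\le t\le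 b$, no geometric event involving a type 2 shadow occurs between times $s$ and $t$: 1. (no appear event) every type 2 shadow of $\gamma(t)$ is one into which some shadow of $\gamma(s)$ evolves; 2. (no disappear event) every type 2 shadow of $\gamma(s)$ evolves into some shadow of $\gamma(t)$; 3. (no merge event) there are no two different shadows of $\gamma(s)$ that evolve into the same shadow of $\gamma(t)$, where at least one of the three is of type 2; 4. (no split event) there is no shadow of $\gamma(s)$ that evolves into two different shadows of $\gamma(t)$, where at least one of the three is of type 2. -/

import Mathlib

open Set

/-- The Euclidean plane. -/
abbrev Plane : Type := EuclideanSpace ℝ (Fin 2)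

namespace KModem

variable {n : ℕ}

/-- The closed polygonal curve `poly` is simple: consecutive vertices are distinct, and distinct
edges, each taken without its terminal vertex, are disjoint (so the curve never meets itself). -/
structure IsSimple (poly : Polygon Plane n) : Prop where
  nondegenerate : poly.HasNondegenerateEdges
  disjoint : ∀ i j : Fin n, i ≠ j →
    Disjoint (poly.edgeSet ℝ i \ {poly (finRotate n i)})
      (poly.edgeSet ℝ j \ {poly (finRotate n j)})

/-- `P` is the closed region of the plane bounded by the simple polygonal curve `poly`: the compact
set that is the closure of its interior and whose topological boundary is the curve. -/
structure IsRegionOf (P : Set Plane) (poly : Polygon Plane n) : Prop where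
  simple : IsSimple poly
  isCompact : IsCompact P
  closure_interior : closure (interior P) = P
  frontier_eq : frontier P = poly.boundary ℝ

/-- The number of points, other than `x` and `y` themselves, in which the segment `xy` meets the
polygonal curve (it is `⊤` if the segment runs along an edge). -/
noncomputable def crossings (poly : Polygon Plane n) (x y : Plane) : ℕ∞ :=
  ((segment ℝ x y ∩ poly.boundary ℝ) \ {x, y}).encard

/-- `x` and `y` are `k`-visible: the segment `xy` meets the polygonal curve at most `k` times. -/
def KVisible (poly : Polygon Plane n) (k : ℕ) (x y : Plane) : Prop :=
  crossings poly x y ≤ k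

/-- The `k`-visibility polygon of `x`: all points of the region that are `k`-visible from `x`. -/
def visibilityPolygon (poly : Polygon Plane n) (P : Set Plane) (k : ℕ) (x : Plane) : Set Plane :=
  {y ∈ P | KVisible poly k x y}

/-- The partition lines of the `k`-cell decomposition: the boundaries of the `m`-visibility polygons
of all vertices, for all even `m` with `0 ≤ m ≤ k`. -/
def partitionLines (poly : Polygon Plane n) (P : Set Plane) (k : ℕ) : Set Plane :=
  {x | ∃ (i : Fin n) (m : ℕ), Even m ∧ m ≤ k ∧ x ∈ frontier (visibilityPolygon poly P m (poly i))}

/-- `C` is a cell of the `k`-cell decomposition: a connected component of what remains of the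
interior of the region once the partition lines are removed. -/
def IsCell (poly : Polygon Plane n) (P : Set Plane) (k : ℕ) (C : Set Plane) : Prop :=
  ∃ x ∈ interior P \ partitionLines poly P k,
    C = connectedComponentIn (interior P \ partitionLines poly P k) x

/-- The points of the region that are invisible to a `k`-modem at `p`. -/
def hidden (poly : Polygon Plane n) (P : Set Plane) (k : ℕ) (p : Plane) : Set Plane :=
  {x ∈ P | ¬ KVisible poly k p x}

/-- `S` is a shadow of `p`: a maximal connected set of points of the region invisible to `p`. -/
def IsShadow (poly : Polygon Plane n) (P : Set Plane) (k : ℕ) (p : Plane) (S : Set Plane) : Prop :=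
  ∃ x ∈ hidden poly P k p, S = connectedComponentIn (hidden poly P k p) x

/-- Type 2 (edge shadow): the shadow contains no vertex of the polygon. -/
def IsTypeTwo (poly : Polygon Plane n) (S : Set Plane) : Prop :=
  ∀ i : Fin n, poly i ∉ S

/-- While the pursuer moves along `γ` during the time interval `[s, t]`, the shadow `S` present at
time `s` evolves into the shadow `T` present at time `t`: a point can move continuously in the
region from `S` to `T`, staying invisible to the pursuer all the time. -/
def Evolves (poly : Polygon Plane n) (P : Set Plane) (k : ℕ) (γ : ℝ → Plane) (s t : ℝ)
    (S T : Set Plane) : Prop :=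
  ∃ η : ℝ → Plane, ContinuousOn η (Icc s t) ∧ (∀ r ∈ Icc s t, η r ∈ hidden poly P k (γ r)) ∧
    η s ∈ S ∧ η t ∈ T

/-- A type 2 shadow appears during `[s, t]`: it is present at time `t`, and no shadow present at
time `s` evolves into it. -/
def AppearEvent (poly : Polygon Plane n) (P : Set Plane) (k : ℕ) (γ : ℝ → Plane) (s t : ℝ) :
    Prop :=
  ∃ T, IsShadow poly P k (γ t) T ∧ IsTypeTwo poly T ∧
    ∀ S, IsShadow poly P k (γ s) S → ¬ Evolves poly P k γ s t S T

/-- A type 2 shadow disappears during `[s, t]`: it is present at time `s` and evolves into no shadow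
present at time `t`. -/
def DisappearEvent (poly : Polygon Plane n) (P : Set Plane) (k : ℕ) (γ : ℝ → Plane) (s t : ℝ) :
    Prop :=
  ∃ S, IsShadow poly P k (γ s) S ∧ IsTypeTwo poly S ∧
    ∀ T, IsShadow poly P k (γ t) T → ¬ Evolves poly P k γ s t S T

/-- A merge that involves a type 2 shadow during `[s, t]`: two different shadows present at time `s`
evolve into the same shadow present at time `t`, and one of the three is of type 2. -/
def MergeEvent (poly : Polygon Plane n) (P : Set Plane) (k : ℕ) (γ : ℝ → Plane) (s t : ℝ) :
    Prop :=
  ∃ S₁ S₂ T, IsShadow poly P k (γ s) S₁ ∧ IsShadow poly P k (γ s) S₂ ∧ S₁ ≠ S₂ ∧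
    IsShadow poly P k (γ t) T ∧ (IsTypeTwo poly S₁ ∨ IsTypeTwo poly S₂ ∨ IsTypeTwo poly T) ∧
    Evolves poly P k γ s t S₁ T ∧ Evolves poly P k γ s t S₂ T

/-- A split that involves a type 2 shadow during `[s, t]`: a shadow present at time `s` evolves into
two different shadows present at time `t`, and one of the three is of type 2. -/
def SplitEvent (poly : Polygon Plane n) (P : Set Plane) (k : ℕ) (γ : ℝ → Plane) (s t : ℝ) :
    Prop :=
  ∃ S T₁ T₂, IsShadow poly P k (γ s) S ∧ IsShadow poly P k (γ t) T₁ ∧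
    IsShadow poly P k (γ t) T₂ ∧ T₁ ≠ T₂ ∧
    (IsTypeTwo poly S ∨ IsTypeTwo poly T₁ ∨ IsTypeTwo poly T₂) ∧
    Evolves poly P k γ s t S T₁ ∧ Evolves poly P k γ s t S T₂

end KModem

open Filter Topology

namespace KModem

/-! ### Orientation determinant in the plane -/

/-! Fix a pursuer position `p` off the partition lines. The curve meets a segment from `p` in points
of three kinds (`IsSimple.classify`): transversal points, which survive perturbation; vertices at
which the curve is tangential to the line of sight, where a small motion can replace one point by
none or by two; and points of edges that point towards `p`, which make the count infinite. Being off
the partition lines says that for every even `m ≤ k` the `m`-visibility of each vertex is locally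
constant (`not_frequently_both`). This forbids a vertex with at most `k + 1` points in front of it
to lie behind a tangential vertex (`no_vertex_behind_tang`), because crossing that line of sight
changes its count by at least two and so passes an even level. It also forbids the near endpoint of
an edge pointing away from `p` to be `k`-visible (`no_visible_along`). Hence a point is hidden for
one of two reasons (`hidden_dichotomy`): `k + 1` transversal points, a stable situation, or exactly
`k` transversal points and one tangential vertex, in which case the line through that vertex
separates hidden from visible.

The second ingredient is parity. A segment that avoids the vertices changes sides at every crossing,
so one that arrives at an edge from the inner side has an even number of crossings
(`even_of_inner`). Near a visible point of such an edge the count is at most `k + 1`, which is odd;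
so visibility is open along the edge, jointly in the pursuer and the point (`visible_local`). The
hidden part of the edge is therefore closed, and where it ends inside the edge it does so at a line
through a tangential vertex (`IsShadowEnd`).

From a point of a type 2 shadow, go straight away from `p` until the ray leaves `P`. This ends at a
hidden point of an edge met from inside. The hidden interval around it contains no end of the edge,
since otherwise the shadow would contain a vertex; so it is bounded by two tangential vertices,
which makes it a track (`IsTrack`). Tracks are stable under perturbation and under limits, so the
same edge and vertices give a track over the whole cell (`IsTrack.forall_mem`). The hidden points
that reach the track in this way form `trackShadow`. If it contains no vertex, membership in it is
locally constant among pairs of a pursuer and a hidden point (`eventually_mem_trackShadow_iff`), so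
it is a shadow; and whether it contains a vertex does not change within the cell
(`isTypeTwo_of_mem`).

Thus every type 2 shadow belongs to a family of shadows over the whole time interval which has a
continuous selection, namely a moving shadow end, and which moving hidden points can neither enter
nor leave (`exists_shadow_family`). The selection rules out appearing and disappearing, the
invariance rules out merging and splitting. -/

/-- Twice the signed area of the triangle `p q r`. -/
def orient (p q r : Plane) : ℝ := (q 0 - p 0) * (r 1 - p 1) - (q 1 - p 1) * (r 0 - p 0)

lemma lineMap_coord (a b : Plane) (t : ℝ) (i : Fin 2) :
    (AffineMap.lineMap a b t : Plane) i = a i + t * (b i - a i) := by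
  simp [AffineMap.lineMap_apply]; ring

lemma plane_ext {a b : Plane} (h0 : a 0 = b 0) (h1 : a 1 = b 1) : a = b := by
  ext i; fin_cases i <;> assumption

lemma orient_lineMap_right (p q a b : Plane) (t : ℝ) :
    orient p q (AffineMap.lineMap a b t) = (1 - t) * orient p q a + t * orient p q b := by
  simp only [orient, lineMap_coord]; ring

lemma orient_lineMap_left (q r a b : Plane) (t : ℝ) :
    orient (AffineMap.lineMap a b t) q r = (1 - t) * orient a q r + t * orient b q r := by
  simp only [orient, lineMap_coord]; ring

lemma orient_lineMap_mid (p r a b : Plane) (t : ℝ) :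
    orient p (AffineMap.lineMap a b t) r = (1 - t) * orient p a r + t * orient p b r := by
  simp only [orient, lineMap_coord]; ring

lemma orient_rotate (p q r : Plane) : orient q r p = orient p q r := by
  simp only [orient]; ring

lemma orient_swap (p q r : Plane) : orient p r q = - orient p q r := by
  simp only [orient]; ring

@[simp] lemma orient_self_left (p r : Plane) : orient p p r = 0 := by simp [orient]
@[simp] lemma orient_self_right (p r : Plane) : orient p r r = 0 := by simp only [orient]; ring
@[simp] lemma orient_self_outer (p r : Plane) : orient p r p = 0 := by simp [orient]

@[fun_prop] lemma Continuous.orient {α : Type*} [TopologicalSpace α] {f g h : α → Plane}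
    (hf : Continuous f) (hg : Continuous g) (hh : Continuous h) :
    Continuous fun x => orient (f x) (g x) (h x) := by
  unfold KModem.orient; fun_prop

lemma plane_ne {p q : Plane} (h : p ≠ q) : 0 < (q 0 - p 0) ^ 2 + (q 1 - p 1) ^ 2 := by
  rcases eq_or_ne (p 0) (q 0) with h0 | h0
  · rcases eq_or_ne (p 1) (q 1) with h1 | h1
    · exact absurd (plane_ext h0 h1) h
    · have : q 1 - p 1 ≠ 0 := sub_ne_zero.2 h1.symm
      positivity
  · have : q 0 - p 0 ≠ 0 := sub_ne_zero.2 h0.symm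
    positivity

/-- The parameter of the orthogonal projection of `r` to the line `p q`. -/
noncomputable def lineParam (p q r : Plane) : ℝ :=
  ((r 0 - p 0) * (q 0 - p 0) + (r 1 - p 1) * (q 1 - p 1)) / ((q 0 - p 0) ^ 2 + (q 1 - p 1) ^ 2)

lemma eq_lineMap_lineParam {p q r : Plane} (h : p ≠ q) (h0 : orient p q r = 0) :
    r = AffineMap.lineMap p q (lineParam p q r) := by
  have hd := plane_ne h
  unfold orient at h0
  apply plane_ext <;> rw [lineMap_coord, lineParam, div_mul_eq_mul_div, ← sub_eq_iff_eq_add',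
      eq_div_iff hd.ne']
  · linear_combination -(q 1 - p 1) * h0
  · linear_combination (q 0 - p 0) * h0

lemma lineParam_lineMap {p q : Plane} (h : p ≠ q) (t : ℝ) :
    lineParam p q (AffineMap.lineMap p q t) = t := by
  have hd := plane_ne h
  rw [lineParam, div_eq_iff hd.ne']
  simp only [lineMap_coord]; ring

lemma mem_openSegment_iff_lineMap {p q r : Plane} :
    r ∈ openSegment ℝ p q ↔ ∃ t ∈ Ioo (0 : ℝ) 1, AffineMap.lineMap p q t = r := by
  rw [openSegment_eq_image_lineMap]; rfl

lemma mem_segment_iff_lineMap {p q r : Plane} :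
    r ∈ segment ℝ p q ↔ ∃ t ∈ Icc (0 : ℝ) 1, AffineMap.lineMap p q t = r := by
  rw [segment_eq_image_lineMap]; rfl

lemma orient_of_mem_segment {p q r : Plane} (h : r ∈ segment ℝ p q) : orient p q r = 0 := by
  obtain ⟨t, -, rfl⟩ := mem_segment_iff_lineMap.1 h
  rw [orient_lineMap_right]; simp

lemma orient_of_mem_openSegment {p q r : Plane} (h : r ∈ openSegment ℝ p q) :
    orient p q r = 0 :=
  orient_of_mem_segment (openSegment_subset_segment _ _ _ h)

lemma mem_openSegment_iff_lineParam {p q r : Plane} (h : p ≠ q) :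
    r ∈ openSegment ℝ p q ↔ orient p q r = 0 ∧ lineParam p q r ∈ Ioo (0 : ℝ) 1 := by
  constructor
  · intro hr
    refine ⟨orient_of_mem_openSegment hr, ?_⟩
    obtain ⟨t, ht, rfl⟩ := mem_openSegment_iff_lineMap.1 hr
    rwa [lineParam_lineMap h]
  · rintro ⟨h0, ht⟩
    exact mem_openSegment_iff_lineMap.2 ⟨_, ht, (eq_lineMap_lineParam h h0).symm⟩

lemma tendsto_lineParam {α : Type*} {l : Filter α} {f g h : α → Plane} {p q r : Plane}
    (hpq : p ≠ q) (hf : Tendsto f l (𝓝 p)) (hg : Tendsto g l (𝓝 q)) (hh : Tendsto h l (𝓝 r)) :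
    Tendsto (fun x => lineParam (f x) (g x) (h x)) l (𝓝 (lineParam p q r)) := by
  have hc : ∀ {f : α → Plane} {p : Plane} (i : Fin 2), Tendsto f l (𝓝 p) →
      Tendsto (fun x => f x i) l (𝓝 (p i)) := fun {f p} i hf =>
    ((by fun_prop : Continuous fun x : Plane => x i).tendsto p).comp hf
  unfold lineParam
  refine Tendsto.div ?_ ?_ (plane_ne hpq).ne'
  · exact (((hc 0 hh).sub (hc 0 hf)).mul ((hc 0 hg).sub (hc 0 hf))).add
      (((hc 1 hh).sub (hc 1 hf)).mul ((hc 1 hg).sub (hc 1 hf)))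
  · exact (((hc 0 hg).sub (hc 0 hf)).pow 2).add (((hc 1 hg).sub (hc 1 hf)).pow 2)

lemma tendsto_orient {α : Type*} {l : Filter α} {f g h : α → Plane} {p q r : Plane}
    (hf : Tendsto f l (𝓝 p)) (hg : Tendsto g l (𝓝 q)) (hh : Tendsto h l (𝓝 r)) :
    Tendsto (fun x => orient (f x) (g x) (h x)) l (𝓝 (orient p q r)) :=
  ((by fun_prop : Continuous fun x : Plane × Plane × Plane => orient x.1 x.2.1 x.2.2).tendsto
    (p, q, r)).comp (hf.prodMk_nhds (hg.prodMk_nhds hh))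

/-- A point on the line `f g` that tends to an interior point of a segment ends up in the open
segment. -/
lemma eventually_mem_openSegment {α : Type*} {l : Filter α} {f g h : α → Plane} {p q r : Plane}
    (hpq : p ≠ q) (hf : Tendsto f l (𝓝 p)) (hg : Tendsto g l (𝓝 q)) (hh : Tendsto h l (𝓝 r))
    (hr : r ∈ openSegment ℝ p q) :
    ∀ᶠ x in l, orient (f x) (g x) (h x) = 0 → h x ∈ openSegment ℝ (f x) (g x) := by
  have h1 := (tendsto_lineParam hpq hf hg hh).eventually
    (isOpen_Ioo.mem_nhds ((mem_openSegment_iff_lineParam hpq).1 hr).2)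
  have h2 : ∀ᶠ x in l, f x ≠ g x := (hf.prodMk_nhds hg).eventually
    ((isOpen_ne_fun continuous_fst continuous_snd).mem_nhds hpq)
  filter_upwards [h1, h2] with x hx hne h0
  exact (mem_openSegment_iff_lineParam hne).2 ⟨h0, hx⟩

/-! ### Intersections of a line with one or two arms -/

/-- `orient p y` is affine along the arm and nonzero at one end, so it has at most one zero. -/
lemma arm_subsingleton {p y q a : Plane} (ha : orient p y a ≠ 0) :
    {x | x ∈ segment ℝ q a ∧ orient p y x = 0}.Subsingleton := by
  rintro x ⟨hx, hx0⟩ x' ⟨hx', hx0'⟩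
  obtain ⟨t, ht, rfl⟩ := mem_segment_iff_lineMap.1 hx
  obtain ⟨t', ht', rfl⟩ := mem_segment_iff_lineMap.1 hx'
  rw [orient_lineMap_right] at hx0 hx0'
  have hne : orient p y a - orient p y q ≠ 0 := by
    intro h
    apply ha; linear_combination hx0 + (1 - t) * h
  have : (t - t') * (orient p y a - orient p y q) = 0 := by linear_combination hx0 - hx0'
  rcases mul_eq_zero.1 this with h | h
  · rw [sub_eq_zero.1 h]
  · exact absurd h hne

lemma arm_ne_zero {p y q a x : Plane} (h : 0 < orient p y q * orient p y a)
    (hx : x ∈ segment ℝ q a) : orient p y x ≠ 0 := by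
  obtain ⟨t, ht, rfl⟩ := mem_segment_iff_lineMap.1 hx
  rw [orient_lineMap_right]
  rcases pos_and_pos_or_neg_and_neg_of_mul_pos h with ⟨h1, h2⟩ | ⟨h1, h2⟩
  · rcases ht.1.eq_or_lt with h0 | h0
    · rw [← h0]; simp [h1.ne']
    · have := mul_pos h0 h2
      have := mul_nonneg (sub_nonneg.2 ht.2) h1.le
      linarith
  · rcases ht.1.eq_or_lt with h0 | h0
    · rw [← h0]; simp [h1.ne]
    · have := mul_neg_of_pos_of_neg h0 h2
      have := mul_nonpos_of_nonneg_of_nonpos (sub_nonneg.2 ht.2) h1.le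
      linarith

lemma arm_eq_base {p y q a x : Plane} (hq : orient p y q = 0) (ha : orient p y a ≠ 0)
    (hx : x ∈ segment ℝ q a) (h0 : orient p y x = 0) : x = q :=
  arm_subsingleton ha ⟨hx, h0⟩ ⟨left_mem_segment _ _ _, hq⟩

/-- If `q` is off the line, it is strictly on the side of `a` or of `b`; that arm is missed and the
other is met at most once. If `q` is on the line, both arms are met in `q` only. Nothing is assumed
about `q`, so the bound survives small motions of the line. -/
lemma arms_subsingleton {p y q a b : Plane} (h : orient p y a * orient p y b < 0) :
    {x | x ∈ segment ℝ q a ∪ segment ℝ q b ∧ orient p y x = 0}.Subsingleton := by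
  have ha : orient p y a ≠ 0 := fun h0 => by simp [h0] at h
  have hb : orient p y b ≠ 0 := fun h0 => by simp [h0] at h
  rcases eq_or_ne (orient p y q) 0 with hq | hq
  · have key : ∀ x, x ∈ segment ℝ q a ∪ segment ℝ q b → orient p y x = 0 → x = q := by
      rintro x (hx | hx) h0
      · exact arm_eq_base hq ha hx h0
      · exact arm_eq_base hq hb hx h0
    rintro x ⟨hx, hx0⟩ x' ⟨hx', hx0'⟩
    rw [key x hx hx0, key x' hx' hx0']
  · have hq2 : 0 < orient p y q ^ 2 := by positivity
    rcases lt_or_ge 0 (orient p y q * orient p y a) with h1 | h1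
    · rintro x ⟨hx | hx, hx0⟩ x' ⟨hx' | hx', hx0'⟩
      · exact absurd hx0 (arm_ne_zero h1 hx)
      · exact absurd hx0 (arm_ne_zero h1 hx)
      · exact absurd hx0' (arm_ne_zero h1 hx')
      · exact arm_subsingleton hb ⟨hx, hx0⟩ ⟨hx', hx0'⟩
    · have h2 : 0 < orient p y q * orient p y b := by
        have h1' : orient p y q * orient p y a < 0 := lt_of_le_of_ne h1 (mul_ne_zero hq ha)
        have : 0 < (orient p y q * orient p y b) * (- (orient p y q * orient p y a)) := by
          have := mul_pos hq2 (neg_pos.2 h); nlinarith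
        exact (pos_iff_pos_of_mul_pos this).2 (by linarith)
      rintro x ⟨hx | hx, hx0⟩ x' ⟨hx' | hx', hx0'⟩
      · exact arm_subsingleton ha ⟨hx, hx0⟩ ⟨hx', hx0'⟩
      · exact absurd hx0' (arm_ne_zero h2 hx')
      · exact absurd hx0 (arm_ne_zero h2 hx)
      · exact absurd hx0' (arm_ne_zero h2 hx')

/-- The line `p y` crosses the arm `q a` close to `q` if it separates `q` from `a`. -/
lemma eventually_exists_arm_crossing {p y q a : Plane} (hq : q ∈ openSegment ℝ p y)
    (hpy : p ≠ y) (ha : orient p y a ≠ 0) {N : Set Plane} (hN : N ∈ 𝓝 q) :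
    ∀ᶠ z : Plane × Plane in 𝓝 (p, y), orient z.1 z.2 q * orient p y a ≤ 0 →
      ∃ x ∈ N, x ∈ openSegment ℝ z.1 z.2 ∧ x ∈ segment ℝ q a ∧
        (orient z.1 z.2 q ≠ 0 → x ≠ q) := by
  have hq0 := orient_of_mem_openSegment hq
  have t1 : Tendsto (fun z : Plane × Plane => z.1) (𝓝 (p, y)) (𝓝 p) := continuous_fst.tendsto _
  have t2 : Tendsto (fun z : Plane × Plane => z.2) (𝓝 (p, y)) (𝓝 y) := continuous_snd.tendsto _
  have tq := tendsto_orient t1 t2 (tendsto_const_nhds (x := q))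
  have ta := tendsto_orient t1 t2 (tendsto_const_nhds (x := a))
  -- The moved line meets the line `q a` at parameter `μ`. This tends to 0, as the numerator tends
  -- to `orient p y q = 0` and the denominator to `-orient p y a ≠ 0`.
  set μ : Plane × Plane → ℝ := fun z =>
    orient z.1 z.2 q / (orient z.1 z.2 q - orient z.1 z.2 a) with hμ
  have tμ : Tendsto μ (𝓝 (p, y)) (𝓝 0) := by
    have := tq.div (tq.sub ta) (by rw [hq0]; simpa using ha)
    rw [hq0, zero_div] at this
    exact this
  have tx : Tendsto (fun z => (AffineMap.lineMap q a (μ z) : Plane)) (𝓝 (p, y)) (𝓝 q) := by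
    have : Continuous fun t : ℝ => (AffineMap.lineMap q a t : Plane) :=
      AffineMap.lineMap_continuous
    simpa [Function.comp_def] using (this.tendsto 0).comp tμ
  have e1 := eventually_mem_openSegment hpy t1 t2 tx hq
  have e2 : ∀ᶠ z : Plane × Plane in 𝓝 (p, y), 0 < orient z.1 z.2 a * orient p y a :=
    (ta.mul_const (orient p y a)).eventually (lt_mem_nhds (mul_self_pos.2 ha))
  filter_upwards [e1, e2, tx.eventually hN, tμ.eventually (gt_mem_nhds one_pos)]
    with z h1 h2 h3 h4 h5
  have haz : orient z.1 z.2 a ≠ 0 := fun h => by simp [h] at h2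
  have hqa : orient z.1 z.2 q * orient z.1 z.2 a ≤ 0 := by
    by_contra! h
    have h6 : 0 < (orient z.1 z.2 q * orient z.1 z.2 a) * (orient z.1 z.2 a * orient p y a) :=
      mul_pos h h2
    have h7 : 0 < orient z.1 z.2 a ^ 2 := by positivity
    nlinarith
  have hd : orient z.1 z.2 q - orient z.1 z.2 a ≠ 0 := by
    intro h
    rw [sub_eq_zero.1 h] at hqa
    exact haz (mul_self_eq_zero.1 (le_antisymm hqa (mul_self_nonneg _)))
  -- Over a squared denominator the sign is read off the numerator, where `hqa` applies.
  have hμ0 : 0 ≤ μ z := by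
    have : μ z = (orient z.1 z.2 q * (orient z.1 z.2 q - orient z.1 z.2 a)) /
        (orient z.1 z.2 q - orient z.1 z.2 a) ^ 2 := by
      simp only [hμ]; field_simp
    rw [this]
    apply div_nonneg _ (sq_nonneg _)
    nlinarith [sq_nonneg (orient z.1 z.2 q)]
  have hx0 : orient z.1 z.2 (AffineMap.lineMap q a (μ z)) = 0 := by
    rw [orient_lineMap_right]; simp only [hμ]; field_simp; ring
  refine ⟨_, h3, h1 hx0, mem_segment_iff_lineMap.2 ⟨_, ⟨hμ0, h4.le⟩, rfl⟩, fun hne heq => ?_⟩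
  rw [heq] at hx0
  exact hne hx0

variable {n : ℕ}

/-! ### Edges of a simple polygon -/

lemma edgeSet_eq (poly : Polygon Plane n) (i : Fin n) :
    poly.edgeSet ℝ i = segment ℝ (poly i) (poly (finRotate n i)) :=
  affineSegment_eq_segment _ _ _

/-- The relative interior of an edge. -/
def openEdge (poly : Polygon Plane n) (i : Fin n) : Set Plane :=
  openSegment ℝ (poly i) (poly (finRotate n i))

lemma openEdge_subset (poly : Polygon Plane n) (i : Fin n) :
    openEdge poly i ⊆ poly.edgeSet ℝ i := by
  rw [edgeSet_eq]; exact openSegment_subset_segment _ _ _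

lemma edgeSet_subset_boundary (poly : Polygon Plane n) (i : Fin n) :
    poly.edgeSet ℝ i ⊆ poly.boundary ℝ := subset_iUnion (fun i => poly.edgeSet ℝ i) i

lemma isCompact_segment (a b : Plane) : IsCompact (segment ℝ a b) := by
  rw [segment_eq_image_lineMap]
  exact isCompact_Icc.image AffineMap.lineMap_continuous

lemma isCompact_edgeSet (poly : Polygon Plane n) (i : Fin n) : IsCompact (poly.edgeSet ℝ i) := by
  rw [edgeSet_eq]; exact isCompact_segment _ _

lemma isClosed_boundary (poly : Polygon Plane n) : IsClosed (poly.boundary ℝ) :=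
  isClosed_iUnion_of_finite fun i => (isCompact_edgeSet poly i).isClosed

lemma left_mem_edge (poly : Polygon Plane n) (i : Fin n) : poly i ∈ poly.edgeSet ℝ i := by
  rw [edgeSet_eq]; exact left_mem_segment _ _ _

lemma right_mem_edge (poly : Polygon Plane n) (i : Fin n) :
    poly (finRotate n i) ∈ poly.edgeSet ℝ i := by
  rw [edgeSet_eq]; exact right_mem_segment _ _ _

lemma mem_edge_cases {poly : Polygon Plane n} {i : Fin n} {z : Plane}
    (hz : z ∈ poly.edgeSet ℝ i) :
    z = poly i ∨ z = poly (finRotate n i) ∨ z ∈ openEdge poly i := by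
  rw [edgeSet_eq, ← insert_endpoints_openSegment] at hz
  simpa [openEdge] using hz

lemma vertex_mem_boundary (poly : Polygon Plane n) (i : Fin n) : poly i ∈ poly.boundary ℝ :=
  edgeSet_subset_boundary poly i (left_mem_edge poly i)

lemma lineMap_injective_of_ne {a b : Plane} (h : a ≠ b) :
    Function.Injective (AffineMap.lineMap a b : ℝ → Plane) := fun s t hst => by
  rw [← lineParam_lineMap h s, hst, lineParam_lineMap h t]

lemma left_notMem_openSegment {a b : Plane} (h : a ≠ b) : a ∉ openSegment ℝ a b := by
  intro ha
  obtain ⟨t, ht, he⟩ := mem_openSegment_iff_lineMap.1 ha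
  have : t = 0 := lineMap_injective_of_ne h (by simpa using he)
  exact ht.1.ne' this

lemma right_notMem_openSegment {a b : Plane} (h : a ≠ b) : b ∉ openSegment ℝ a b := by
  rw [openSegment_symm]; exact left_notMem_openSegment h.symm

lemma ne_of_mem_openSegment {a b q : Plane} (hq : q ∈ openSegment ℝ a b) (hne : q ≠ a) :
    a ≠ b := by
  rintro rfl
  rw [openSegment_same] at hq
  exact hne hq

section Simple

variable {poly : Polygon Plane n} (hs : IsSimple poly)
include hs

lemma IsSimple.eq_of_mem {i j : Fin n} {z : Plane} (hi : z ∈ poly.edgeSet ℝ i)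
    (hi' : z ≠ poly (finRotate n i)) (hj : z ∈ poly.edgeSet ℝ j)
    (hj' : z ≠ poly (finRotate n j)) : i = j := by
  by_contra hne
  exact (Set.disjoint_left.1 (hs.disjoint i j hne)) ⟨hi, hi'⟩ ⟨hj, hj'⟩

lemma IsSimple.injective {i j : Fin n} (h : poly i = poly j) : i = j :=
  hs.eq_of_mem (left_mem_edge poly i) (hs.nondegenerate i) (h ▸ left_mem_edge poly j)
    (h ▸ hs.nondegenerate j)

lemma IsSimple.eq_of_vertex_mem {i j : Fin n} (h : poly i ∈ poly.edgeSet ℝ j) :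
    i = j ∨ i = finRotate n j := by
  by_cases hj : poly i = poly (finRotate n j)
  · exact Or.inr (hs.injective hj)
  · exact Or.inl (hs.eq_of_mem (left_mem_edge poly i) (hs.nondegenerate i) h hj)

lemma IsSimple.left_notMem_openEdge (j : Fin n) : poly j ∉ openEdge poly j :=
  left_notMem_openSegment (hs.nondegenerate j)

lemma IsSimple.right_notMem_openEdge (j : Fin n) : poly (finRotate n j) ∉ openEdge poly j :=
  right_notMem_openSegment (hs.nondegenerate j)

lemma IsSimple.vertex_notMem_openEdge (i j : Fin n) : poly i ∉ openEdge poly j := by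
  intro h
  rcases hs.eq_of_vertex_mem (openEdge_subset poly j h) with rfl | rfl
  · exact hs.left_notMem_openEdge _ h
  · exact hs.right_notMem_openEdge _ h

lemma IsSimple.eq_of_mem_openEdge {i j : Fin n} {z : Plane} (hj : z ∈ openEdge poly j)
    (hi : z ∈ poly.edgeSet ℝ i) : i = j := by
  have hv : ∀ k, z ≠ poly k := fun k h => hs.vertex_notMem_openEdge k j (h ▸ hj)
  exact hs.eq_of_mem hi (hv _) (openEdge_subset poly j hj) (hv _)

/-- Disjointness of half-open edges leaves only the case that `z` is also the terminal vertex of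
edge `j`. Then the two edges would be one segment run through in both directions, and an interior
point of it contradicts simplicity. -/
lemma IsSimple.adjacent_inter (j : Fin n) {z : Plane}
    (h1 : z ∈ poly.edgeSet ℝ ((finRotate n).symm j)) (h2 : z ∈ poly.edgeSet ℝ j) :
    z = poly j := by
  set i := (finRotate n).symm j with hi
  have hij : finRotate n i = j := Equiv.apply_symm_apply _ _
  have hne : i ≠ j := fun h => hs.nondegenerate i (by rw [hij, h])
  by_contra hz
  have h3 : z = poly (finRotate n j) := by
    by_contra h4
    exact hne (hs.eq_of_mem h1 (by rwa [hij]) h2 h4)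
  have h4 : i = finRotate n j :=
    hs.eq_of_mem h1 (by rwa [hij]) (h3 ▸ left_mem_edge poly _) (h3 ▸ hs.nondegenerate _)
  obtain ⟨m, hm⟩ : (openEdge poly j).Nonempty :=
    ⟨_, mem_openSegment_iff_lineMap.2 ⟨1 / 2, by norm_num, rfl⟩⟩
  have hm' : m ∈ poly.edgeSet ℝ i := by
    rw [edgeSet_eq, hij, h4, segment_symm, ← edgeSet_eq]; exact openEdge_subset _ _ hm
  exact hne (hs.eq_of_mem_openEdge hm hm')

end Simple

/-! ### Arms of a boundary point -/

/-- Near `q` the polygonal curve is the union of the two segments `q a` and `q b`, which meet in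
`q` only. -/
structure IsArms (poly : Polygon Plane n) (q a b : Plane) : Prop where
  left_ne : a ≠ q
  right_ne : b ≠ q
  subset : segment ℝ q a ∪ segment ℝ q b ⊆ poly.boundary ℝ
  locally_eq : ∃ N ∈ 𝓝 q, poly.boundary ℝ ∩ N ⊆ segment ℝ q a ∪ segment ℝ q b
  inter : ∀ z ∈ segment ℝ q a, z ∈ segment ℝ q b → z = q

lemma IsArms.symm {poly : Polygon Plane n} {q a b : Plane} (h : IsArms poly q a b) :
    IsArms poly q b a where
  left_ne := h.right_ne
  right_ne := h.left_ne
  subset := by rw [union_comm]; exact h.subset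
  locally_eq := by rw [union_comm]; exact h.locally_eq
  inter z hz hz' := h.inter z hz' hz

lemma IsArms.mem_boundary {poly : Polygon Plane n} {q a b : Plane} (h : IsArms poly q a b) :
    q ∈ poly.boundary ℝ := h.subset (Or.inl (left_mem_segment _ _ _))

lemma segment_split {a b q : Plane} (hq : q ∈ segment ℝ a b) :
    segment ℝ a b ⊆ segment ℝ q a ∪ segment ℝ q b := by
  obtain ⟨t, ht, rfl⟩ := mem_segment_iff_lineMap.1 hq
  intro z hz
  obtain ⟨s, hs, rfl⟩ := mem_segment_iff_lineMap.1 hz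
  have hw : ∀ {u v w : ℝ}, w ∈ segment ℝ u v →
      (AffineMap.lineMap a b w : Plane) ∈ segment ℝ (AffineMap.lineMap a b u : Plane)
        (AffineMap.lineMap a b v) := fun {u v w} h => by
    rw [← image_segment]; exact mem_image_of_mem _ h
  rcases le_total s t with h | h
  · left
    have := hw (u := t) (v := 0) (w := s) (by rw [segment_symm, segment_eq_Icc ht.1]; exact ⟨hs.1, h⟩)
    simpa using this
  · right
    have := hw (u := t) (v := 1) (w := s) (by rw [segment_eq_Icc ht.2]; exact ⟨h, hs.2⟩)
    simpa using this

lemma segment_split_inter {a b q z : Plane} (hab : a ≠ b) (hq : q ∈ openSegment ℝ a b)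
    (h1 : z ∈ segment ℝ q a) (h2 : z ∈ segment ℝ q b) : z = q := by
  obtain ⟨t, ht, rfl⟩ := mem_openSegment_iff_lineMap.1 hq
  obtain ⟨u, hu, rfl⟩ := mem_segment_iff_lineMap.1 h1
  obtain ⟨v, hv, hz⟩ := mem_segment_iff_lineMap.1 h2
  have h3 : (AffineMap.lineMap a b (t + v * (1 - t)) : Plane) =
      AffineMap.lineMap a b (t - u * t) := by
    have e1 : (AffineMap.lineMap a b (t + v * (1 - t)) : Plane) =
        AffineMap.lineMap (AffineMap.lineMap a b t : Plane) b v := by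
      apply plane_ext <;> simp only [lineMap_coord] <;> ring
    have e2 : (AffineMap.lineMap a b (t - u * t) : Plane) =
        AffineMap.lineMap (AffineMap.lineMap a b t : Plane) a u := by
      apply plane_ext <;> simp only [lineMap_coord] <;> ring
    rw [e1, e2, hz]
  have h4 := lineMap_injective_of_ne hab h3
  have h5 : u = 0 := by
    have := mul_nonneg hv.1 (sub_nonneg.2 ht.2.le)
    have := mul_nonneg hu.1 ht.1.le
    have h6 : u * t = 0 := by linarith
    exact (mul_eq_zero.1 h6).resolve_right ht.1.ne'
  simp [h5]

/-- The finitely many edges that miss `q` are closed, so they miss a neighbourhood of `q`. -/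
lemma exists_nhds_boundary_subset (poly : Polygon Plane n) (q : Plane) :
    ∃ N ∈ 𝓝 q, ∀ z ∈ N, ∀ i, z ∈ poly.edgeSet ℝ i → q ∈ poly.edgeSet ℝ i := by
  have : ∀ i, ∀ᶠ z in 𝓝 q, z ∈ poly.edgeSet ℝ i → q ∈ poly.edgeSet ℝ i := fun i => by
    by_cases hq : q ∈ poly.edgeSet ℝ i
    · exact Eventually.of_forall fun _ _ => hq
    · filter_upwards [(isCompact_edgeSet poly i).isClosed.isOpen_compl.mem_nhds hq] with z hz h
      exact absurd h hz
  have h2 := eventually_all.2 this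
  exact ⟨_, h2, fun z hz => hz⟩

section Simple

variable {poly : Polygon Plane n} (hs : IsSimple poly)
include hs

lemma IsSimple.isArms_openEdge {j : Fin n} {q : Plane} (hq : q ∈ openEdge poly j) :
    IsArms poly q (poly j) (poly (finRotate n j)) where
  left_ne h := hs.left_notMem_openEdge j (h ▸ hq)
  right_ne h := hs.right_notMem_openEdge j (h ▸ hq)
  subset := by
    refine subset_trans ?_ (edgeSet_subset_boundary poly j)
    have hq' := openEdge_subset poly j hq
    rw [edgeSet_eq] at hq' ⊢
    exact union_subset ((convex_segment _ _).segment_subset hq' (left_mem_segment _ _ _))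
      ((convex_segment _ _).segment_subset hq' (right_mem_segment _ _ _))
  locally_eq := by
    obtain ⟨N, hN, h⟩ := exists_nhds_boundary_subset poly q
    refine ⟨N, hN, fun z ⟨hz, hzN⟩ => ?_⟩
    obtain ⟨i, hi⟩ := mem_iUnion.1 hz
    have := hs.eq_of_mem_openEdge hq (h z hzN i hi)
    subst this
    rw [edgeSet_eq] at hi
    exact segment_split (openSegment_subset_segment _ _ _ hq) hi
  inter z h1 h2 := segment_split_inter (hs.nondegenerate j) hq h1 h2

lemma IsSimple.isArms_vertex (j : Fin n) :
    IsArms poly (poly j) (poly ((finRotate n).symm j)) (poly (finRotate n j)) where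
  left_ne h := by
    have := hs.nondegenerate ((finRotate n).symm j)
    rw [Equiv.apply_symm_apply] at this; exact this h
  right_ne h := hs.nondegenerate j h.symm
  subset := by
    apply union_subset
    · have := edgeSet_subset_boundary poly ((finRotate n).symm j)
      rwa [edgeSet_eq, Equiv.apply_symm_apply, segment_symm] at this
    · have := edgeSet_subset_boundary poly j
      rwa [edgeSet_eq] at this
  locally_eq := by
    obtain ⟨N, hN, h⟩ := exists_nhds_boundary_subset poly (poly j)
    refine ⟨N, hN, fun z ⟨hz, hzN⟩ => ?_⟩
    obtain ⟨i, hi⟩ := mem_iUnion.1 hz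
    rcases hs.eq_of_vertex_mem (h z hzN i hi) with rfl | rfl
    · right; rwa [edgeSet_eq] at hi
    · left; rw [edgeSet_eq, segment_symm] at hi; rwa [Equiv.symm_apply_apply]
  inter z h1 h2 := by
    apply hs.adjacent_inter j
    · rw [edgeSet_eq, Equiv.apply_symm_apply, segment_symm]; exact h1
    · rw [edgeSet_eq]; exact h2

end Simple

/-! ### Counting the points of the curve on a moving segment -/

/-- The points of the curve strictly between `p` and `y`. -/
def meets (poly : Polygon Plane n) (p y : Plane) : Set Plane :=
  openSegment ℝ p y ∩ poly.boundary ℝ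

lemma crossings_eq (poly : Polygon Plane n) {p y : Plane} (h : p ≠ y) :
    crossings poly p y = (meets poly p y).encard := by
  unfold crossings meets
  congr 1
  ext z
  constructor
  · rintro ⟨⟨hz, hb⟩, hn⟩
    rw [← insert_endpoints_openSegment] at hz
    simp only [mem_insert_iff, mem_singleton_iff, not_or] at hz hn
    exact ⟨(hz.resolve_left hn.1).resolve_left hn.2, hb⟩
  · rintro ⟨hz, hb⟩
    refine ⟨⟨openSegment_subset_segment _ _ _ hz, hb⟩, ?_⟩
    rintro (rfl | h1)
    · exact left_notMem_openSegment h hz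
    · rw [mem_singleton_iff] at h1
      subst h1
      exact right_notMem_openSegment h hz

lemma crossings_self (poly : Polygon Plane n) (p : Plane) : crossings poly p p = 0 := by
  unfold crossings
  rw [segment_same]
  rw [pair_eq_singleton, encard_eq_zero]
  exact eq_empty_of_forall_notMem fun x hx => hx.2 hx.1.1

lemma crossings_comm (poly : Polygon Plane n) (p y : Plane) :
    crossings poly p y = crossings poly y p := by
  unfold crossings
  rw [segment_symm, Set.pair_comm]

/-- The tube lemma for the parameter interval. -/
lemma eventually_segment_subset {p y : Plane} {U : Set Plane} (hU : IsOpen U)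
    (h : segment ℝ p y ⊆ U) :
    ∀ᶠ z : Plane × Plane in 𝓝 (p, y), segment ℝ z.1 z.2 ⊆ U := by
  have hc : Continuous fun w : (Plane × Plane) × ℝ =>
      (AffineMap.lineMap w.1.1 w.1.2 w.2 : Plane) := by
    simp only [AffineMap.lineMap_apply_module]; fun_prop
  have := isCompact_Icc.eventually_forall_of_forall_eventually (x₀ := (p, y))
    (K := Icc (0 : ℝ) 1) (P := fun z t => (AffineMap.lineMap z.1 z.2 t : Plane) ∈ U)
    (fun t ht => hc.continuousAt.eventually (hU.mem_nhds
      (h (mem_segment_iff_lineMap.2 ⟨t, ht, rfl⟩))))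
  filter_upwards [this] with z hz x hx
  obtain ⟨t, ht, rfl⟩ := mem_segment_iff_lineMap.1 hx
  exact hz t ht

/-- Local upper bounds become a global one by compactness of the segment: finitely many
neighbourhoods cover it and all nearby segments, and only those centred in `F` can contribute. The
filter `l` allows one-sided perturbations. -/
lemma eventually_encard_meets_le {poly : Polygon Plane n} {p y : Plane}
    {l : Filter (Plane × Plane)} (hl : l ≤ 𝓝 (p, y)) (F : Finset Plane) (m : Plane → ℕ)
    (h0 : ∀ q ∈ segment ℝ p y, q ∉ F → ∃ N ∈ 𝓝 q, ∀ᶠ z in l, meets poly z.1 z.2 ∩ N = ∅)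
    (hF : ∀ q ∈ F, ∃ N ∈ 𝓝 q, ∀ᶠ z in l, (meets poly z.1 z.2 ∩ N).encard ≤ m q) :
    ∀ᶠ z in l, (meets poly z.1 z.2).encard ≤ (∑ q ∈ F, m q : ℕ) := by
  classical
  set f : Plane → ℕ := fun q => if q ∈ F then m q else 0 with hf
  have H : ∀ q, ∃ N ∈ 𝓝 q, q ∈ segment ℝ p y →
      ∀ᶠ z in l, (meets poly z.1 z.2 ∩ N).encard ≤ f q := fun q => by
    by_cases hq : q ∈ F
    · obtain ⟨N, hN, h⟩ := hF q hq
      exact ⟨N, hN, fun _ => by simpa [hf, hq] using h⟩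
    · by_cases hq' : q ∈ segment ℝ p y
      · obtain ⟨N, hN, h⟩ := h0 q hq' hq
        exact ⟨N, hN, fun _ => by simpa [hf, hq] using h⟩
      · exact ⟨univ, univ_mem, fun h => absurd h hq'⟩
  choose N hN hNl using H
  obtain ⟨t, htK, htU⟩ := (isCompact_segment p y).elim_nhds_subcover
    (fun q => interior (N q)) (fun q _ => interior_mem_nhds.2 (hN q))
  have e1 := eventually_segment_subset
    (isOpen_biUnion fun q (_ : q ∈ t) => isOpen_interior (s := N q)) htU
  have e2 : ∀ᶠ z in l, ∀ q ∈ t, (meets poly z.1 z.2 ∩ N q).encard ≤ f q :=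
    (eventually_all_finset t).2 fun q hq => hNl q (htK q hq)
  filter_upwards [hl e1, e2] with z h1 h2
  have hsub : meets poly z.1 z.2 ⊆ ⋃ q ∈ t, meets poly z.1 z.2 ∩ N q := fun x hx => by
    obtain ⟨q, hq, hxq⟩ := mem_iUnion₂.1 (h1 (openSegment_subset_segment _ _ _ hx.1))
    exact mem_iUnion₂.2 ⟨q, hq, hx, interior_subset hxq⟩
  calc (meets poly z.1 z.2).encard ≤ (⋃ q ∈ t, meets poly z.1 z.2 ∩ N q).encard :=
        encard_le_encard hsub
    _ ≤ ∑ q ∈ t, (meets poly z.1 z.2 ∩ N q).encard := t.set_encard_biUnion_le _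
    _ ≤ ∑ q ∈ t, (f q : ℕ∞) := Finset.sum_le_sum h2
    _ = ((∑ q ∈ t, f q : ℕ) : ℕ∞) := by push_cast; rfl
    _ ≤ (∑ q ∈ F, m q : ℕ) := by
        norm_cast
        have h3 : ∑ q ∈ t, f q ≤ ∑ q ∈ t ∪ F, f q :=
          Finset.sum_le_sum_of_subset Finset.subset_union_left
        have h4 : ∑ q ∈ t ∪ F, f q = ∑ q ∈ F, f q := by
          symm
          apply Finset.sum_subset Finset.subset_union_right
          intro x _ hx
          simp [hf, hx]
        have h5 : ∑ q ∈ F, f q = ∑ q ∈ F, m q :=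
          Finset.sum_congr rfl fun x hx => by simp [hf, hx]
        omega

lemma sum_encard_inter_le {α β : Type*} (F : Finset β) (U : β → Set α)
    (hU : (F : Set β).PairwiseDisjoint U) (A : Set α) :
    ∑ q ∈ F, (A ∩ U q).encard ≤ A.encard := by
  classical
  induction F using Finset.induction_on generalizing A with
  | empty => simp
  | insert x F hx ih =>
    rw [Finset.sum_insert hx, ← encard_sdiff_add_encard_inter A (U x), add_comm]
    gcongr
    calc ∑ q ∈ F, (A ∩ U q).encard ≤ ∑ q ∈ F, (A \ U x ∩ U q).encard := by
          apply Finset.sum_le_sum fun q hq => encard_le_encard ?_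
          rintro z ⟨hz, hzq⟩
          refine ⟨⟨hz, fun hzx => ?_⟩, hzq⟩
          exact (disjoint_left.1 (hU (by simp) (by simp [hq]) (by rintro rfl; exact hx hq))) hzx hzq
      _ ≤ (A \ U x).encard := ih (hU.subset (by simp)) _

/-- Disjoint neighbourhoods of the points of `F` make the local lower bounds add up. -/
lemma eventually_le_encard_meets {poly : Polygon Plane n} {l : Filter (Plane × Plane)}
    (F : Finset Plane) (m : Plane → ℕ)
    (hF : ∀ q ∈ F, ∀ N ∈ 𝓝 q, ∀ᶠ z in l, (m q : ℕ∞) ≤ (meets poly z.1 z.2 ∩ N).encard) :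
    ∀ᶠ z in l, ((∑ q ∈ F, m q : ℕ) : ℕ∞) ≤ (meets poly z.1 z.2).encard := by
  obtain ⟨U, hU, hd⟩ := F.finite_toSet.t2_separation
  have e : ∀ᶠ z in l, ∀ q ∈ F, (m q : ℕ∞) ≤ (meets poly z.1 z.2 ∩ U q).encard :=
    (eventually_all_finset F).2 fun q hq => hF q hq _ ((hU q).2.mem_nhds (hU q).1)
  filter_upwards [e] with z hz
  push_cast
  exact (Finset.sum_le_sum hz).trans (sum_encard_inter_le F U hd _)

/-! ### Local counts at a transversal and at a tangential point -/

section Local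

variable {poly : Polygon Plane n} {p y q a b : Plane}

lemma tendsto_orient_pair (p y q : Plane) :
    Tendsto (fun z : Plane × Plane => orient z.1 z.2 q) (𝓝 (p, y)) (𝓝 (orient p y q)) :=
  (by fun_prop : Continuous fun z : Plane × Plane => orient z.1 z.2 q).tendsto (p, y)

lemma meets_inter_subset {N : Set Plane} (hN : poly.boundary ℝ ∩ N ⊆ segment ℝ q a ∪ segment ℝ q b)
    (p y : Plane) :
    meets poly p y ∩ N ⊆ {x | x ∈ segment ℝ q a ∪ segment ℝ q b ∧ orient p y x = 0} :=
  fun _ hx => ⟨hN ⟨hx.1.2, hx.2⟩, orient_of_mem_openSegment hx.1.1⟩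

lemma IsArms.transversal_le (h : IsArms poly q a b) (ht : orient p y a * orient p y b < 0) :
    ∃ N ∈ 𝓝 q, ∀ᶠ z in 𝓝 (p, y), (meets poly z.1 z.2 ∩ N).encard ≤ (1 : ℕ) := by
  obtain ⟨N, hN, hsub⟩ := h.locally_eq
  refine ⟨N, hN, ?_⟩
  filter_upwards [((tendsto_orient_pair p y a).mul (tendsto_orient_pair p y b)).eventually
    (gt_mem_nhds ht)] with z hz
  simpa using encard_le_one_iff_subsingleton.2
    ((arms_subsingleton (q := q) hz).anti (meets_inter_subset hsub z.1 z.2))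

/-- The ends `a` and `b` are on opposite sides, so wherever `q` falls, the moved line separates it
weakly from one of them and crosses that arm. -/
lemma IsArms.le_transversal (h : IsArms poly q a b) (ht : orient p y a * orient p y b < 0)
    (hpy : p ≠ y) (hq : q ∈ openSegment ℝ p y) {N : Set Plane} (hN : N ∈ 𝓝 q) :
    ∀ᶠ z in 𝓝 (p, y), ((1 : ℕ) : ℕ∞) ≤ (meets poly z.1 z.2 ∩ N).encard := by
  have ha : orient p y a ≠ 0 := fun h0 => by simp [h0] at ht
  have hb : orient p y b ≠ 0 := fun h0 => by simp [h0] at ht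
  filter_upwards [eventually_exists_arm_crossing hq hpy ha hN,
    eventually_exists_arm_crossing hq hpy hb hN] with z h1 h2
  rw [Nat.cast_one, one_le_encard_iff_nonempty]
  rcases le_or_gt (orient z.1 z.2 q * orient p y a) 0 with h3 | h3
  · obtain ⟨x, hxN, hx, hxa, -⟩ := h1 h3
    exact ⟨x, ⟨hx, h.subset (Or.inl hxa)⟩, hxN⟩
  · have h4 : orient z.1 z.2 q * orient p y b ≤ 0 := by
      by_contra! h5
      have := mul_pos h3 h5
      nlinarith [mul_nonneg (sq_nonneg (orient z.1 z.2 q)) (neg_nonneg.2 ht.le)]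
    obtain ⟨x, hxN, hx, hxb, -⟩ := h2 h4
    exact ⟨x, ⟨hx, h.subset (Or.inr hxb)⟩, hxN⟩

variable {σ : ℝ}

lemma IsArms.tangential_le_two (h : IsArms poly q a b) (ha : orient p y a ≠ 0)
    (hb : orient p y b ≠ 0) :
    ∃ N ∈ 𝓝 q, ∀ᶠ z in 𝓝 (p, y), (meets poly z.1 z.2 ∩ N).encard ≤ (2 : ℕ) := by
  obtain ⟨N, hN, hsub⟩ := h.locally_eq
  refine ⟨N, hN, ?_⟩
  filter_upwards [(tendsto_orient_pair p y a).eventually (isOpen_ne.mem_nhds ha),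
    (tendsto_orient_pair p y b).eventually (isOpen_ne.mem_nhds hb)] with z h1 h2
  have hsub' : meets poly z.1 z.2 ∩ N ⊆
      {x | x ∈ segment ℝ q a ∧ orient z.1 z.2 x = 0} ∪
      {x | x ∈ segment ℝ q b ∧ orient z.1 z.2 x = 0} := fun x hx => by
    obtain ⟨h3 | h3, h4⟩ := meets_inter_subset hsub z.1 z.2 hx
    · exact Or.inl ⟨h3, h4⟩
    · exact Or.inr ⟨h3, h4⟩
  have h5 := encard_le_one_iff_subsingleton.2 (arm_subsingleton (q := q) h1)
  have h6 := encard_le_one_iff_subsingleton.2 (arm_subsingleton (q := q) h2)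
  calc _ ≤ _ := encard_le_encard hsub'
    _ ≤ _ := encard_union_le _ _
    _ ≤ 1 + 1 := add_le_add h5 h6
    _ = ((2 : ℕ) : ℕ∞) := by norm_num

lemma mul_pos_of_sign {σ x y : ℝ} (hx : 0 < σ * x) (hy : 0 < σ * y) : 0 < x * y := by
  have h : 0 < σ ^ 2 * (x * y) := by have := mul_pos hx hy; nlinarith
  by_contra! h'
  exact h.not_ge (mul_nonpos_of_nonneg_of_nonpos (sq_nonneg σ) h')

lemma mul_nonpos_of_sign {σ x y : ℝ} (hx : σ * x ≤ 0) (hy : 0 < σ * y) : x * y ≤ 0 := by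
  by_contra! h
  rcases pos_and_pos_or_neg_and_neg_of_mul_pos h with ⟨h1, h2⟩ | ⟨h1, h2⟩
  · have h3 : 0 < σ := (pos_iff_pos_of_mul_pos hy).2 h2
    nlinarith
  · have h3 : σ < 0 := by
      by_contra! h4
      nlinarith
    nlinarith

/-- If the moved line leaves `q` on the same side as `a` and `b`, both arms stay strictly on that
side. -/
lemma IsArms.tangential_empty (h : IsArms poly q a b) (ha : 0 < σ * orient p y a)
    (hb : 0 < σ * orient p y b) :
    ∃ N ∈ 𝓝 q, ∀ᶠ z in 𝓝 (p, y), 0 < σ * orient z.1 z.2 q → meets poly z.1 z.2 ∩ N = ∅ := by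
  obtain ⟨N, hN, hsub⟩ := h.locally_eq
  refine ⟨N, hN, ?_⟩
  filter_upwards [((tendsto_orient_pair p y a).const_mul σ).eventually (lt_mem_nhds ha),
    ((tendsto_orient_pair p y b).const_mul σ).eventually (lt_mem_nhds hb)] with z h1 h2 h3
  refine eq_empty_of_forall_notMem fun x hx => ?_
  obtain ⟨h4 | h4, h5⟩ := meets_inter_subset hsub z.1 z.2 hx
  · exact arm_ne_zero (mul_pos_of_sign h3 h1) h4 h5
  · exact arm_ne_zero (mul_pos_of_sign h3 h2) h4 h5

lemma IsArms.one_le_tangential (h : IsArms poly q a b) (ha : 0 < σ * orient p y a)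
    (hpy : p ≠ y) (hq : q ∈ openSegment ℝ p y) {N : Set Plane} (hN : N ∈ 𝓝 q) :
    ∀ᶠ z in 𝓝 (p, y), σ * orient z.1 z.2 q ≤ 0 →
      ((1 : ℕ) : ℕ∞) ≤ (meets poly z.1 z.2 ∩ N).encard := by
  have ha0 : orient p y a ≠ 0 := fun h0 => by simp [h0] at ha
  filter_upwards [eventually_exists_arm_crossing hq hpy ha0 hN] with z h1 h3
  rw [Nat.cast_one, one_le_encard_iff_nonempty]
  obtain ⟨x, hxN, hx, hxa, -⟩ := h1 (mul_nonpos_of_sign h3 ha)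
  exact ⟨x, ⟨hx, h.subset (Or.inl hxa)⟩, hxN⟩

/-- With `q` pushed to the other side, each arm is crossed; the crossings differ because the arms
share only `q`, which is off the line. -/
lemma IsArms.two_le_tangential (h : IsArms poly q a b) (ha : 0 < σ * orient p y a)
    (hb : 0 < σ * orient p y b) (hpy : p ≠ y) (hq : q ∈ openSegment ℝ p y) {N : Set Plane}
    (hN : N ∈ 𝓝 q) :
    ∀ᶠ z in 𝓝 (p, y), σ * orient z.1 z.2 q < 0 →
      ((2 : ℕ) : ℕ∞) ≤ (meets poly z.1 z.2 ∩ N).encard := by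
  have ha0 : orient p y a ≠ 0 := fun h0 => by simp [h0] at ha
  have hb0 : orient p y b ≠ 0 := fun h0 => by simp [h0] at hb
  filter_upwards [eventually_exists_arm_crossing hq hpy ha0 hN,
    eventually_exists_arm_crossing hq hpy hb0 hN] with z h1 h2 h3
  have hne : orient z.1 z.2 q ≠ 0 := fun h0 => by simp [h0] at h3
  obtain ⟨x, hxN, hx, hxa, hxq⟩ := h1 (mul_nonpos_of_sign h3.le ha)
  obtain ⟨x', hxN', hx', hxb, -⟩ := h2 (mul_nonpos_of_sign h3.le hb)
  have hxx : x ≠ x' := by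
    rintro rfl
    exact hxq hne (h.inter x hxa hxb)
  rw [show ((2 : ℕ) : ℕ∞) = 2 by norm_num, ← encard_pair hxx]
  apply encard_le_encard
  rintro w (rfl | hw)
  · exact ⟨⟨hx, h.subset (Or.inl hxa)⟩, hxN⟩
  · rw [mem_singleton_iff] at hw
    subst hw
    exact ⟨⟨hx', h.subset (Or.inr hxb)⟩, hxN'⟩

lemma exists_nhds_meets_empty (hq : q ∉ poly.boundary ℝ) (l : Filter (Plane × Plane)) :
    ∃ N ∈ 𝓝 q, ∀ᶠ z in l, meets poly z.1 z.2 ∩ N = ∅ :=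
  ⟨_, (isClosed_boundary poly).isOpen_compl.mem_nhds hq, Eventually.of_forall fun _ =>
    eq_empty_of_forall_notMem fun _ hx => hx.2 hx.1.2⟩

end Local

/-! ### Points on a ray -/

/-- For `q` in front of `y` the lines `p q` and `p y` have the same sides, so transversality and
tangency depend on the ray only. -/
lemma exists_orient_scale {p y q : Plane} (hq : q ∈ openSegment ℝ p y) :
    ∃ t : ℝ, 0 < t ∧ ∀ a, orient p q a = t * orient p y a := by
  obtain ⟨t, ht, rfl⟩ := mem_openSegment_iff_lineMap.1 hq
  exact ⟨t, ht.1, fun a => by rw [orient_lineMap_mid]; simp⟩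

lemma openSegment_subset_of_mem {p y q : Plane} (hq : q ∈ openSegment ℝ p y) :
    openSegment ℝ p q ⊆ openSegment ℝ p y := by
  obtain ⟨t, ht, rfl⟩ := mem_openSegment_iff_lineMap.1 hq
  intro x hx
  obtain ⟨s, hs, rfl⟩ := mem_openSegment_iff_lineMap.1 hx
  refine mem_openSegment_iff_lineMap.2 ⟨s * t, ⟨mul_pos hs.1 ht.1, ?_⟩, ?_⟩
  · nlinarith [hs.1, hs.2, ht.1, ht.2]
  · apply plane_ext <;> simp only [lineMap_coord] <;> ring

lemma mem_openSegment_of_lt {p y : Plane} {s t : ℝ} (hs : 0 < s) (hst : s < t) :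
    (AffineMap.lineMap p y s : Plane) ∈ openSegment ℝ p (AffineMap.lineMap p y t) := by
  have ht : 0 < t := hs.trans hst
  refine mem_openSegment_iff_lineMap.2 ⟨s / t, ⟨div_pos hs ht, (div_lt_one ht).2 hst⟩, ?_⟩
  apply plane_ext <;> simp only [lineMap_coord] <;> field_simp <;> ring

lemma ray_trichotomy {p y q q' : Plane} (hq : q ∈ openSegment ℝ p y)
    (hq' : q' ∈ openSegment ℝ p y) :
    q ∈ openSegment ℝ p q' ∨ q = q' ∨ q' ∈ openSegment ℝ p q := by
  obtain ⟨t, ht, rfl⟩ := mem_openSegment_iff_lineMap.1 hq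
  obtain ⟨s, hs, rfl⟩ := mem_openSegment_iff_lineMap.1 hq'
  rcases lt_trichotomy t s with h | rfl | h
  · exact Or.inl (mem_openSegment_of_lt ht.1 h)
  · exact Or.inr (Or.inl rfl)
  · exact Or.inr (Or.inr (mem_openSegment_of_lt hs.1 h))

lemma dist_lt_of_mem_openSegment {p y q : Plane} (hpy : p ≠ y) (hq : q ∈ openSegment ℝ p y) :
    dist p q < dist p y := by
  obtain ⟨t, ht, rfl⟩ := mem_openSegment_iff_lineMap.1 hq
  rw [dist_left_lineMap, Real.norm_of_nonneg ht.1.le]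
  have := dist_pos.2 hpy
  nlinarith [ht.2]

lemma ne_of_mem_openSegment_left {p y q : Plane} (hpy : p ≠ y) (hq : q ∈ openSegment ℝ p y) :
    p ≠ q := fun h => left_notMem_openSegment hpy (h ▸ hq)

lemma meets_subset_of_mem {poly : Polygon Plane n} {p y q : Plane}
    (hq : q ∈ openSegment ℝ p y) : meets poly p q ⊆ meets poly p y :=
  inter_subset_inter_left _ (openSegment_subset_of_mem hq)

lemma lineParam_lineMap_right {p q : Plane} (hpq : p ≠ q) (a b : Plane) (t : ℝ) :
    lineParam p q (AffineMap.lineMap a b t) =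
      (1 - t) * lineParam p q a + t * lineParam p q b := by
  have := (plane_ne hpq).ne'
  simp only [lineParam, lineMap_coord]; field_simp; ring

/-! ### Types of boundary points, as seen from `p` -/

/-- The curve crosses the line `p q` at `q`. -/
def IsTransv (poly : Polygon Plane n) (p q : Plane) : Prop :=
  ∃ a b, IsArms poly q a b ∧ orient p q a * orient p q b < 0

/-- The curve touches the line through `p` and the `j`-th vertex there without crossing it. -/
def IsTang (poly : Polygon Plane n) (p : Plane) (j : Fin n) : Prop :=
  0 < orient p (poly j) (poly ((finRotate n).symm j)) * orient p (poly j) (poly (finRotate n j))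

/-- `u` and `u'` are the two endpoints of an edge. -/
def IsAdj (poly : Polygon Plane n) (u u' : Plane) : Prop :=
  ∃ j, (u = poly j ∧ u' = poly (finRotate n j)) ∨ (u = poly (finRotate n j) ∧ u' = poly j)

lemma IsAdj.symm {poly : Polygon Plane n} {u u' : Plane} (h : IsAdj poly u u') :
    IsAdj poly u' u := by
  obtain ⟨j, h | h⟩ := h
  · exact ⟨j, Or.inr ⟨h.2, h.1⟩⟩
  · exact ⟨j, Or.inl ⟨h.2, h.1⟩⟩

lemma IsAdj.exists_eq {poly : Polygon Plane n} {u u' : Plane} (h : IsAdj poly u u') :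
    ∃ i, u = poly i := by
  obtain ⟨j, h | h⟩ := h
  exacts [⟨_, h.1⟩, ⟨_, h.1⟩]

lemma IsAdj.segment_subset {poly : Polygon Plane n} {u u' : Plane} (h : IsAdj poly u u') :
    segment ℝ u u' ⊆ poly.boundary ℝ := by
  obtain ⟨j, ⟨rfl, rfl⟩ | ⟨rfl, rfl⟩⟩ := h
  · rw [← edgeSet_eq]; exact edgeSet_subset_boundary _ _
  · rw [segment_symm, ← edgeSet_eq]; exact edgeSet_subset_boundary _ _

lemma IsAdj.exists_isArms {poly : Polygon Plane n} (hs : IsSimple poly) {u u' : Plane}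
    (h : IsAdj poly u u') : ∃ t, IsAdj poly t u ∧ IsArms poly u t u' := by
  obtain ⟨j, ⟨rfl, rfl⟩ | ⟨rfl, rfl⟩⟩ := h
  · exact ⟨_, ⟨(finRotate n).symm j, Or.inl ⟨rfl, by rw [Equiv.apply_symm_apply]⟩⟩,
      hs.isArms_vertex j⟩
  · have := hs.isArms_vertex (finRotate n j)
    rw [Equiv.symm_apply_apply] at this
    exact ⟨_, ⟨finRotate n j, Or.inr ⟨rfl, rfl⟩⟩, this.symm⟩

lemma mem_openSegment_of_neg {a b p : Plane} {t : ℝ} (ht : t < 0)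
    (hp : p = AffineMap.lineMap a b t) : a ∈ openSegment ℝ p b := by
  have h1 : (1 - t) ≠ 0 := by linarith
  refine mem_openSegment_iff_lineMap.2 ⟨-t / (1 - t), ⟨div_pos (by linarith) (by linarith),
    (div_lt_one (by linarith)).2 (by linarith)⟩, ?_⟩
  rw [hp]
  apply plane_ext <;> simp only [lineMap_coord] <;> field_simp <;> ring

lemma mem_openSegment_of_collinear {a b p : Plane} (hab : a ≠ b) (h0 : orient p a b = 0)
    (hp : p ∉ segment ℝ a b) : a ∈ openSegment ℝ p b ∨ b ∈ openSegment ℝ p a := by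
  have h1 := eq_lineMap_lineParam hab (r := p) (by rw [orient_rotate]; exact h0)
  rcases lt_or_ge (lineParam a b p) 0 with h | h
  · exact Or.inl (mem_openSegment_of_neg h h1)
  rcases lt_or_ge 1 (lineParam a b p) with h' | h'
  · right
    apply mem_openSegment_of_neg (t := 1 - lineParam a b p) (by linarith)
    rw [AffineMap.lineMap_apply_one_sub]; exact h1
  · exact absurd (mem_segment_iff_lineMap.2 ⟨_, ⟨h, h'⟩, h1.symm⟩) hp

/-- As `p` is on the line of the edge but not on the edge, it lies beyond one endpoint; that one is
the near endpoint `u`. -/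
lemma IsSimple.exists_along {poly : Polygon Plane n} (hs : IsSimple poly) {p : Plane} {j : Fin n}
    (hp : p ∉ poly.boundary ℝ) (h0 : orient p (poly j) (poly (finRotate n j)) = 0) :
    ∃ u u', IsAdj poly u u' ∧ u ∈ openSegment ℝ p u' ∧ poly.edgeSet ℝ j = segment ℝ u u' := by
  have hp' : p ∉ segment ℝ (poly j) (poly (finRotate n j)) := by
    rw [← edgeSet_eq]; exact fun h => hp (edgeSet_subset_boundary _ _ h)
  rcases mem_openSegment_of_collinear (hs.nondegenerate j) h0 hp' with h | h
  · exact ⟨_, _, ⟨j, Or.inl ⟨rfl, rfl⟩⟩, h, edgeSet_eq _ _⟩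
  · exact ⟨_, _, ⟨j, Or.inr ⟨rfl, rfl⟩⟩, h, by rw [edgeSet_eq, segment_symm]⟩

/-- A boundary point `q` lies in an edge that points towards `p`. -/
def IsAlong (poly : Polygon Plane n) (p q : Plane) : Prop :=
  ∃ u u', IsAdj poly u u' ∧ u ∈ openSegment ℝ p u' ∧ q ∈ segment ℝ u u'

lemma IsSimple.isAlong {poly : Polygon Plane n} (hs : IsSimple poly) {p q : Plane} {j : Fin n}
    (hp : p ∉ poly.boundary ℝ) (hq : q ∈ poly.edgeSet ℝ j)
    (h0 : orient p (poly j) (poly (finRotate n j)) = 0) : IsAlong poly p q := by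
  obtain ⟨u, u', h1, h2, h3⟩ := hs.exists_along hp h0
  exact ⟨u, u', h1, h2, h3 ▸ hq⟩

lemma IsSimple.vertex_trichotomy {poly : Polygon Plane n} (hs : IsSimple poly) {p : Plane}
    (hp : p ∉ poly.boundary ℝ) (j : Fin n) :
    orient p (poly j) (poly ((finRotate n).symm j)) *
      orient p (poly j) (poly (finRotate n j)) < 0 ∨ IsTang poly p j ∨ IsAlong poly p (poly j) := by
  rcases lt_trichotomy (orient p (poly j) (poly ((finRotate n).symm j)) *
    orient p (poly j) (poly (finRotate n j))) 0 with h | h | h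
  · exact Or.inl h
  · right; right
    rcases mul_eq_zero.1 h with h | h
    · apply hs.isAlong (j := (finRotate n).symm j) hp
      · have := right_mem_edge poly ((finRotate n).symm j)
        rwa [Equiv.apply_symm_apply] at this
      · rw [Equiv.apply_symm_apply, orient_swap, h, neg_zero]
    · exact hs.isAlong hp (left_mem_edge _ _) h
  · exact Or.inr (Or.inl h)

/-- A boundary point is crossed transversally, or it is a vertex at which the curve is tangential,
or it lies in an edge that points towards `p`. -/
lemma IsSimple.classify {poly : Polygon Plane n} (hs : IsSimple poly) {p q : Plane}
    (hp : p ∉ poly.boundary ℝ) (hq : q ∈ poly.boundary ℝ) :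
    IsTransv poly p q ∨ (∃ j, q = poly j ∧ IsTang poly p j) ∨ IsAlong poly p q := by
  have vert : ∀ j, q = poly j →
      IsTransv poly p q ∨ (∃ j, q = poly j ∧ IsTang poly p j) ∨ IsAlong poly p q := by
    rintro j rfl
    rcases hs.vertex_trichotomy hp j with h | h | h
    · exact Or.inl ⟨_, _, hs.isArms_vertex j, h⟩
    · exact Or.inr (Or.inl ⟨j, rfl, h⟩)
    · exact Or.inr (Or.inr h)
  obtain ⟨j, hj⟩ := mem_iUnion.1 hq
  rcases mem_edge_cases hj with h | h | h
  · exact vert _ h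
  · exact vert _ h
  · by_cases h0 : orient p (poly j) (poly (finRotate n j)) = 0
    · exact Or.inr (Or.inr (hs.isAlong hp hj h0))
    · left
      refine ⟨_, _, hs.isArms_openEdge h, ?_⟩
      -- The two sides multiply to `-t * (1 - t)` times the square of the nonzero value in `h0`.
      obtain ⟨t, ht, rfl⟩ := mem_openSegment_iff_lineMap.1 h
      rw [orient_lineMap_mid, orient_lineMap_mid, orient_swap p (poly j) (poly (finRotate n j)),
        orient_self_right, orient_self_right]
      have h1 : 0 < orient p (poly j) (poly (finRotate n j)) ^ 2 := by positivity
      have h2 : 0 < t * (1 - t) := mul_pos ht.1 (sub_pos.2 ht.2)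
      nlinarith [mul_pos h1 h2]

/-- An edge that points towards `p` is met in infinitely many points by any segment from `p` that
reaches beyond its near endpoint. -/
lemma infinite_meets_of_along {poly : Polygon Plane n} {p u u' y : Plane} (hpu : p ≠ u')
    (hadj : IsAdj poly u u') {r T : ℝ} (hr : r ∈ Ioo (0 : ℝ) 1)
    (hu : u = AffineMap.lineMap p u' r) (hT : r < T) (hy : y = AffineMap.lineMap p u' T) :
    (meets poly p y).Infinite := by
  have h1 : (Ioo r (min 1 T)).Infinite := Ioo_infinite (lt_min hr.2 hT)
  refine (h1.image (lineMap_injective_of_ne hpu).injOn).mono ?_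
  rintro _ ⟨s, ⟨hs1, hs2⟩, rfl⟩
  refine ⟨hy ▸ mem_openSegment_of_lt (hr.1.trans hs1) (hs2.trans_le (min_le_right _ _)),
    hadj.segment_subset ?_⟩
  have hs3 : s ≤ 1 := hs2.le.trans (min_le_left _ _)
  have h1r : 0 < 1 - r := sub_pos.2 hr.2
  refine mem_segment_iff_lineMap.2 ⟨(s - r) / (1 - r), ⟨div_nonneg (by linarith) h1r.le,
    (div_le_one h1r).2 (by linarith)⟩, ?_⟩
  rw [hu]
  apply plane_ext <;> simp only [lineMap_coord] <;> field_simp <;> ring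

/-- Used contrapositively: a finite count leaves only transversal and tangential points on the
segment. -/
lemma infinite_meets_of_mem_along {poly : Polygon Plane n} {p u u' y q : Plane} (hpu : p ≠ u')
    (hadj : IsAdj poly u u') (hu : u ∈ openSegment ℝ p u') (hq : q ∈ segment ℝ u u')
    (hqy : q ∈ openSegment ℝ p y) : (meets poly p y).Infinite := by
  obtain ⟨r, hr, hr'⟩ := mem_openSegment_iff_lineMap.1 hu
  obtain ⟨m, hm, rfl⟩ := mem_segment_iff_lineMap.1 hq
  obtain ⟨t, ht, ht'⟩ := mem_openSegment_iff_lineMap.1 hqy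
  have h1 : r ≤ r + m * (1 - r) := le_add_of_nonneg_right (mul_nonneg hm.1 (sub_nonneg.2 hr.2.le))
  have h2 : 0 < r + m * (1 - r) := hr.1.trans_le h1
  -- On the ray towards `u'` the point `q` has parameter `r + m * (1 - r)`, and `y` is `1 / t` times
  -- as far from `p`.
  refine infinite_meets_of_along hpu hadj hr hr'.symm (T := (r + m * (1 - r)) / t) ?_ ?_
  · rw [lt_div_iff₀ ht.1]; nlinarith [hr.1, ht.2]
  · have ht0 := ht.1.ne'
    have e : ∀ i, p i + t * (y i - p i) = u i + m * (u' i - u i) := fun i => by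
      rw [← lineMap_coord, ← lineMap_coord, ht']
    have e' : ∀ i, u i = p i + r * (u' i - p i) := fun i => by rw [← lineMap_coord, hr']
    apply plane_ext <;> rw [lineMap_coord]
    · have := e 0; rw [e' 0] at this
      field_simp; linear_combination this
    · have := e 1; rw [e' 1] at this
      field_simp; linear_combination this

lemma infinite_meets_of_isAdj {poly : Polygon Plane n} {p u u' : Plane} (hpu : p ≠ u')
    (hadj : IsAdj poly u u') (hu : u ∈ openSegment ℝ p u') : (meets poly p u').Infinite := by
  obtain ⟨r, hr, hr'⟩ := mem_openSegment_iff_lineMap.1 hu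
  exact infinite_meets_of_along hpu hadj hr hr'.symm hr.2 (by simp)

/-- The two edges at a vertex cannot both point away from `p`. -/
lemma IsArms.not_both_beyond {poly : Polygon Plane n} {p u a b : Plane} (h : IsArms poly u a b)
    (ha : u ∈ openSegment ℝ p a) (hb : u ∈ openSegment ℝ p b) (hpu : p ≠ u) : False := by
  have inv : ∀ {c}, u ∈ openSegment ℝ p c → ∃ s : ℝ, 1 < s ∧ c = AffineMap.lineMap p u s :=
    fun {c} hc => by
      obtain ⟨r, hr, hr'⟩ := mem_openSegment_iff_lineMap.1 hc
      have := hr.1.ne'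
      refine ⟨1 / r, (one_lt_div hr.1).2 hr.2, ?_⟩
      rw [← hr']
      apply plane_ext <;> simp only [lineMap_coord] <;> field_simp <;> ring
  obtain ⟨s, hs, rfl⟩ := inv ha
  obtain ⟨t, ht, rfl⟩ := inv hb
  -- The nearer of the two far ends lies on both arms, so it would have to be `u`, which has
  -- parameter 1.
  set m := min s t with hm
  have hm1 : 1 < m := lt_min hs ht
  have key : ∀ c, 1 < c → m ≤ c →
      (AffineMap.lineMap p u m : Plane) ∈ segment ℝ u (AffineMap.lineMap p u c) := fun c hc hmc => by
    have hc1 : c - 1 ≠ 0 := by linarith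
    refine mem_segment_iff_lineMap.2 ⟨(m - 1) / (c - 1), ⟨div_nonneg (by linarith)
      (by linarith), (div_le_one (by linarith)).2 (by linarith)⟩, ?_⟩
    apply plane_ext <;> simp only [lineMap_coord] <;> field_simp <;> ring
  have := h.inter _ (key _ hs (min_le_left _ _)) (key _ ht (min_le_right _ _))
  have h2 : m = 1 := lineMap_injective_of_ne hpu (by simpa using this)
  exact hm1.ne' h2

lemma mem_segment_of_between {p w q q' : Plane} (h : q ∈ openSegment ℝ p q')
    (h' : q' ∈ openSegment ℝ p w) : q' ∈ segment ℝ w q := by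
  obtain ⟨s, hs, rfl⟩ := mem_openSegment_iff_lineMap.1 h
  obtain ⟨t, ht, rfl⟩ := mem_openSegment_iff_lineMap.1 h'
  have h1 : s * t < t := by nlinarith [hs.2, ht.1]
  have h2 : 1 - s * t ≠ 0 := by linarith [ht.2]
  refine mem_segment_iff_lineMap.2 ⟨(1 - t) / (1 - s * t), ⟨div_nonneg (by linarith [ht.2])
    (by linarith [ht.2]), (div_le_one (by linarith [ht.2])).2 (by linarith)⟩, ?_⟩
  have hm : (1 - t) / (1 - s * t) * (1 - s * t) = 1 - t := div_mul_cancel₀ _ h2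
  apply plane_ext <;> simp only [lineMap_coord]
  · linear_combination -(w 0 - p 0) * hm
  · linear_combination -(w 1 - p 1) * hm

/-- The two edges at a vertex cannot both point towards `p`. -/
lemma IsArms.not_both_before {poly : Polygon Plane n} {p u a b : Plane} (h : IsArms poly u a b)
    (ha : a ∈ openSegment ℝ p u) (hb : b ∈ openSegment ℝ p u) : False := by
  rcases ray_trichotomy ha hb with h1 | h1 | h1
  · exact h.right_ne (h.inter b (mem_segment_of_between h1 hb) (right_mem_segment _ _ _))
  · exact h.left_ne (h.inter a (right_mem_segment _ _ _) (h1 ▸ right_mem_segment _ _ _))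
  · exact h.left_ne (h.inter a (right_mem_segment _ _ _) (mem_segment_of_between h1 ha))

/-! ### Local counts, in terms of the type of the point -/

section Counts

variable {poly : Polygon Plane n} {p y q : Plane}

lemma IsTransv.exists_arms (h : IsTransv poly p q) (hq : q ∈ openSegment ℝ p y) :
    ∃ a b, IsArms poly q a b ∧ orient p y a * orient p y b < 0 := by
  obtain ⟨a, b, hab, h⟩ := h
  obtain ⟨t, ht, hta⟩ := exists_orient_scale hq
  refine ⟨a, b, hab, ?_⟩
  rw [hta, hta] at h
  by_contra! h1
  nlinarith [mul_nonneg (mul_pos ht ht).le h1]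

lemma IsTransv.eventually_le (h : IsTransv poly p q) (hq : q ∈ openSegment ℝ p y) :
    ∃ N ∈ 𝓝 q, ∀ᶠ z in 𝓝 (p, y), (meets poly z.1 z.2 ∩ N).encard ≤ (1 : ℕ) := by
  obtain ⟨a, b, hab, h⟩ := h.exists_arms hq
  exact hab.transversal_le h

lemma IsTransv.eventually_ge (h : IsTransv poly p q) (hpy : p ≠ y) (hq : q ∈ openSegment ℝ p y)
    {N : Set Plane} (hN : N ∈ 𝓝 q) :
    ∀ᶠ z in 𝓝 (p, y), ((1 : ℕ) : ℕ∞) ≤ (meets poly z.1 z.2 ∩ N).encard := by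
  obtain ⟨a, b, hab, h⟩ := h.exists_arms hq
  exact hab.le_transversal h hpy hq hN

/-- Segments from near `p` to the fixed vertex `w` do not meet the curve near `w`. -/
lemma IsArms.eventually_openSegment_inter_arm {w a : Plane} (hpw : p ≠ w) (haw : a ≠ w)
    (hp : p ∉ segment ℝ w a) (ha : a ∉ openSegment ℝ p w) :
    ∀ᶠ p' in 𝓝 p, ∀ x ∈ openSegment ℝ p' w, x ∉ segment ℝ w a := by
  have hne : ∀ᶠ p' in 𝓝 p, p' ≠ w := isOpen_ne.mem_nhds hpw
  -- If `a` is collinear with `p` and `w`, it lies beyond `w`, and it keeps a projection parameter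
  -- above 1 as `p` moves, so the arm stays behind `w`. Otherwise moved lines meet the arm in `w`
  -- only.
  by_cases h0 : orient p w a = 0
  · have h1 := eq_lineMap_lineParam hpw h0
    have h2 : 1 < lineParam p w a := by
      by_contra! h2
      rcases h2.eq_or_lt with h2 | h2
      · rw [h2] at h1; exact haw (by simpa using h1)
      rcases le_or_gt (lineParam p w a) 0 with h3 | h3
      · apply hp
        rcases h3.eq_or_lt with h3 | h3
        · rw [h3] at h1
          rw [show a = p by simpa using h1]
          exact right_mem_segment _ _ _
        · have := openSegment_subset_segment _ _ _ (mem_openSegment_of_neg h3 h1)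
          rwa [segment_symm]
      · exact ha (mem_openSegment_iff_lineMap.2 ⟨_, ⟨h3, h2⟩, h1.symm⟩)
    have h3 := (tendsto_lineParam hpw tendsto_id tendsto_const_nhds
      (tendsto_const_nhds (x := a))).eventually (lt_mem_nhds h2)
    filter_upwards [h3, hne] with p' h4 h5 x hx hxa
    obtain ⟨m, hm, rfl⟩ := mem_segment_iff_lineMap.1 hxa
    have h6 := ((mem_openSegment_iff_lineParam h5).1 hx).2.2
    have h7 : lineParam p' w w = 1 := by
      have := lineParam_lineMap h5 1
      simpa using this
    rw [lineParam_lineMap_right h5, h7] at h6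
    simp only [id] at h4
    nlinarith [hm.1, hm.2]
  · have h1 : ∀ᶠ p' in 𝓝 p, orient p' w a ≠ 0 :=
      (tendsto_orient tendsto_id tendsto_const_nhds tendsto_const_nhds).eventually
        (isOpen_ne.mem_nhds h0)
    filter_upwards [h1, hne] with p' h2 h3 x hx hxa
    have : x = w := arm_eq_base (by simp) h2 hxa (orient_of_mem_openSegment hx)
    subst this
    exact right_notMem_openSegment h3 hx

/-- Keeps the target vertex `w` from contributing to the count while only the pursuer moves. -/
lemma IsArms.eventually_empty {w a b : Plane} (h : IsArms poly w a b)
    (hp : p ∉ poly.boundary ℝ) (ha : a ∉ openSegment ℝ p w) (hb : b ∉ openSegment ℝ p w) :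
    ∃ N ∈ 𝓝 w, ∀ᶠ z : Plane × Plane in 𝓝 (p, w), z.2 = w → meets poly z.1 z.2 ∩ N = ∅ := by
  obtain ⟨N, hN, hsub⟩ := h.locally_eq
  have hpw : p ≠ w := fun e => hp (e ▸ h.mem_boundary)
  have t1 : Tendsto (fun z : Plane × Plane => z.1) (𝓝 (p, w)) (𝓝 p) := continuous_fst.tendsto _
  refine ⟨N, hN, ?_⟩
  filter_upwards [t1.eventually (eventually_openSegment_inter_arm hpw h.left_ne
      (fun e => hp (h.subset (Or.inl e))) ha),
    t1.eventually (eventually_openSegment_inter_arm hpw h.right_ne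
      (fun e => hp (h.subset (Or.inr e))) hb)] with z h1 h2 h3
  refine eq_empty_of_forall_notMem fun x hx => ?_
  rw [h3] at hx
  rcases hsub ⟨hx.1.2, hx.2⟩ with h4 | h4
  · exact h1 x hx.1.1 h4
  · exact h2 x hx.1.1 h4

end Counts

/-- Both sides of a line are approached at each of its points. -/
lemma frequently_side {p w v : Plane} (hwv : w ≠ v) (h0 : orient p w v = 0) {c : ℝ} (hc : c ≠ 0) :
    ∃ᶠ p' in 𝓝 p, 0 < c * orient p' w v := by
  -- `r` is `w` displaced along the normal of `w v` by a multiple `c`, which gives `orient r w v`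
  -- the sign of `c`; `p` is then moved towards `r`.
  set r : Plane := !₂[w 0 - c * (v 1 - w 1), w 1 + c * (v 0 - w 0)] with hr
  have hrv : orient r w v = c * ((v 0 - w 0) ^ 2 + (v 1 - w 1) ^ 2) := by
    simp [orient, hr]; ring
  have hd := plane_ne hwv
  have ht : Tendsto (fun t : ℝ => (AffineMap.lineMap p r t : Plane)) (𝓝[>] 0) (𝓝 p) := by
    have : Continuous fun t : ℝ => (AffineMap.lineMap p r t : Plane) :=
      AffineMap.lineMap_continuous
    have h2 := this.tendsto 0
    rw [AffineMap.lineMap_apply_zero] at h2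
    exact h2.mono_left nhdsWithin_le_nhds
  refine ht.frequently (Eventually.frequently ?_)
  filter_upwards [self_mem_nhdsWithin] with t ht
  rw [orient_lineMap_left, h0, hrv]
  have h3 : 0 < c ^ 2 := by positivity
  have := mul_pos (mul_pos h3 hd) (mem_Ioi.1 ht)
  nlinarith

/-! ### Consequences of lying off the partition lines -/

/-- The part of the region that is cut into cells. -/
def cellDomain (poly : Polygon Plane n) (P : Set Plane) (k : ℕ) : Set Plane :=
  interior P \ partitionLines poly P k

section Domain

variable {poly : Polygon Plane n} {P : Set Plane} {k : ℕ} {p : Plane}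

lemma isClosed_partitionLines : IsClosed (partitionLines poly P k) := by
  have : partitionLines poly P k = ⋃ i : Fin n, ⋃ m ∈ {m : ℕ | Even m ∧ m ≤ k},
      frontier (visibilityPolygon poly P m (poly i)) := by
    ext x
    simp only [partitionLines, mem_ofPred_eq, mem_iUnion, exists_prop, and_assoc]
  rw [this]
  refine isClosed_iUnion_of_finite fun i => ?_
  exact ((finite_Iic k).subset fun m hm => hm.2).isClosed_biUnion fun m _ => isClosed_frontier

lemma isOpen_cellDomain : IsOpen (cellDomain poly P k) :=
  isOpen_interior.sdiff isClosed_partitionLines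

lemma notMem_boundary_of_mem_interior (hP : IsRegionOf P poly) (hp : p ∈ interior P) :
    p ∉ poly.boundary ℝ := by
  rw [← hP.frontier_eq]
  exact fun h => h.2 hp

lemma notMem_boundary (hP : IsRegionOf P poly) (hp : p ∈ cellDomain poly P k) :
    p ∉ poly.boundary ℝ := notMem_boundary_of_mem_interior hP hp.1

lemma ne_of_mem_domain (hP : IsRegionOf P poly) (hp : p ∈ cellDomain poly P k) {q : Plane}
    (hq : q ∈ poly.boundary ℝ) : p ≠ q :=
  fun h => notMem_boundary hP hp (h ▸ hq)

lemma frequently_nhds_self {Q : Plane → Prop} (h : Q p) : ∃ᶠ p' in 𝓝 p, Q p' :=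
  fun h' => h'.self_of_nhds h

/-- Off the partition lines, visibility of a vertex cannot change. -/
lemma not_frequently_both (hp : p ∈ cellDomain poly P k) (i : Fin n) {m : ℕ}
    (hm : Even m) (hmk : m ≤ k) (h1 : ∃ᶠ p' in 𝓝 p, crossings poly p' (poly i) ≤ m)
    (h2 : ∃ᶠ p' in 𝓝 p, ¬ crossings poly p' (poly i) ≤ m) : False := by
  apply hp.2
  refine ⟨i, m, hm, hmk, ?_⟩
  rw [frontier_eq_closure_inter_closure]
  have hint : ∀ᶠ p' in 𝓝 p, p' ∈ P := mem_interior_iff_mem_nhds.1 hp.1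
  refine ⟨mem_closure_iff_frequently.2 ?_, mem_closure_iff_frequently.2 ?_⟩
  · refine (h1.and_eventually hint).mono fun p' h => ⟨h.2, ?_⟩
    rw [KVisible, crossings_comm]; exact h.1
  · refine h2.mono fun p' h h' => h ?_
    rw [crossings_comm]; exact h'.2

/-- The level `m = k` of the cell condition. -/
lemma eventually_vertex_iff (hk : Even k) (hp : p ∈ cellDomain poly P k) (i : Fin n) :
    ∀ᶠ p' in 𝓝 p, (crossings poly p' (poly i) ≤ k ↔ crossings poly p (poly i) ≤ k) := by
  have := not_frequently_both hp i hk le_rfl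
  by_cases h : crossings poly p (poly i) ≤ k
  · simp only [h, iff_true]
    by_contra h2
    exact this (frequently_nhds_self h) (not_eventually.1 h2)
  · simp only [h, iff_false]
    by_contra h2
    refine this ?_ (frequently_nhds_self h)
    simpa only [not_eventually, not_not] using h2

end Domain

/-! ### Counts on segments with transversal points and at most one tangential vertex -/

section Counts

variable {poly : Polygon Plane n} {p y : Plane}

/-- The end `y` has its own bound `M`, because it may lie on the curve and a moved segment may then
cross the curve near it. -/
lemma eventually_encard_meets_le_add {l : Filter (Plane × Plane)} (hl : l ≤ 𝓝 (p, y))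
    (hp : p ∉ poly.boundary ℝ) (F : Finset Plane) (m : Plane → ℕ) (M : ℕ)
    (hsub : meets poly p y ⊆ F) (hyF : y ∉ F)
    (hF : ∀ q ∈ F, ∃ N ∈ 𝓝 q, ∀ᶠ z in l, (meets poly z.1 z.2 ∩ N).encard ≤ m q)
    (hy : ∃ N ∈ 𝓝 y, ∀ᶠ z in l, (meets poly z.1 z.2 ∩ N).encard ≤ M) :
    ∀ᶠ z in l, (meets poly z.1 z.2).encard ≤ (∑ q ∈ F, m q + M : ℕ) := by
  classical
  have := eventually_encard_meets_le (poly := poly) hl (insert y F) (fun q => if q = y then M else m q)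
    (fun q hq hqF => ?_) (fun q hq => ?_)
  · rw [Finset.sum_insert hyF, if_pos rfl, add_comm] at this
    convert this using 6 with z
    rename_i q hq
    rw [if_neg]; rintro rfl; exact hyF hq
  · apply exists_nhds_meets_empty
    intro hb
    simp only [Finset.mem_insert, not_or] at hqF
    rw [← insert_endpoints_openSegment] at hq
    rcases hq with rfl | rfl | hq
    · exact hp hb
    · exact hqF.1 rfl
    · exact hqF.2 (hsub ⟨hq, hb⟩)
  · rcases Finset.mem_insert.1 hq with h | h
    · subst h; simpa using hy
    · have hqy : q ≠ y := fun e => hyF (e ▸ h)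
      rw [if_neg hqy]
      exact hF q h

/-- The points of `F` are crossed transversally by the segment from `p` to `y`. -/
def TransvOn (poly : Polygon Plane n) (p y : Plane) (F : Finset Plane) : Prop :=
  ∀ q ∈ F, q ∈ openSegment ℝ p y ∧ IsTransv poly p q

/-- Transversal points survive perturbation; with `k + 1` of them the far end stays hidden. -/
lemma TransvOn.eventually_ge {F : Finset Plane} (h : TransvOn poly p y F) (hpy : p ≠ y) :
    ∀ᶠ z in 𝓝 (p, y), (F.card : ℕ∞) ≤ (meets poly z.1 z.2).encard := by
  simpa using eventually_le_encard_meets F (fun _ => 1)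
    fun q hq N hN => (h q hq).2.eventually_ge hpy (h q hq).1 hN

lemma TransvOn.eventually_le {F : Finset Plane} (h : TransvOn poly p y F) (hpy : p ≠ y)
    (hp : p ∉ poly.boundary ℝ) {l : Filter (Plane × Plane)} (hl : l ≤ 𝓝 (p, y))
    (hsub : meets poly p y ⊆ F) {M : ℕ}
    (hy : ∃ N ∈ 𝓝 y, ∀ᶠ z in l, (meets poly z.1 z.2 ∩ N).encard ≤ M) :
    ∀ᶠ z in l, (meets poly z.1 z.2).encard ≤ (F.card + M : ℕ) := by
  have := eventually_encard_meets_le_add hl hp F (fun _ => 1) M hsub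
    (fun hyF => right_notMem_openSegment hpy (h y hyF).1) (fun q hq => by
      obtain ⟨N, hN, h'⟩ := (h q hq).2.eventually_le (h q hq).1
      exact ⟨N, hN, hl h'⟩) hy
  simpa using this

section Tangential

variable {F : Finset Plane} {i : Fin n} {σ : ℝ}

lemma sum_insert_ite (F : Finset Plane) {v : Plane} (hv : v ∉ F) (c : ℕ) :
    ∑ q ∈ insert v F, (if q = v then c else 1) = F.card + c := by
  classical
  rw [Finset.sum_insert hv, if_pos rfl, Finset.sum_congr rfl (g := fun _ => 1)]
  · simp [add_comm]
  · intro q hq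
    rw [if_neg]; rintro rfl; exact hv hq

variable (hs : IsSimple poly) (hF : TransvOn poly p y F) (hpy : p ≠ y)
  (hi : poly i ∈ openSegment ℝ p y) (hiF : poly i ∉ F)
  (ha : 0 < σ * orient p (poly i) (poly ((finRotate n).symm i)))
  (hb : 0 < σ * orient p (poly i) (poly (finRotate n i)))

include hi in
lemma side_arm {a : Plane} (h : 0 < σ * orient p (poly i) a) : 0 < σ * orient p y a := by
  obtain ⟨t, ht, hta⟩ := exists_orient_scale hi
  rw [hta] at h
  by_contra! h'
  nlinarith [mul_nonneg ht.le (neg_nonneg.2 h')]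

include hF hpy hiF in
lemma TransvOn.eventually_ge_tang {c : ℕ} {S : Set (Plane × Plane)}
    (hc : ∀ N ∈ 𝓝 (poly i), ∀ᶠ z in 𝓝 (p, y), z ∈ S →
      (c : ℕ∞) ≤ (meets poly z.1 z.2 ∩ N).encard) :
    ∀ᶠ z in 𝓝 (p, y), z ∈ S → ((F.card + c : ℕ) : ℕ∞) ≤ (meets poly z.1 z.2).encard := by
  classical
  have := eventually_le_encard_meets (poly := poly) (l := 𝓝 (p, y) ⊓ 𝓟 S) (insert (poly i) F)
    (fun q => if q = poly i then c else 1) (fun q hq N hN => by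
      rcases Finset.mem_insert.1 hq with rfl | hq
      · rw [if_pos rfl]; exact eventually_inf_principal.2 (hc N hN)
      · rw [if_neg (by rintro rfl; exact hiF hq)]
        exact ((hF q hq).2.eventually_ge hpy (hF q hq).1 hN).filter_mono inf_le_left)
  rw [sum_insert_ite F hiF] at this
  exact eventually_inf_principal.1 this

include hF hpy hi hiF in
lemma TransvOn.eventually_le_tang (hp : p ∉ poly.boundary ℝ) {l : Filter (Plane × Plane)}
    (hl : l ≤ 𝓝 (p, y)) (hsub : meets poly p y ⊆ insert (poly i) (F : Set Plane)) {c M : ℕ}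
    (hc : ∃ N ∈ 𝓝 (poly i), ∀ᶠ z in l, (meets poly z.1 z.2 ∩ N).encard ≤ c)
    (hy : ∃ N ∈ 𝓝 y, ∀ᶠ z in l, (meets poly z.1 z.2 ∩ N).encard ≤ M) :
    ∀ᶠ z in l, (meets poly z.1 z.2).encard ≤ (F.card + c + M : ℕ) := by
  classical
  have hyF : y ∉ insert (poly i) F := fun h => by
    rcases Finset.mem_insert.1 h with h | h
    · exact right_notMem_openSegment hpy (h ▸ hi)
    · exact right_notMem_openSegment hpy (hF y h).1
  have := eventually_encard_meets_le_add hl hp (insert (poly i) F)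
    (fun q => if q = poly i then c else 1) M (by simpa using hsub) hyF (fun q hq => by
      rcases Finset.mem_insert.1 hq with rfl | hq
      · rw [if_pos rfl]; exact hc
      · rw [if_neg (by rintro rfl; exact hiF hq)]
        obtain ⟨N, hN, h'⟩ := (hF q hq).2.eventually_le (hF q hq).1
        exact ⟨N, hN, hl h'⟩) hy
  rwa [sum_insert_ite F hiF] at this

include hs hF hpy hi hiF ha hb

/-- The side is expressed by the far end `z.2` relative to the line from `z.1` through the vertex.
If `z.2` is on the side of the arms, the vertex is on the opposite side of the moved segment, which
therefore cuts both arms. -/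
lemma TransvOn.eventually_ge_two :
    ∀ᶠ z in 𝓝 (p, y), 0 < σ * orient z.1 (poly i) z.2 →
      ((F.card + 2 : ℕ) : ℕ∞) ≤ (meets poly z.1 z.2).encard :=
  hF.eventually_ge_tang (S := {z | 0 < σ * orient z.1 (poly i) z.2}) hpy hiF
    fun N hN => by
    filter_upwards [(hs.isArms_vertex i).two_le_tangential (side_arm hi ha)
      (side_arm hi hb) hpy hi hN] with z hz h
    refine hz ?_
    have h' : 0 < σ * orient z.1 (poly i) z.2 := h
    rw [orient_swap] at h'; linarith

omit hb in
lemma TransvOn.eventually_ge_one :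
    ∀ᶠ z in 𝓝 (p, y), 0 ≤ σ * orient z.1 (poly i) z.2 →
      ((F.card + 1 : ℕ) : ℕ∞) ≤ (meets poly z.1 z.2).encard :=
  hF.eventually_ge_tang (S := {z | 0 ≤ σ * orient z.1 (poly i) z.2}) hpy hiF
    fun N hN => by
    filter_upwards [(hs.isArms_vertex i).one_le_tangential (side_arm hi ha)
      hpy hi hN] with z hz h
    refine hz ?_
    have h' : 0 ≤ σ * orient z.1 (poly i) z.2 := h
    rw [orient_swap] at h'; linarith

/-- With the far end on the side away from the arms, the contact at the vertex is lost. `S` collects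
the conditions on the moved pair under which its far end contributes nothing. -/
lemma TransvOn.eventually_le_of_neg (hp : p ∉ poly.boundary ℝ) {S : Set (Plane × Plane)}
    (hsub : meets poly p y ⊆ insert (poly i) (F : Set Plane))
    (hy : ∃ N ∈ 𝓝 y, ∀ᶠ z in 𝓝 (p, y), z ∈ S → meets poly z.1 z.2 ∩ N = ∅) :
    ∀ᶠ z in 𝓝 (p, y), z ∈ S → σ * orient z.1 (poly i) z.2 < 0 →
      (meets poly z.1 z.2).encard ≤ (F.card : ℕ) := by
  have h1 := hF.eventually_le_tang (c := 0) (M := 0)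
    (l := 𝓝 (p, y) ⊓ 𝓟 {z | z ∈ S ∧ σ * orient z.1 (poly i) z.2 < 0}) hpy hi hiF hp
    inf_le_left hsub ?_ ?_
  · filter_upwards [eventually_inf_principal.1 h1] with z hz h2 h3
    simpa using hz ⟨h2, h3⟩
  · obtain ⟨N, hN, h⟩ := (hs.isArms_vertex i).tangential_empty (side_arm hi ha)
      (side_arm hi hb)
    refine ⟨N, hN, eventually_inf_principal.2 ?_⟩
    filter_upwards [h] with z hz h3
    rw [hz (by have := h3.2; rw [orient_swap] at this; linarith)]
    simp
  · obtain ⟨N, hN, h⟩ := hy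
    refine ⟨N, hN, eventually_inf_principal.2 ?_⟩
    filter_upwards [h] with z hz h3
    rw [hz h3.1]
    simp

end Tangential

end Counts

/-! ### Configurations that cannot occur off the partition lines -/

section Domain

variable {poly : Polygon Plane n} {P : Set Plane} {k : ℕ} {p : Plane}

lemma tendsto_pair_const (p y : Plane) : Tendsto (fun p' : Plane => (p', y)) (𝓝 p) (𝓝 (p, y)) :=
  (by fun_prop : Continuous fun p' : Plane => (p', y)).tendsto p

lemma finite_meets_of_le {y : Plane} {m : ℕ} (h : (meets poly p y).encard ≤ m) :
    (meets poly p y).Finite :=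
  finite_of_encard_le_coe h

lemma IsTang.exists_side {i : Fin n} (h : IsTang poly p i) : ∃ σ : ℝ, (σ = 1 ∨ σ = -1) ∧
    0 < σ * orient p (poly i) (poly ((finRotate n).symm i)) ∧
    0 < σ * orient p (poly i) (poly (finRotate n i)) := by
  rcases pos_and_pos_or_neg_and_neg_of_mul_pos h with ⟨h1, h2⟩ | ⟨h1, h2⟩
  · exact ⟨1, Or.inl rfl, by simpa using h1, by simpa using h2⟩
  · exact ⟨-1, Or.inr rfl, by linarith, by linarith⟩

/-- Moving `p` off the line to one side loses the contact at vertex `i`, to the other side doubles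
it. So the count for vertex `j` is at most `F.card` on one side and at least `F.card + 2` on the
other, and some even level lies between; `p` would be on the corresponding partition line. Here all
even levels up to `k` are needed. -/
lemma no_vertex_behind_unique_tang (hP : IsRegionOf P poly) (hk : Even k)
    (hp : p ∈ cellDomain poly P k) {i j : Fin n} (hi : IsTang poly p i)
    (hij : poly i ∈ openSegment ℝ p (poly j))
    (hc : (meets poly p (poly j)).encard ≤ (k + 1 : ℕ))
    (huniq : ∀ q ∈ meets poly p (poly j), q ≠ poly i → IsTransv poly p q) : False := by
  classical
  have hs := hP.simple
  have hpb := notMem_boundary hP hp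
  have hpj := ne_of_mem_domain hP hp (vertex_mem_boundary poly j)
  have hfin := finite_meets_of_le hc
  set F := hfin.toFinset.erase (poly i) with hFdef
  have him : poly i ∈ meets poly p (poly j) := ⟨hij, vertex_mem_boundary poly i⟩
  have hF : TransvOn poly p (poly j) F := fun q hq => by
    obtain ⟨h1, h2⟩ := Finset.mem_erase.1 hq
    have h3 := hfin.mem_toFinset.1 h2
    exact ⟨h3.1, huniq q h3 h1⟩
  have hiF : poly i ∉ F := Finset.notMem_erase _ _
  have hsub : meets poly p (poly j) ⊆ insert (poly i) (F : Set Plane) := fun q hq => by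
    by_cases h : q = poly i
    · exact Or.inl h
    · exact Or.inr (Finset.mem_erase.2 ⟨h, hfin.mem_toFinset.2 hq⟩)
  have hcard : F.card ≤ k := by
    have h1 := Finset.card_erase_add_one (hfin.mem_toFinset.2 him)
    rw [← hFdef] at h1
    rw [hfin.encard_eq_coe_toFinset_card] at hc
    have h2 : hfin.toFinset.card ≤ k + 1 := by exact_mod_cast hc
    omega
  obtain ⟨σ, hσ, ha, hb⟩ := hi.exists_side
  have hσ0 : σ ≠ 0 := by rcases hσ with rfl | rfl <;> norm_num
  have hij0 : orient p (poly j) (poly i) = 0 := orient_of_mem_openSegment hij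
  have hne : poly j ≠ poly i := fun h => right_notMem_openSegment hpj (h ▸ hij)
  -- the near end of the segment
  have hnear : ∃ N ∈ 𝓝 (poly j), ∀ᶠ z : Plane × Plane in 𝓝 (p, poly j),
      z ∈ {z : Plane × Plane | z.2 = poly j} → meets poly z.1 z.2 ∩ N = ∅ := by
    have hback : ∀ u, IsAdj poly u (poly j) → u ∉ openSegment ℝ p (poly j) := fun u hu h =>
      (infinite_meets_of_isAdj hpj hu h) hfin
    refine (hs.isArms_vertex j).eventually_empty hpb (hback _ ?_) (hback _ ?_)
    · exact ⟨(finRotate n).symm j, Or.inl ⟨rfl, by rw [Equiv.apply_symm_apply]⟩⟩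
    · exact ⟨j, Or.inr ⟨rfl, rfl⟩⟩
  have hlow := hF.eventually_le_of_neg hs hpj hij hiF ha hb hpb hsub hnear
  have hhigh := hF.eventually_ge_two hs hpj hij hiF ha hb
  have hnej : ∀ᶠ p' in 𝓝 p, p' ≠ poly j := isOpen_ne.mem_nhds hpj
  -- An odd `F.card` is less than the even number `k`, so rounding up to an even level does not
  -- exceed `k`.
  obtain ⟨m, hm, hmk, hm1, hm2⟩ : ∃ m, Even m ∧ m ≤ k ∧ F.card ≤ m ∧ m ≤ F.card + 1 := by
    rcases Nat.even_or_odd F.card with h | h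
    · exact ⟨_, h, hcard, le_rfl, by omega⟩
    · refine ⟨F.card + 1, h.add_one, ?_, by omega, le_rfl⟩
      rcases hcard.eq_or_lt with h1 | h1
      · rw [h1] at h; exact absurd hk (Nat.not_even_iff_odd.2 h)
      · omega
  refine not_frequently_both hp j hm hmk ?_ ?_
  · refine ((frequently_side hne hij0 (c := σ) hσ0).and_eventually
      (((tendsto_pair_const p (poly j)).eventually hlow).and hnej)).mono ?_
    rintro p' ⟨h1, h2, h3⟩
    rw [crossings_eq poly h3]
    refine (h2 rfl ?_).trans (by exact_mod_cast hm1)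
    rw [orient_swap]; linarith
  · refine ((frequently_side hne hij0 (c := -σ) (neg_ne_zero.2 hσ0)).and_eventually
      (((tendsto_pair_const p (poly j)).eventually hhigh).and hnej)).mono ?_
    rintro p' ⟨h1, h2, h3⟩
    rw [crossings_eq poly h3]
    intro h4
    have h5 := (h2 (by rw [orient_swap]; linarith)).trans h4
    have h6 : F.card + 2 ≤ m := by exact_mod_cast h5
    omega

/-- Off the partition lines, no vertex that is seen through at most `k + 1` points of the curve
lies behind a tangential vertex. -/
lemma no_vertex_behind_tang (hP : IsRegionOf P poly) (hk : Even k)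
    (hp : p ∈ cellDomain poly P k) {i j : Fin n} (hi : IsTang poly p i)
    (hij : poly i ∈ openSegment ℝ p (poly j)) :
    ¬ (meets poly p (poly j)).encard ≤ (k + 1 : ℕ) := by
  intro hc
  -- Take the counterexample closest to `p`: no other tangential vertex can then be in front of it,
  -- which reduces to the case of a unique one.
  set B : Set (Fin n) := {j | ∃ i, IsTang poly p i ∧ poly i ∈ openSegment ℝ p (poly j) ∧
    (meets poly p (poly j)).encard ≤ (k + 1 : ℕ)} with hB
  obtain ⟨j, ⟨i, hi, hij, hc⟩, hmin⟩ := exists_min_image B (fun j => dist p (poly j))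
    (toFinite B) ⟨j, i, hi, hij, hc⟩
  have hpj : ∀ j, p ≠ poly j := fun j => ne_of_mem_domain hP hp (vertex_mem_boundary poly j)
  have hnear : ∀ j', poly j' ∈ openSegment ℝ p (poly j) → j' ∉ B := fun j' h1 h2 =>
    (hmin j' h2).not_gt (dist_lt_of_mem_openSegment (hpj j) h1)
  have hsmall : ∀ j', poly j' ∈ openSegment ℝ p (poly j) →
      (meets poly p (poly j')).encard ≤ (k + 1 : ℕ) := fun j' h =>
    (encard_le_encard (meets_subset_of_mem h)).trans hc
  refine no_vertex_behind_unique_tang hP hk hp hi hij hc fun q hq hqi => ?_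
  rcases hP.simple.classify (notMem_boundary hP hp) hq.2 with h | ⟨i', rfl, h⟩ | ⟨u, u', h1, h2, h3⟩
  · exact h
  · exfalso
    rcases ray_trichotomy hij hq.1 with h1 | h1 | h1
    · exact hnear i' hq.1 ⟨i, hi, h1, hsmall _ hq.1⟩
    · exact hqi h1.symm
    · exact hnear i hij ⟨i', h, h1, hsmall _ hij⟩
  · obtain ⟨j', hj'⟩ := h1.symm.exists_eq
    exact absurd (finite_meets_of_le hc)
      (infinite_meets_of_mem_along (hj' ▸ hpj j') h1 h2 h3 hq.1)

/-- Off the partition lines, no `k`-visible vertex is the near endpoint of an edge that points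
away from `p`. -/
lemma no_visible_along (hP : IsRegionOf P poly) (hk : Even k) (hp : p ∈ cellDomain poly P k)
    {u u' : Plane} (hadj : IsAdj poly u u') (hu : u ∈ openSegment ℝ p u') :
    ¬ (meets poly p u).encard ≤ (k : ℕ) := by
  classical
  intro hc
  have hs := hP.simple
  have hpb := notMem_boundary hP hp
  obtain ⟨j, hj⟩ := hadj.exists_eq
  obtain ⟨j', hj'⟩ := hadj.symm.exists_eq
  have hpu : p ≠ u := hj ▸ ne_of_mem_domain hP hp (vertex_mem_boundary poly j)
  have hpu' : p ≠ u' := hj' ▸ ne_of_mem_domain hP hp (vertex_mem_boundary poly j')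
  have hfin := finite_meets_of_le hc
  obtain ⟨t, hadjt, harm⟩ := hadj.exists_isArms hs
  obtain ⟨u'', -, harm'⟩ := hadj.symm.exists_isArms hs
  have hu'u : u' ≠ u := harm.right_ne
  have h0 : orient p u' u = 0 := orient_of_mem_openSegment hu
  have hT : ∀ q ∈ meets poly p u, IsTransv poly p q := fun q hq => by
    rcases hs.classify hpb hq.2 with h | ⟨i', rfl, h⟩ | ⟨w, w', h1, h2, h3⟩
    · exact h
    · exfalso
      rw [hj] at hq hc
      exact no_vertex_behind_tang hP hk hp h hq.1 (hc.trans (by exact_mod_cast Nat.le_succ k))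
    · obtain ⟨i, hi⟩ := h1.symm.exists_eq
      exact absurd hfin (infinite_meets_of_mem_along
        (hi ▸ ne_of_mem_domain hP hp (vertex_mem_boundary poly i)) h1 h2 h3 hq.1)
  -- The other edge at `u` is not collinear with `p`: two edges at `u` cannot both point away, and
  -- one that arrives from the side of `p` makes the count at `u` infinite.
  have ht0 : orient p u' t ≠ 0 := fun ht0 => by
    have hut : orient p u t = 0 := by
      obtain ⟨s, -, hs'⟩ := exists_orient_scale hu
      rw [hs', ht0, mul_zero]
    rcases mem_openSegment_of_collinear harm.left_ne.symm hut
      (fun h => hpb (harm.subset (Or.inl h))) with h | h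
    · exact harm.not_both_beyond h hu hpu
    · exact (infinite_meets_of_isAdj hpu hadjt h) hfin
  have hF : TransvOn poly p u hfin.toFinset := fun q hq =>
    ⟨(hfin.mem_toFinset.1 hq).1, hT q (hfin.mem_toFinset.1 hq)⟩
  -- Positions from which `u` is on the same side of the segment to `u'` as its other neighbour `t`
  -- is from `p`. Close to `p` such a segment passes by the edges `u t` and `u u'` without meeting
  -- them before its end.
  set S : Set (Plane × Plane) :=
    {z | z.2 = u' ∧ 0 < orient p u' t * orient z.1 u' u} with hS
  have edge_empty : ∀ z ∈ S, ∀ x ∈ meets poly z.1 z.2, x ∉ segment ℝ u u' := fun z hz x hx hxe => by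
    rw [hz.1] at hx
    have hz0 : orient z.1 u' u ≠ 0 := fun h => by simpa [h] using hz.2
    rw [segment_symm] at hxe
    have : x = u' := arm_eq_base (by simp) hz0 hxe (orient_of_mem_openSegment hx.1)
    subst this
    exact right_notMem_openSegment (fun h => hz0 (by rw [h]; simp)) hx.1
  have hempty : ∀ q ∈ segment ℝ u u', ∃ N ∈ 𝓝 q, ∀ᶠ z in 𝓝 (p, u') ⊓ 𝓟 S,
      meets poly z.1 z.2 ∩ N = ∅ := by
    intro q hq
    rw [← insert_endpoints_openSegment] at hq
    rcases hq with rfl | rfl | hq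
    · obtain ⟨N, hN, hsub⟩ := harm.locally_eq
      refine ⟨N, hN, eventually_inf_principal.2 ?_⟩
      filter_upwards [((tendsto_orient_pair p u' t).const_mul (orient p u' t)).eventually
        (lt_mem_nhds (mul_self_pos.2 ht0))] with z hz hzS
      refine eq_empty_of_forall_notMem fun x hx => ?_
      rcases hsub ⟨hx.1.2, hx.2⟩ with h | h
      · refine arm_ne_zero (p := z.1) (y := z.2) ?_ h (orient_of_mem_openSegment hx.1.1)
        rw [hzS.1] at hz ⊢
        exact mul_pos_of_sign hzS.2 hz
      · exact edge_empty z hzS x hx.1 h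
    · obtain ⟨N, hN, hsub⟩ := harm'.locally_eq
      have h1 : u'' ∉ openSegment ℝ p q := fun h => harm'.not_both_before h hu
      have t1 : Tendsto (fun z : Plane × Plane => z.1) (𝓝 (p, q)) (𝓝 p) := continuous_fst.tendsto _
      refine ⟨N, hN, eventually_inf_principal.2 ?_⟩
      filter_upwards [t1.eventually (IsArms.eventually_openSegment_inter_arm hpu' harm'.left_ne
        (fun e => hpb (harm'.subset (Or.inl e))) h1)] with z hz hzS
      refine eq_empty_of_forall_notMem fun x hx => ?_
      rcases hsub ⟨hx.1.2, hx.2⟩ with h | h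
      · have hx1 := hx.1.1
        rw [hzS.1] at hx1
        exact hz x hx1 h
      · exact edge_empty z hzS x hx.1 (by rwa [segment_symm])
    · obtain ⟨i, hi⟩ := hadj
      have hq' : q ∈ openEdge poly i := by
        rcases hi with ⟨rfl, rfl⟩ | ⟨rfl, rfl⟩
        · exact hq
        · rwa [openSegment_symm] at hq
      have hqs : segment ℝ q (poly i) ∪ segment ℝ q (poly (finRotate n i)) ⊆ segment ℝ u u' := by
        have e : segment ℝ (poly i) (poly (finRotate n i)) = segment ℝ u u' := by
          rcases hi with ⟨rfl, rfl⟩ | ⟨rfl, rfl⟩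
          · rfl
          · rw [segment_symm]
        rw [← e]
        have hqm := openSegment_subset_segment ℝ _ _ hq'
        exact union_subset ((convex_segment _ _).segment_subset hqm (left_mem_segment _ _ _))
          ((convex_segment _ _).segment_subset hqm (right_mem_segment _ _ _))
      obtain ⟨N, hN, hsub⟩ := (hs.isArms_openEdge hq').locally_eq
      refine ⟨N, hN, eventually_inf_principal.2 (Eventually.of_forall fun z hzS => ?_)⟩
      exact eq_empty_of_forall_notMem fun x hx =>
        edge_empty z hzS x hx.1 (hqs (hsub ⟨hx.1.2, hx.2⟩))
  have hup := eventually_encard_meets_le (poly := poly) (l := 𝓝 (p, u') ⊓ 𝓟 S) inf_le_left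
    hfin.toFinset (fun _ => 1) (fun q hq hqF => ?_) (fun q hq => ?_)
  · have hcard : hfin.toFinset.card ≤ k := by
      rw [hfin.encard_eq_coe_toFinset_card] at hc
      exact_mod_cast hc
    have hnej : ∀ᶠ p' in 𝓝 p, p' ≠ u' := isOpen_ne.mem_nhds hpu'
    rw [hj'] at hup hnej hpu' hu hu'u h0 ht0 hadj
    -- From positions of `S` close to `p` the vertex `u'` is `k`-visible, from `p` itself its count
    -- is infinite.
    refine not_frequently_both hp j' hk le_rfl ?_ (frequently_nhds_self ?_)
    · refine ((frequently_side hu'u h0 ht0).and_eventually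
        (((tendsto_pair_const p (poly j')).eventually (eventually_inf_principal.1 hup)).and
          hnej)).mono ?_
      rintro p' ⟨h1, h2, h3⟩
      rw [crossings_eq poly h3]
      refine (h2 ⟨hj'.symm, by rw [hj']; exact h1⟩).trans ?_
      simpa using hcard
    · rw [crossings_eq poly hpu']
      intro h
      exact (infinite_meets_of_isAdj hpu' hadj hu) (finite_meets_of_le h)
  · have hq' := segment_split (openSegment_subset_segment ℝ _ _ hu) hq
    rcases hq' with h | h
    · rw [segment_symm, ← insert_endpoints_openSegment] at h
      rcases h with rfl | rfl | h
      · exact exists_nhds_meets_empty hpb _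
      · exact hempty _ (left_mem_segment _ _ _)
      · exact exists_nhds_meets_empty (fun hb => hqF (hfin.mem_toFinset.2 ⟨h, hb⟩)) _
    · exact hempty _ h
  · have hq' := hfin.mem_toFinset.1 hq
    obtain ⟨N, hN, h'⟩ := (hT q hq').eventually_le (openSegment_subset_of_mem hu hq'.1)
    exact ⟨N, hN, h'.filter_mono inf_le_left⟩

end Domain

/-! ### The two reasons for being hidden -/

section Dichotomy

variable {poly : Polygon Plane n} {P : Set Plane} {k : ℕ} {p : Plane}

/-- A vertex at which the curve is not crossed transversally from `p`. -/
def IsBad (poly : Polygon Plane n) (p : Plane) (j : Fin n) : Prop :=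
  IsTang poly p j ∨ ∃ u', IsAdj poly (poly j) u' ∧ poly j ∈ openSegment ℝ p u'

lemma eq_or_mem_openSegment {p u u' q : Plane} (hu : u ∈ openSegment ℝ p u')
    (hq : q ∈ segment ℝ u u') : u = q ∨ u ∈ openSegment ℝ p q := by
  obtain ⟨r, hr, rfl⟩ := mem_openSegment_iff_lineMap.1 hu
  obtain ⟨m, hm, rfl⟩ := mem_segment_iff_lineMap.1 hq
  rcases hm.1.eq_or_lt with h | h
  · left; rw [← h]; simp
  · right
    have e : (AffineMap.lineMap (AffineMap.lineMap p u' r : Plane) u' m : Plane) =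
        AffineMap.lineMap p u' (r + m * (1 - r)) := by
      apply plane_ext <;> simp only [lineMap_coord] <;> ring
    rw [e]
    exact mem_openSegment_of_lt hr.1 (lt_add_of_pos_right _ (mul_pos h (sub_pos.2 hr.2)))

lemma exists_isBad (hs : IsSimple poly) (hp : p ∉ poly.boundary ℝ) {x : Plane}
    (hx : x ∈ poly.boundary ℝ) (hT : ¬ IsTransv poly p x) :
    ∃ j, IsBad poly p j ∧ (poly j = x ∨ poly j ∈ openSegment ℝ p x) := by
  rcases hs.classify hp hx with h | ⟨j, rfl, h⟩ | ⟨u, u', h1, h2, h3⟩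
  · exact absurd h hT
  · exact ⟨j, Or.inl h, Or.inl rfl⟩
  · obtain ⟨j, rfl⟩ := h1.exists_eq
    exact ⟨j, Or.inr ⟨u', h1, h2⟩, eq_or_mem_openSegment h2 h3⟩

/-- A point is hidden from `p` either because of `k + 1` transversal points in front of it, or
because of `k` transversal points and one tangential vertex. -/
lemma hidden_dichotomy (hP : IsRegionOf P poly) (hk : Even k) (hp : p ∈ cellDomain poly P k)
    {y : Plane} (hpy : p ≠ y) (hc : ¬ (meets poly p y).encard ≤ (k : ℕ)) :
    (∃ F : Finset Plane, F.card = k + 1 ∧ TransvOn poly p y F) ∨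
    ∃ (i : Fin n) (F : Finset Plane), F.card = k ∧ TransvOn poly p y F ∧
      poly i ∈ openSegment ℝ p y ∧ IsTang poly p i ∧ poly i ∉ F ∧
      meets poly p y ⊆ insert (poly i) (F : Set Plane) ∧ (∀ j, y ≠ poly j) := by
  classical
  have hs := hP.simple
  have hpb := notMem_boundary hP hp
  have hpv : ∀ j, p ≠ poly j := fun j => ne_of_mem_domain hP hp (vertex_mem_boundary poly j)
  set T : Set Plane := {q | q ∈ openSegment ℝ p y ∧ IsTransv poly p q} with hTdef
  rcases le_or_gt (((k + 1 : ℕ) : ℕ∞)) T.encard with h1 | h1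
  · left
    obtain ⟨F, hFT, hF⟩ := exists_subset_encard_eq h1
    have hfin : F.Finite := finite_of_encard_eq_coe hF
    rw [hfin.encard_eq_coe_toFinset_card] at hF
    exact ⟨hfin.toFinset, by exact_mod_cast hF, fun q hq => hFT (hfin.mem_toFinset.1 hq)⟩
  right
  have hTk : T.encard ≤ (k : ℕ) := by
    rw [Nat.cast_add, Nat.cast_one] at h1
    exact Order.le_of_lt_add_one h1
  have hTfin : T.Finite := finite_of_encard_le_coe hTk
  set B : Set (Fin n) := {j | poly j ∈ openSegment ℝ p y ∧ IsBad poly p j} with hB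
  -- bad points in front of a point of the segment come with bad vertices
  have hbad : ∀ x ∈ meets poly p y, x ∉ T → ∃ j ∈ B, poly j = x ∨ poly j ∈ openSegment ℝ p x :=
    fun x hx hxT => by
    obtain ⟨j, hj, h⟩ := exists_isBad hs hpb hx.2 fun h => hxT ⟨hx.1, h⟩
    refine ⟨j, ⟨?_, hj⟩, h⟩
    rcases h with rfl | h
    · exact hx.1
    · exact openSegment_subset_of_mem hx.1 h
  have hdist : ∀ {x j}, x ∈ openSegment ℝ p y → (poly j = x ∨ poly j ∈ openSegment ℝ p x) →
      dist p (poly j) ≤ dist p x := fun {x j} hx h => by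
    rcases h with rfl | h
    · exact le_rfl
    · exact (dist_lt_of_mem_openSegment (ne_of_mem_openSegment_left hpy hx) h).le
  have hnsub : ¬ meets poly p y ⊆ T := fun h => hc ((encard_le_encard h).trans hTk)
  obtain ⟨x, hx, hxT⟩ := not_subset.1 hnsub
  obtain ⟨j₀, hj₀, -⟩ := hbad x hx hxT
  -- In front of the nearest bad vertex there are only transversal points, at most `k` of them. So
  -- it is `k`-visible, and `no_visible_along` leaves only tangency.
  obtain ⟨i, hiB, hmin⟩ := exists_min_image B (fun j => dist p (poly j)) (toFinite B) ⟨j₀, hj₀⟩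
  have hfront : meets poly p (poly i) ⊆ T := fun x hx => by
    by_contra hxT
    have hxy := meets_subset_of_mem hiB.1 hx
    obtain ⟨j, hj, h⟩ := hbad x hxy hxT
    have h2 := dist_lt_of_mem_openSegment (hpv i) hx.1
    exact ((hmin j hj).trans (hdist hxy.1 h)).not_gt h2
  have hiT : IsTang poly p i := by
    rcases hiB.2 with h | ⟨u', h, h'⟩
    · exact h
    · exact absurd ((encard_le_encard hfront).trans hTk) (no_visible_along hP hk hp h h')
  -- The next bad vertex would lie behind the tangential vertex `i` with at most `k + 1` points in
  -- front of it.
  have hall : meets poly p y ⊆ insert (poly i) T := by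
    intro x hx
    by_contra hxn
    simp only [mem_insert_iff, not_or] at hxn
    set B' : Set (Fin n) := {j ∈ B | poly j ≠ poly i} with hB'
    have hbad' : ∀ x ∈ meets poly p y, x ≠ poly i → x ∉ T →
        ∃ j ∈ B', poly j = x ∨ poly j ∈ openSegment ℝ p x := fun x hx hxi hxT => by
      rcases hs.classify hpb hx.2 with h | ⟨j, rfl, h⟩ | ⟨u, u', h1, h2, h3⟩
      · exact absurd ⟨hx.1, h⟩ hxT
      · exact ⟨j, ⟨⟨hx.1, Or.inl h⟩, hxi⟩, Or.inl rfl⟩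
      · obtain ⟨j, rfl⟩ := h1.exists_eq
        have h4 := eq_or_mem_openSegment h2 h3
        have h5 : poly j ∈ openSegment ℝ p y := by
          rcases h4 with rfl | h4
          · exact hx.1
          · exact openSegment_subset_of_mem hx.1 h4
        refine ⟨j, ⟨⟨h5, Or.inr ⟨u', h1, h2⟩⟩, fun h => ?_⟩, h4⟩
        rw [h] at h1 h2
        exact no_visible_along hP hk hp h1 h2 ((encard_le_encard hfront).trans hTk)
    obtain ⟨j₁, hj₁, -⟩ := hbad' x hx hxn.1 hxn.2
    obtain ⟨j, hj, hminj⟩ := exists_min_image B' (fun j => dist p (poly j)) (toFinite B') ⟨j₁, hj₁⟩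
    have hij : poly i ∈ openSegment ℝ p (poly j) := by
      rcases ray_trichotomy hiB.1 hj.1.1 with h | h | h
      · exact h
      · exact absurd h.symm hj.2
      · exact absurd (hmin j hj.1) (not_le.2 (dist_lt_of_mem_openSegment (hpv i) h))
    refine no_vertex_behind_tang hP hk hp hiT hij ?_
    have hsub : meets poly p (poly j) ⊆ insert (poly i) T := fun z hz => by
      by_contra hzn
      simp only [mem_insert_iff, not_or] at hzn
      have hzy := meets_subset_of_mem hj.1.1 hz
      obtain ⟨j', hj', h⟩ := hbad' z hzy hzn.1 hzn.2
      exact ((hminj j' hj').trans (hdist hzy.1 h)).not_gt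
        (dist_lt_of_mem_openSegment (hpv j) hz.1)
    calc _ ≤ _ := encard_le_encard hsub
      _ ≤ _ := encard_insert_le _ _
      _ ≤ _ := by push_cast; gcongr
  have hiT' : poly i ∉ T := fun h => hnsub (hall.trans (insert_subset h subset_rfl))
  -- With fewer than `k` transversal points the total would be at most `k` and `y` visible.
  have hcard : T.encard = (k : ℕ) := by
    refine le_antisymm hTk (le_of_not_gt fun h => hc ?_)
    calc _ ≤ _ := encard_le_encard hall
      _ ≤ _ := encard_insert_le _ _
      _ ≤ _ := Order.add_one_le_of_lt h
  refine ⟨i, hTfin.toFinset, ?_, fun q hq => hTfin.mem_toFinset.1 hq, hiB.1, hiT,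
    fun h => hiT' (hTfin.mem_toFinset.1 h), by simpa using hall, ?_⟩
  · rw [hTfin.encard_eq_coe_toFinset_card] at hcard
    exact_mod_cast hcard
  · rintro j rfl
    refine no_vertex_behind_tang hP hk hp hiT hiB.1 ?_
    calc _ ≤ _ := encard_le_encard hall
      _ ≤ _ := encard_insert_le _ _
      _ ≤ _ := by push_cast; gcongr

end Dichotomy

/-! ### The two sides of an edge -/

section Sides

variable {poly : Polygon Plane n} {P : Set Plane}

/-- Off the curve the plane splits into the open sets `interior P` and `Pᶜ`. -/
lemma subset_interior_or_disjoint (hP : IsRegionOf P poly) {s : Set Plane}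
    (hs : IsPreconnected s) (hd : ∀ x ∈ s, x ∉ poly.boundary ℝ) :
    s ⊆ interior P ∨ ∀ x ∈ s, x ∉ P := by
  have hsub : s ⊆ interior P ∪ Pᶜ := fun x hx => by
    by_cases h : x ∈ P
    · left
      by_contra h'
      exact hd x hx (hP.frontier_eq ▸ ⟨subset_closure h, h'⟩)
    · exact Or.inr h
  rcases hs.subset_or_subset isOpen_interior hP.isCompact.isClosed.isOpen_compl
    (disjoint_left.2 fun x h h' => h' (interior_subset h)) hsub with h | h
  · exact Or.inl h
  · exact Or.inr h

lemma subset_interior_of_preconnected (hP : IsRegionOf P poly) {s : Set Plane}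
    (hs : IsPreconnected s) (hd : ∀ x ∈ s, x ∉ poly.boundary ℝ) {x : Plane} (hx : x ∈ s)
    (hxP : x ∈ P) : s ⊆ interior P :=
  (subset_interior_or_disjoint hP hs hd).resolve_right fun h => h x hx hxP

/-- The linear form that defines the line through the `i`-th edge. -/
def edgeForm (poly : Polygon Plane n) (i : Fin n) (x : Plane) : ℝ :=
  orient (poly i) (poly (finRotate n i)) x

lemma continuous_edgeForm (i : Fin n) : Continuous (edgeForm poly i) := by
  unfold edgeForm; fun_prop

lemma edgeForm_lineMap (i : Fin n) (a b : Plane) (t : ℝ) :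
    edgeForm poly i (AffineMap.lineMap a b t) =
      (1 - t) * edgeForm poly i a + t * edgeForm poly i b := orient_lineMap_right _ _ _ _ _

lemma edgeForm_of_mem {i : Fin n} {x : Plane} (hx : x ∈ poly.edgeSet ℝ i) :
    edgeForm poly i x = 0 := by
  rw [edgeSet_eq] at hx; exact orient_of_mem_segment hx

/-- Near a point of an open edge the line of the edge is contained in the edge. -/
lemma eventually_mem_openEdge (hs : IsSimple poly) {i : Fin n} {z : Plane}
    (hz : z ∈ openEdge poly i) :
    ∀ᶠ x in 𝓝 z, edgeForm poly i x = 0 → x ∈ openEdge poly i :=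
  eventually_mem_openSegment (hs.nondegenerate i) tendsto_const_nhds tendsto_const_nhds
    tendsto_id hz

/-- Near a point of an open edge the curve is contained in the edge. -/
lemma eventually_mem_edge_of_boundary (hs : IsSimple poly) {i : Fin n} {z : Plane}
    (hz : z ∈ openEdge poly i) :
    ∀ᶠ x in 𝓝 z, x ∈ poly.boundary ℝ → x ∈ poly.edgeSet ℝ i := by
  obtain ⟨N, hN, h⟩ := exists_nhds_boundary_subset poly z
  filter_upwards [hN] with x hx hxb
  obtain ⟨j, hj⟩ := mem_iUnion.1 hxb
  rwa [← hs.eq_of_mem_openEdge hz (h x hx j hj)]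

/-- In a small ball each open half misses the curve, hence is inside or outside. Two inner halves
would make `z` an interior point; two outer ones would contradict that `P` is the closure of its
interior. -/
lemma exists_local_side (hP : IsRegionOf P poly) {i : Fin n} {z : Plane}
    (hz : z ∈ openEdge poly i) :
    ∃ σ : ℝ, (σ = 1 ∨ σ = -1) ∧ ∀ᶠ x in 𝓝 z, (0 < σ * edgeForm poly i x → x ∈ interior P) ∧
      (σ * edgeForm poly i x < 0 → x ∉ P) := by
  have hs := hP.simple
  obtain ⟨r, hr, hball⟩ := Metric.eventually_nhds_iff_ball.1 (eventually_mem_edge_of_boundary hs hz)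
  have hconv : ∀ σ : ℝ, Convex ℝ (Metric.ball z r ∩ {x | 0 < σ * edgeForm poly i x}) := fun σ => by
    refine (convex_ball z r).inter ?_
    intro x hx y hy a b ha hb hab
    have e : a • x + b • y = AffineMap.lineMap x y b := by
      rw [AffineMap.lineMap_apply_module, ← hab, add_sub_cancel_right]
    simp only [mem_ofPred_eq] at hx hy ⊢
    rw [e, edgeForm_lineMap]
    have ha' : 1 - b = a := by linarith
    rw [ha']
    rcases ha.eq_or_lt with h | h
    · have : b = 1 := by linarith
      rw [← h, this]; linarith
    · nlinarith [mul_pos h hx, mul_nonneg hb hy.le]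
  have hside : ∀ σ : ℝ, Metric.ball z r ∩ {x | 0 < σ * edgeForm poly i x} ⊆ interior P ∨
      ∀ x ∈ Metric.ball z r ∩ {x | 0 < σ * edgeForm poly i x}, x ∉ P := fun σ =>
    subset_interior_or_disjoint hP (hconv σ).isPreconnected fun x hx hxb => by
      have := edgeForm_of_mem (hball x hx.1 hxb)
      have h2 : 0 < σ * edgeForm poly i x := hx.2
      rw [this, mul_zero] at h2
      exact lt_irrefl _ h2
  have hzP : z ∈ frontier P := by
    rw [hP.frontier_eq]; exact edgeSet_subset_boundary _ _ (openEdge_subset _ _ hz)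
  have hb : Metric.ball z r ∈ 𝓝 z := Metric.ball_mem_nhds z hr
  have fin : ∀ σ : ℝ, (σ = 1 ∨ σ = -1) →
      Metric.ball z r ∩ {x | 0 < σ * edgeForm poly i x} ⊆ interior P →
      (∀ x ∈ Metric.ball z r ∩ {x | 0 < (-σ) * edgeForm poly i x}, x ∉ P) →
      ∃ σ : ℝ, (σ = 1 ∨ σ = -1) ∧ ∀ᶠ x in 𝓝 z, (0 < σ * edgeForm poly i x → x ∈ interior P) ∧
      (σ * edgeForm poly i x < 0 → x ∉ P) := fun σ hσ h1 h2 => by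
    refine ⟨σ, hσ, ?_⟩
    filter_upwards [hb] with x hx
    refine ⟨fun h => h1 ⟨hx, h⟩, fun h => h2 x ⟨hx, ?_⟩⟩
    simp only [mem_ofPred_eq]; linarith
  rcases hside 1 with h1 | h1 <;> rcases hside (-1) with h2 | h2
  · -- both sides in `P`: then `z` is an interior point
    exfalso
    apply hzP.2
    rw [mem_interior_iff_mem_nhds]
    filter_upwards [hb, eventually_mem_openEdge hs hz] with x hx hxe
    rcases lt_trichotomy 0 (edgeForm poly i x) with h | h | h
    · exact interior_subset (h1 ⟨hx, by simpa using h⟩)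
    · apply hP.isCompact.isClosed.frontier_subset
      rw [hP.frontier_eq]
      exact edgeSet_subset_boundary _ _ (openEdge_subset _ _ (hxe h.symm))
    · exact interior_subset (h2 ⟨hx, by simpa using h⟩)
  · exact fin 1 (Or.inl rfl) h1 h2
  · exact fin (-1) (Or.inr rfl) h2 (by simpa using h1)
  · -- both sides outside: then `z` is not in the closure of the interior
    exfalso
    have hzc : z ∈ closure (interior P) := by
      rw [hP.closure_interior]; exact hP.isCompact.isClosed.frontier_subset hzP
    obtain ⟨x, ⟨hx, hxe⟩, hxP⟩ := mem_closure_iff_nhds.1 hzc _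
      (inter_mem hb (eventually_mem_openEdge hs hz))
    rcases lt_trichotomy 0 (edgeForm poly i x) with h | h | h
    · exact h1 x ⟨hx, by simpa using h⟩ (interior_subset hxP)
    · exact notMem_boundary_of_mem_interior hP hxP
        (edgeSet_subset_boundary _ _ (openEdge_subset _ _ (hxe h.symm)))
    · exact h2 x ⟨hx, by simpa using h⟩ (interior_subset hxP)

/-- The open edge is connected and the two possible local signs define disjoint open parts of it, so
the sign is constant. -/
lemma exists_edge_side (hP : IsRegionOf P poly) (i : Fin n) :
    ∃ σ : ℝ, (σ = 1 ∨ σ = -1) ∧ ∀ z ∈ openEdge poly i,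
      ∀ᶠ x in 𝓝 z, (0 < σ * edgeForm poly i x → x ∈ interior P) ∧
        (σ * edgeForm poly i x < 0 → x ∉ P) := by
  set Q : ℝ → Plane → Prop := fun σ z => ∀ᶠ x in 𝓝 z,
    (0 < σ * edgeForm poly i x → x ∈ interior P) ∧ (σ * edgeForm poly i x < 0 → x ∉ P) with hQ
  have hopen : ∀ σ, IsOpen {z | Q σ z} := fun σ => by
    rw [isOpen_iff_eventually]
    exact fun z hz => eventually_eventually_nhds.2 hz
  have hpre : IsPreconnected (openEdge poly i) := (convex_openSegment _ _).isPreconnected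
  have hex : ∀ z ∈ openEdge poly i, Q 1 z ∨ Q (-1) z := fun z hz => by
    obtain ⟨σ, rfl | rfl, h⟩ := exists_local_side hP hz
    · exact Or.inl h
    · exact Or.inr h
  have hdis : ∀ z ∈ openEdge poly i, ¬ (Q 1 z ∧ Q (-1) z) := by
    rintro z hz ⟨h1, h2⟩
    have hzP : z ∈ frontier P := by
      rw [hP.frontier_eq]; exact edgeSet_subset_boundary _ _ (openEdge_subset _ _ hz)
    have hzc : z ∈ closure (interior P) := by
      rw [hP.closure_interior]; exact hP.isCompact.isClosed.frontier_subset hzP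
    obtain ⟨x, ⟨⟨hx, hx'⟩, hxe⟩, hxP⟩ := mem_closure_iff_nhds.1 hzc _
      (inter_mem (inter_mem h1 h2) (eventually_mem_openEdge hP.simple hz))
    rcases lt_trichotomy 0 (edgeForm poly i x) with h | h | h
    · exact hx'.2 (by linarith) (interior_subset hxP)
    · exact notMem_boundary_of_mem_interior hP hxP
        (edgeSet_subset_boundary _ _ (openEdge_subset _ _ (hxe h.symm)))
    · exact hx.2 (by linarith) (interior_subset hxP)
  by_cases h1 : (openEdge poly i ∩ {z | Q 1 z}).Nonempty
  · by_cases h2 : (openEdge poly i ∩ {z | Q (-1) z}).Nonempty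
    · obtain ⟨z, hz, hz1, hz2⟩ := hpre _ _ (hopen 1) (hopen (-1)) (fun z hz => hex z hz) h1 h2
      exact absurd ⟨hz1, hz2⟩ (hdis z hz)
    · exact ⟨1, Or.inl rfl, fun z hz => (hex z hz).resolve_right fun h => h2 ⟨z, hz, h⟩⟩
  · exact ⟨-1, Or.inr rfl, fun z hz => (hex z hz).resolve_left fun h => h1 ⟨z, hz, h⟩⟩

/-- The sign that makes `edgeForm` positive on the inner side of the edge. -/
noncomputable def innerSign (hP : IsRegionOf P poly) (i : Fin n) : ℝ :=
  (exists_edge_side hP i).choose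

/-- The defining form of an edge, positive on the inner side. -/
noncomputable def innerForm (hP : IsRegionOf P poly) (i : Fin n) (x : Plane) : ℝ :=
  innerSign hP i * edgeForm poly i x

variable (hP : IsRegionOf P poly) (i : Fin n)

lemma innerSign_ne_zero : innerSign hP i ≠ 0 := by
  rcases (exists_edge_side hP i).choose_spec.1 with h | h <;> rw [innerSign, h] <;> norm_num

lemma eventually_inner {i : Fin n} {z : Plane} (hz : z ∈ openEdge poly i) :
    ∀ᶠ x in 𝓝 z, (0 < innerForm hP i x → x ∈ interior P) ∧ (innerForm hP i x < 0 → x ∉ P) :=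
  (exists_edge_side hP i).choose_spec.2 z hz

lemma innerForm_eq_zero {i : Fin n} {x : Plane} : innerForm hP i x = 0 ↔ edgeForm poly i x = 0 := by
  simp [innerForm, innerSign_ne_zero]

lemma innerForm_of_mem {i : Fin n} {x : Plane} (hx : x ∈ poly.edgeSet ℝ i) :
    innerForm hP i x = 0 := (innerForm_eq_zero hP).2 (edgeForm_of_mem hx)

lemma continuous_innerForm : Continuous (innerForm hP i) :=
  (continuous_edgeForm i).const_mul _

lemma innerForm_lineMap (a b : Plane) (t : ℝ) :
    innerForm hP i (AffineMap.lineMap a b t) =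
      (1 - t) * innerForm hP i a + t * innerForm hP i b := by
  simp only [innerForm, edgeForm_lineMap]; ring

end Sides

/-! ### Parity of the number of crossings -/

section Parity

variable {poly : Polygon Plane n} {P : Set Plane}

lemma edgeForm_eq_orient (i : Fin n) (p : Plane) :
    edgeForm poly i p = orient p (poly i) (poly (finRotate n i)) :=
  orient_rotate _ _ _

/-- If `p` were on the line of the edge, the near endpoint would be met at `q` or before it. -/
lemma edgeForm_ne_zero_of_no_vertex (hs : IsSimple poly) {p y q : Plane} {j : Fin n}
    (hp : p ∉ poly.boundary ℝ) (hv : ∀ j, poly j ∉ openSegment ℝ p y) (hq : q ∈ poly.edgeSet ℝ j)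
    (hqy : q ∈ openSegment ℝ p y) : edgeForm poly j p ≠ 0 := by
  intro h0
  rw [edgeForm_eq_orient] at h0
  obtain ⟨u, u', h1, h2, h3⟩ := hs.exists_along hp h0
  obtain ⟨i, rfl⟩ := h1.exists_eq
  rcases eq_or_mem_openSegment h2 (h3 ▸ hq) with rfl | h
  · exact hv i hqy
  · exact hv i (openSegment_subset_of_mem hqy h)

/-- Along a segment that meets no vertex, the part before parameter `s`. -/
lemma meets_lineMap {p y : Plane} (hpy : p ≠ y) {s : ℝ} (hs : s ∈ Ioc (0 : ℝ) 1) :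
    meets poly p (AffineMap.lineMap p y s) = {x ∈ meets poly p y | lineParam p y x < s} := by
  ext x
  constructor
  · rintro ⟨hx, hb⟩
    obtain ⟨r, hr, rfl⟩ := mem_openSegment_iff_lineMap.1 hx
    have e : (AffineMap.lineMap p (AffineMap.lineMap p y s : Plane) r : Plane) =
        AffineMap.lineMap p y (r * s) := by
      apply plane_ext <;> simp only [lineMap_coord] <;> ring
    rw [e] at hb ⊢
    have h1 : r * s < s := by nlinarith [hr.2, hs.1]
    refine ⟨⟨mem_openSegment_iff_lineMap.2 ⟨_, ⟨mul_pos hr.1 hs.1, h1.trans_le hs.2⟩, rfl⟩, hb⟩, ?_⟩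
    rwa [lineParam_lineMap hpy]
  · rintro ⟨⟨hx, hb⟩, h⟩
    obtain ⟨r, hr, rfl⟩ := mem_openSegment_iff_lineMap.1 hx
    rw [lineParam_lineMap hpy] at h
    exact ⟨mem_openSegment_of_lt hr.1 h, hb⟩

/-- Induction that removes the last crossing. Without vertices on the open segment every crossing is
through the interior of an edge whose line misses `p`, so it switches between inside and outside. -/
lemma mem_iff_even (hP : IsRegionOf P poly) {p : Plane} (hp : p ∈ interior P) :
    ∀ (m : ℕ) (y : Plane), p ≠ y → y ∉ poly.boundary ℝ → (∀ j, poly j ∉ openSegment ℝ p y) →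
      (meets poly p y).encard = m → (y ∈ P ↔ Even m) := by
  have hs := hP.simple
  have hpb := notMem_boundary_of_mem_interior hP hp
  intro m
  induction m with
  | zero =>
    intro y hpy hy hv hc
    simp only [Even.zero, iff_true]
    have h0 : meets poly p y = ∅ := by simpa using hc
    refine interior_subset (subset_interior_of_preconnected hP (convex_segment p y).isPreconnected
      (fun x hx hb => ?_) (left_mem_segment _ _ _) (interior_subset hp) (right_mem_segment _ _ _))
    rw [← insert_endpoints_openSegment] at hx
    rcases hx with rfl | rfl | hx
    · exact hpb hb
    · exact hy hb
    · have : x ∈ meets poly p y := ⟨hx, hb⟩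
      rw [h0] at this; exact this
  | succ m ih =>
    intro y hpy hy hv hc
    have hfin : (meets poly p y).Finite := finite_of_encard_eq_coe hc
    have hne : (meets poly p y).Nonempty := by
      rw [← one_le_encard_iff_nonempty, hc]; push_cast; exact le_add_self
    obtain ⟨q, hq, hmax⟩ := exists_max_image _ (lineParam p y) hfin hne
    obtain ⟨j, hj⟩ := mem_iUnion.1 hq.2
    have hqe : q ∈ openEdge poly j := by
      rcases mem_edge_cases hj with h | h | h
      · exact absurd hq.1 (h ▸ hv j)
      · exact absurd hq.1 (h ▸ hv _)
      · exact h
    have hf0 : innerForm hP j p ≠ 0 := fun h =>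
      edgeForm_ne_zero_of_no_vertex hs hpb hv hj hq.1 ((innerForm_eq_zero hP).1 h)
    set t := lineParam p y q with htdef
    have htq : q = AffineMap.lineMap p y t :=
      eq_lineMap_lineParam hpy (orient_of_mem_openSegment hq.1)
    have ht : t ∈ Ioo (0 : ℝ) 1 := ((mem_openSegment_iff_lineParam hpy).1 hq.1).2
    have hlt : ∀ x ∈ meets poly p y, x ≠ q → lineParam p y x < t := fun x hx hxq => by
      refine lt_of_le_of_ne (hmax x hx) fun h => hxq ?_
      rw [eq_lineMap_lineParam hpy (orient_of_mem_openSegment hx.1), h, ← htq]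
    -- The form is affine along the segment and vanishes at `t`, so it changes sign there.
    have hform : ∀ s : ℝ, innerForm hP j (AffineMap.lineMap p y s) * t =
        innerForm hP j p * (t - s) := fun s => by
      have h1 : innerForm hP j (AffineMap.lineMap p y t) = 0 := by
        rw [← htq]; exact innerForm_of_mem hP hj
      rw [innerForm_lineMap] at h1 ⊢
      linear_combination s * h1
    have hcont : Tendsto (fun s : ℝ => (AffineMap.lineMap p y s : Plane)) (𝓝 t) (𝓝 q) := by
      have : Continuous fun s : ℝ => (AffineMap.lineMap p y s : Plane) :=
        AffineMap.lineMap_continuous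
      have h2 := this.tendsto t
      rwa [← htq] at h2
    have hE : ∀ᶠ s in 𝓝 t, ((0 < innerForm hP j (AffineMap.lineMap p y s) →
        (AffineMap.lineMap p y s : Plane) ∈ interior P) ∧
        (innerForm hP j (AffineMap.lineMap p y s) < 0 → (AffineMap.lineMap p y s : Plane) ∉ P)) ∧
        s ∈ Ioo (0 : ℝ) 1 ∧ ∀ x ∈ meets poly p y, x ≠ q → lineParam p y x < s := by
      have hIoo : ∀ᶠ s in 𝓝 t, s ∈ Ioo (0 : ℝ) 1 := isOpen_Ioo.mem_nhds ht
      refine (hcont.eventually (eventually_inner hP hqe)).and (hIoo.and ?_)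
      refine (eventually_all_finite hfin).2 fun x hx => ?_
      by_cases hxq : x = q
      · exact Eventually.of_forall fun _ h => absurd hxq h
      · filter_upwards [lt_mem_nhds (hlt x hx hxq)] with s hs _ using hs
    -- `s₁` is just before the last crossing but beyond all others, `s₂` just after it.
    obtain ⟨s₁, ⟨hin₁, hs₁, hlt₁⟩, hst₁⟩ :=
      ((hE.filter_mono (nhdsWithin_le_nhds (s := Iio t))).and self_mem_nhdsWithin).exists
    obtain ⟨s₂, ⟨hin₂, hs₂, -⟩, hst₂⟩ :=
      ((hE.filter_mono (nhdsWithin_le_nhds (s := Ioi t))).and self_mem_nhdsWithin).exists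
    -- nothing happens between `s₂` and `y`
    have h2y : (AffineMap.lineMap p y s₂ : Plane) ∈ P ↔ y ∈ P := by
      have hpre : IsPreconnected (segment ℝ (AffineMap.lineMap p y s₂ : Plane) y) :=
        (convex_segment _ _).isPreconnected
      have hd : ∀ x ∈ segment ℝ (AffineMap.lineMap p y s₂ : Plane) y, x ∉ poly.boundary ℝ := by
        intro x hx hb
        obtain ⟨r, hr, rfl⟩ := mem_segment_iff_lineMap.1 hx
        have e : (AffineMap.lineMap (AffineMap.lineMap p y s₂ : Plane) y r : Plane) =
            AffineMap.lineMap p y (s₂ + r * (1 - s₂)) := by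
          apply plane_ext <;> simp only [lineMap_coord] <;> ring
        rw [e] at hb
        have h1 : s₂ ≤ s₂ + r * (1 - s₂) :=
          le_add_of_nonneg_right (mul_nonneg hr.1 (sub_nonneg.2 hs₂.2.le))
        have h2 : s₂ + r * (1 - s₂) ≤ 1 := by nlinarith [hr.2, hs₂.2]
        rcases h2.eq_or_lt with h2 | h2
        · rw [h2] at hb; exact hy (by simpa using hb)
        · have h3 := hmax _ ⟨mem_openSegment_iff_lineMap.2 ⟨_, ⟨hs₂.1.trans_le h1, h2⟩, rfl⟩, hb⟩
          rw [lineParam_lineMap hpy] at h3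
          linarith
      constructor
      · exact fun h => interior_subset (subset_interior_of_preconnected hP hpre hd
          (left_mem_segment _ _ _) h (right_mem_segment _ _ _))
      · exact fun h => interior_subset (subset_interior_of_preconnected hP hpre hd
          (right_mem_segment _ _ _) h (left_mem_segment _ _ _))
    have hmeets : meets poly p (AffineMap.lineMap p y s₁) = meets poly p y \ {q} := by
      rw [meets_lineMap hpy ⟨hs₁.1, hs₁.2.le⟩]
      ext x
      refine ⟨fun ⟨h1, h2⟩ => ⟨h1, ?_⟩, fun ⟨h1, h2⟩ => ⟨h1, hlt₁ x h1 h2⟩⟩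
      rintro rfl
      exact (h2.trans hst₁).ne htdef.symm
    have hc₁ : (meets poly p (AffineMap.lineMap p y s₁)).encard = m := by
      rw [hmeets]
      have h1 := encard_sdiff_singleton_add_one hq
      rw [hc] at h1
      push_cast at h1
      exact ENat.add_left_injective_of_ne_top ENat.one_ne_top h1
    have hp₁ : p ≠ AffineMap.lineMap p y s₁ := fun h => by
      have := lineMap_injective_of_ne hpy (a₁ := 0) (a₂ := s₁) (by simpa using h)
      exact hs₁.1.ne this
    have hmem₁ : (AffineMap.lineMap p y s₁ : Plane) ∈ openSegment ℝ p y :=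
      mem_openSegment_iff_lineMap.2 ⟨_, hs₁, rfl⟩
    have hy₁ : (AffineMap.lineMap p y s₁ : Plane) ∉ poly.boundary ℝ := fun hb => by
      have h1 : (AffineMap.lineMap p y s₁ : Plane) ≠ q := fun h => by
        rw [htq] at h
        exact hst₁.ne (lineMap_injective_of_ne hpy h)
      have h2 := hlt₁ _ ⟨hmem₁, hb⟩ h1
      rw [lineParam_lineMap hpy] at h2
      exact lt_irrefl _ h2
    have hih := ih _ hp₁ hy₁ (fun j h => hv j (openSegment_subset_of_mem hmem₁ h)) hc₁
    rw [Nat.even_add_one, ← hih, ← h2y]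
    have f1 := hform s₁
    have f2 := hform s₂
    rcases lt_or_gt_of_ne hf0 with h | h
    · have g1 : innerForm hP j (AffineMap.lineMap p y s₁) < 0 := by
        by_contra! h'
        nlinarith [mul_nonneg h' ht.1.le, mul_pos (neg_pos.2 h) (sub_pos.2 hst₁)]
      have g2 : 0 < innerForm hP j (AffineMap.lineMap p y s₂) := by
        by_contra! h'
        nlinarith [mul_nonneg (neg_nonneg.2 h') ht.1.le, mul_pos (neg_pos.2 h) (sub_pos.2 hst₂)]
      exact iff_of_true (interior_subset (hin₂.1 g2)) (hin₁.2 g1)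
    · have g1 : 0 < innerForm hP j (AffineMap.lineMap p y s₁) := by
        by_contra! h'
        nlinarith [mul_nonneg (neg_nonneg.2 h') ht.1.le, mul_pos h (sub_pos.2 hst₁)]
      have g2 : innerForm hP j (AffineMap.lineMap p y s₂) < 0 := by
        by_contra! h'
        nlinarith [mul_nonneg h' ht.1.le, mul_pos h (sub_pos.2 hst₂)]
      exact iff_of_false (hin₂.2 g2) (fun h => h (interior_subset (hin₁.1 g1)))

/-- A segment that reaches an edge from its inner side and meets no vertex has an even number of
crossings. -/
lemma even_of_inner (hP : IsRegionOf P poly) {p y : Plane} (hp : p ∈ interior P) {i : Fin n}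
    (hy : y ∈ openEdge poly i) (hin : 0 < innerForm hP i p)
    (hv : ∀ j, poly j ∉ openSegment ℝ p y) {m : ℕ} (hc : (meets poly p y).encard = m) :
    Even m := by
  have hpy : p ≠ y := fun h => notMem_boundary_of_mem_interior hP hp
    (edgeSet_subset_boundary _ _ (h ▸ openEdge_subset _ _ hy))
  have hfin : (meets poly p y).Finite := finite_of_encard_eq_coe hc
  have hcont : Tendsto (fun s : ℝ => (AffineMap.lineMap p y s : Plane)) (𝓝 1) (𝓝 y) := by
    have : Continuous fun s : ℝ => (AffineMap.lineMap p y s : Plane) :=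
      AffineMap.lineMap_continuous
    have h2 := this.tendsto 1
    rwa [AffineMap.lineMap_apply_one] at h2
  have hE : ∀ᶠ s in 𝓝 (1 : ℝ), (0 < innerForm hP i (AffineMap.lineMap p y s) →
      (AffineMap.lineMap p y s : Plane) ∈ interior P) ∧ 0 < s ∧
      ∀ x ∈ meets poly p y, lineParam p y x < s := by
    refine ((hcont.eventually (eventually_inner hP hy)).mono fun _ h => h.1).and
      ((lt_mem_nhds one_pos).and ?_)
    refine (eventually_all_finite hfin).2 fun x hx => lt_mem_nhds ?_
    exact ((mem_openSegment_iff_lineParam hpy).1 hx.1).2.2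
  -- Stopping just short of `y` keeps the count and gives a point of the interior, to which the
  -- parity criterion applies.
  obtain ⟨s, ⟨h1, h2, h3⟩, h4⟩ :=
    ((hE.filter_mono (nhdsWithin_le_nhds (s := Iio 1))).and self_mem_nhdsWithin).exists
  have h5 : 0 < innerForm hP i (AffineMap.lineMap p y s) := by
    rw [innerForm_lineMap, innerForm_of_mem hP (openEdge_subset _ _ hy)]
    nlinarith
  have hmeets : meets poly p (AffineMap.lineMap p y s) = meets poly p y := by
    rw [meets_lineMap hpy ⟨h2, h4.le⟩]
    exact sep_eq_self_iff_mem_true.2 h3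
  refine (mem_iff_even hP hp m (AffineMap.lineMap p y s) (fun h => ?_)
    (notMem_boundary_of_mem_interior hP (h1 h5)) (fun j h => hv j (openSegment_subset_of_mem
      (mem_openSegment_iff_lineMap.2 ⟨s, ⟨h2, h4⟩, rfl⟩) h)) (by rw [hmeets, hc])).1
      (interior_subset (h1 h5))
  have := lineMap_injective_of_ne hpy (a₁ := 0) (a₂ := s) (by simpa using h)
  exact h2.ne this

/-- A zero of an affine function that is not identically zero is isolated. -/
lemma affine_eventually_ne {a b τ : ℝ} (h : ¬ (a = 0 ∧ b = 0)) :
    ∀ᶠ s in 𝓝[≠] τ, (1 - s) * a + s * b ≠ 0 := by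
  by_cases h0 : (1 - τ) * a + τ * b = 0
  · filter_upwards [self_mem_nhdsWithin] with s hs h1
    have h2 : (s - τ) * (b - a) = 0 := by linear_combination h1 - h0
    rcases mul_eq_zero.1 h2 with h3 | h3
    · exact hs (sub_eq_zero.1 h3)
    · exact h ⟨by linear_combination h0 - τ * h3, by linear_combination h0 + (1 - τ) * h3⟩
  · have : Continuous fun s : ℝ => (1 - s) * a + s * b := by fun_prop
    exact (this.tendsto τ).eventually (isOpen_ne.mem_nhds h0) |>.filter_mono nhdsWithin_le_nhds

lemma orient_eq_zero_of_collinear {p v a b : Plane} (hpv : p ≠ v) (ha : orient p v a = 0)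
    (hb : orient p v b = 0) : orient a b p = 0 := by
  rw [eq_lineMap_lineParam hpv ha, eq_lineMap_lineParam hpv hb]
  simp only [orient, lineMap_coord]; ring

lemma orient_edge_ne {p v : Plane} {i : Fin n} (hpv : p ≠ v) (hi : edgeForm poly i p ≠ 0) :
    ¬ (orient p v (poly i) = 0 ∧ orient p v (poly (finRotate n i)) = 0) :=
  fun h => hi (orient_eq_zero_of_collinear hpv h.1 h.2)

/-- Almost all points of an edge are seen from `p` along lines that contain no vertex. -/
lemma eventually_generic {p : Plane} (hp : ∀ j, p ≠ poly j) {i : Fin n}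
    (hi : edgeForm poly i p ≠ 0) (τ : ℝ) :
    ∀ᶠ s in 𝓝[≠] τ, ∀ j, poly j ∉ openSegment ℝ p
      (AffineMap.lineMap (poly i) (poly (finRotate n i)) s : Plane) := by
  refine eventually_all.2 fun j => ?_
  filter_upwards [affine_eventually_ne (orient_edge_ne (hp j) hi) (τ := τ)] with s hs hj
  apply hs
  rw [← orient_lineMap_right, orient_swap, orient_of_mem_openSegment hj, neg_zero]

end Parity

/-! ### Local structure of the hidden part of an edge -/

section Local

variable {poly : Polygon Plane n} {P : Set Plane} {k : ℕ} {p y : Plane} {i : Fin n}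

lemma eventually_pair_ne (hpy : p ≠ y) : ∀ᶠ z : Plane × Plane in 𝓝 (p, y), z.1 ≠ z.2 :=
  (isOpen_ne_fun continuous_fst continuous_snd).mem_nhds hpy

lemma kVisible_iff (hpy : p ≠ y) : KVisible poly k p y ↔ (meets poly p y).encard ≤ (k : ℕ) := by
  rw [KVisible, crossings_eq poly hpy]

lemma notMem_edge_of_mem_openSegment (hp : edgeForm poly i p ≠ 0) (hy : y ∈ poly.edgeSet ℝ i)
    {x : Plane} (hx : x ∈ openSegment ℝ p y) : x ∉ poly.edgeSet ℝ i := by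
  intro hxe
  obtain ⟨t, ht, rfl⟩ := mem_openSegment_iff_lineMap.1 hx
  have := edgeForm_of_mem hxe
  rw [edgeForm_lineMap, edgeForm_of_mem hy, mul_zero, add_zero] at this
  exact (mul_ne_zero (sub_pos.2 ht.2).ne' hp) this

lemma eventually_edgeForm_ne (hp : edgeForm poly i p ≠ 0) :
    ∀ᶠ z : Plane × Plane in 𝓝 (p, y), edgeForm poly i z.1 ≠ 0 :=
  (((continuous_edgeForm i).comp continuous_fst).tendsto (p, y)).eventually (isOpen_ne.mem_nhds hp)

lemma exists_nhds_openEdge (hs : IsSimple poly) (hp : edgeForm poly i p ≠ 0)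
    (hy : y ∈ openEdge poly i) :
    ∃ N ∈ 𝓝 y, ∀ᶠ z : Plane × Plane in 𝓝 (p, y),
      z ∈ {z : Plane × Plane | z.2 ∈ poly.edgeSet ℝ i} → meets poly z.1 z.2 ∩ N = ∅ := by
  refine ⟨_, eventually_mem_edge_of_boundary hs hy, ?_⟩
  filter_upwards [eventually_edgeForm_ne hp] with z hz hze
  exact eq_empty_of_forall_notMem fun x hx =>
    notMem_edge_of_mem_openSegment hz hze hx.1.1 (hx.2 hx.1.2)

/-- The pair `(j, σ)` describes the boundary of the hidden part of edge `i` near the hidden point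
`y`: the points on the `σ`-side of the tangential vertex `j` are the hidden ones. -/
structure IsShadowEnd (poly : Polygon Plane n) (k : ℕ) (i j : Fin n) (σ : ℝ) (p y : Plane) :
    Prop where
  sign : σ = 1 ∨ σ = -1
  mem : y ∈ openEdge poly i
  vertex_mem : poly j ∈ openSegment ℝ p y
  prev_side : 0 < σ * orient p (poly j) (poly ((finRotate n).symm j))
  next_side : 0 < σ * orient p (poly j) (poly (finRotate n j))
  locally_iff : ∀ᶠ z : Plane × Plane in 𝓝 (p, y), z.2 ∈ poly.edgeSet ℝ i →
    (¬ KVisible poly k z.1 z.2 ↔ 0 ≤ σ * orient z.1 (poly j) z.2)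

/-- All other vertices in front of a shadow end are transversal. -/
lemma vertex_transversal_of_tang (hP : IsRegionOf P poly) (hk : Even k)
    (hp : p ∈ cellDomain poly P k) {j j' : Fin n} (hc : (meets poly p y).encard ≤ (k + 1 : ℕ))
    (hj : poly j ∈ openSegment ℝ p y) (hT : IsTang poly p j) (hj' : poly j' ∈ openSegment ℝ p y)
    (hne : j' ≠ j) :
    orient p (poly j') (poly ((finRotate n).symm j')) *
      orient p (poly j') (poly (finRotate n j')) < 0 := by
  have hle : ∀ i, poly i ∈ openSegment ℝ p y → (meets poly p (poly i)).encard ≤ (k + 1 : ℕ) :=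
    fun i hi => (encard_le_encard (meets_subset_of_mem hi)).trans hc
  rcases hP.simple.vertex_trichotomy (notMem_boundary hP hp) j' with h | h | ⟨u, u', h1, h2, h3⟩
  · exact h
  · exfalso
    rcases ray_trichotomy hj hj' with h' | h' | h'
    · exact no_vertex_behind_tang hP hk hp hT h' (hle _ hj')
    · exact hne (hP.simple.injective h').symm
    · exact no_vertex_behind_tang hP hk hp h h' (hle _ hj)
  · obtain ⟨i, hi⟩ := h1.symm.exists_eq
    exact absurd (finite_meets_of_le hc) (infinite_meets_of_mem_along
      (hi ▸ ne_of_mem_domain hP hp (vertex_mem_boundary poly i)) h1 h2 h3 hj')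

/-- The two cases of `hidden_dichotomy`, perturbed: `k + 1` transversal points persist; with `k` of
them and a tangential vertex the count is at least `k + 1` on the closed side of the arms and at
most `k` on the other. That all other vertices in front are transversal later identifies the
tangential vertex. -/
lemma hidden_local (hP : IsRegionOf P poly) (hk : Even k) (hp : p ∈ cellDomain poly P k)
    (hi : edgeForm poly i p ≠ 0) (hy : y ∈ poly.edgeSet ℝ i) (hh : ¬ KVisible poly k p y) :
    (∀ᶠ z : Plane × Plane in 𝓝 (p, y), ¬ KVisible poly k z.1 z.2) ∨
    ∃ j σ, IsShadowEnd poly k i j σ p y ∧ ∀ j', poly j' ∈ openSegment ℝ p y → j' ≠ j →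
      orient p (poly j') (poly ((finRotate n).symm j')) *
        orient p (poly j') (poly (finRotate n j')) < 0 := by
  have hs := hP.simple
  have hpb := notMem_boundary hP hp
  have hpy : p ≠ y := ne_of_mem_domain hP hp (edgeSet_subset_boundary _ _ hy)
  rw [kVisible_iff hpy] at hh
  rcases hidden_dichotomy hP hk hp hpy hh with ⟨F, hFc, hF⟩ | ⟨j, F, hFc, hF, hj, hT, hjF, hsub, hyv⟩
  · left
    filter_upwards [hF.eventually_ge hpy, eventually_pair_ne hpy] with z hz hne h
    rw [kVisible_iff hne] at h
    have := hz.trans h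
    rw [hFc] at this
    have : k + 1 ≤ k := by exact_mod_cast this
    omega
  · right
    obtain ⟨σ, hσ, ha, hb⟩ := hT.exists_side
    have hyo : y ∈ openEdge poly i :=
      ((mem_edge_cases hy).resolve_left (hyv _)).resolve_left (hyv _)
    have hc : (meets poly p y).encard ≤ (k + 1 : ℕ) :=
      calc _ ≤ _ := encard_le_encard hsub
        _ ≤ _ := encard_insert_le _ _
        _ ≤ _ := by rw [encard_coe_eq_coe_finsetCard, hFc]; push_cast; rfl
    refine ⟨j, σ, ⟨hσ, hyo, hj, ha, hb, ?_⟩, fun j' hj' hne =>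
      vertex_transversal_of_tang hP hk hp hc hj hT hj' hne⟩
    filter_upwards [hF.eventually_ge_one hs hpy hj hjF ha,
      hF.eventually_le_of_neg hs hpy hj hjF ha hb hpb hsub (exists_nhds_openEdge hs hi hyo),
      eventually_pair_ne hpy] with z h1 h2 hne hze
    rw [kVisible_iff hne]
    constructor
    · intro h
      by_contra! h3
      apply h
      rw [← hFc]
      exact h2 hze h3
    · intro h h3
      have := (h1 h).trans h3
      rw [hFc] at this
      have : k + 1 ≤ k := by exact_mod_cast this
      omega

/-- If the line of an edge contains `p`, then the edge is hidden, and remains so. -/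
lemma hidden_of_edgeForm_eq_zero (hP : IsRegionOf P poly) (hk : Even k)
    (hp : p ∈ cellDomain poly P k) (hi : edgeForm poly i p = 0) (hy : y ∈ poly.edgeSet ℝ i) :
    ∀ᶠ z : Plane × Plane in 𝓝 (p, y), ¬ KVisible poly k z.1 z.2 := by
  have hpb := notMem_boundary hP hp
  have hpy : p ≠ y := ne_of_mem_domain hP hp (edgeSet_subset_boundary _ _ hy)
  rw [edgeForm_eq_orient] at hi
  obtain ⟨u, u', hadj, hu, he⟩ := hP.simple.exists_along hpb hi
  obtain ⟨j, rfl⟩ := hadj.exists_eq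
  have hpu := ne_of_mem_domain hP hp (vertex_mem_boundary poly j)
  rcases hidden_dichotomy hP hk hp hpu (no_visible_along hP hk hp hadj hu) with
    ⟨F, hFc, hF⟩ | ⟨-, -, -, -, -, -, -, -, h⟩
  -- The near endpoint is a hidden vertex, so it has `k + 1` transversal points in front, which are
  -- in front of `y` as well.
  · have hF' : TransvOn poly p y F := fun q hq => by
      refine ⟨?_, (hF q hq).2⟩
      rcases eq_or_mem_openSegment hu (he ▸ hy) with h | h
      · exact h ▸ (hF q hq).1
      · exact openSegment_subset_of_mem h (hF q hq).1
    filter_upwards [hF'.eventually_ge hpy, eventually_pair_ne hpy] with z hz hne h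
    rw [kVisible_iff hne] at h
    have := hz.trans h
    rw [hFc] at this
    have : k + 1 ≤ k := by exact_mod_cast this
    omega
  · exact absurd rfl (h j)

/-- At most one point is gained near a visible `y`. If all points in front are transversal, only the
second edge at an endpoint `y` can add one. Otherwise there is a single tangential vertex, `y` is no
vertex, and the contact can split in two. -/
lemma le_succ_local (hP : IsRegionOf P poly) (hk : Even k) (hp : p ∈ cellDomain poly P k)
    (hi : edgeForm poly i p ≠ 0) (hy : y ∈ poly.edgeSet ℝ i) (hv : KVisible poly k p y) :
    ∀ᶠ z : Plane × Plane in 𝓝 (p, y), z.2 ∈ openEdge poly i →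
      (meets poly z.1 z.2).encard ≤ (k + 1 : ℕ) := by
  classical
  have hs := hP.simple
  have hpb := notMem_boundary hP hp
  have hpy : p ≠ y := ne_of_mem_domain hP hp (edgeSet_subset_boundary _ _ hy)
  rw [kVisible_iff hpy] at hv
  have hfin := finite_meets_of_le hv
  have hcard : hfin.toFinset.card ≤ k := by
    rw [hfin.encard_eq_coe_toFinset_card] at hv; exact_mod_cast hv
  have hclass : ∀ q ∈ meets poly p y, IsTransv poly p q ∨ ∃ j, q = poly j ∧ IsTang poly p j :=
    fun q hq => by
    rcases hs.classify hpb hq.2 with h | h | ⟨u, u', h1, h2, h3⟩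
    · exact Or.inl h
    · exact Or.inr h
    · obtain ⟨j, hj⟩ := h1.symm.exists_eq
      exact absurd hfin (infinite_meets_of_mem_along
        (hj ▸ ne_of_mem_domain hP hp (vertex_mem_boundary poly j)) h1 h2 h3 hq.1)
  have hbehind : ∀ j j', IsTang poly p j → poly j' ∈ openSegment ℝ p y →
      poly j ∉ openSegment ℝ p (poly j') := fun j j' h1 h2 h3 =>
    no_vertex_behind_tang hP hk hp h1 h3 (((encard_le_encard (meets_subset_of_mem h2)).trans
      hv).trans (by exact_mod_cast Nat.le_succ k))
  set l := 𝓝 (p, y) ⊓ 𝓟 {z : Plane × Plane | z.2 ∈ openEdge poly i} with hl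
  suffices h : ∀ᶠ z in l, (meets poly z.1 z.2).encard ≤ (k + 1 : ℕ) from
    eventually_inf_principal.1 h
  have hll : l ≤ 𝓝 (p, y) := inf_le_left
  by_cases hT : ∀ q ∈ meets poly p y, IsTransv poly p q
  · have hF : TransvOn poly p y hfin.toFinset := fun q hq =>
      ⟨(hfin.mem_toFinset.1 hq).1, hT q (hfin.mem_toFinset.1 hq)⟩
    have hnear : ∃ N ∈ 𝓝 y, ∀ᶠ z in l, (meets poly z.1 z.2 ∩ N).encard ≤ (1 : ℕ) := by
      by_cases hyo : y ∈ openEdge poly i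
      · obtain ⟨N, hN, h⟩ := exists_nhds_openEdge hs hi hyo
        refine ⟨N, hN, eventually_inf_principal.2 ?_⟩
        filter_upwards [h] with z hz hze
        rw [hz (openEdge_subset _ _ hze)]; simp
      -- At an endpoint `y` the moved segment may be cut close to its end by the other edge at `y`,
      -- but only once.
      · obtain ⟨u', hadj, he⟩ : ∃ u', IsAdj poly y u' ∧ segment ℝ y u' = poly.edgeSet ℝ i := by
          rcases mem_edge_cases hy with rfl | rfl | h
          · exact ⟨_, ⟨i, Or.inl ⟨rfl, rfl⟩⟩, (edgeSet_eq _ _).symm⟩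
          · exact ⟨_, ⟨i, Or.inr ⟨rfl, rfl⟩⟩, by rw [segment_symm, edgeSet_eq]⟩
          · exact absurd h hyo
        obtain ⟨t, -, harm⟩ := hadj.exists_isArms hs
        obtain ⟨N, hN, hsub⟩ := harm.locally_eq
        refine ⟨N, hN, eventually_inf_principal.2 ?_⟩
        filter_upwards [eventually_edgeForm_ne hi] with z hz hze
        rw [Nat.cast_one, encard_le_one_iff_subsingleton]
        have hzy : orient z.1 z.2 y ≠ 0 := by
          obtain ⟨s, hs', hs''⟩ := mem_openSegment_iff_lineMap.1 (show z.2 ∈ openSegment ℝ _ _ from hze)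
          rw [← hs'', orient_lineMap_mid]
          rw [edgeForm_eq_orient] at hz
          rcases mem_edge_cases hy with rfl | rfl | h
          · rw [orient_self_right, orient_swap, mul_zero, zero_add]
            exact mul_ne_zero hs'.1.ne' (neg_ne_zero.2 hz)
          · rw [orient_self_right, mul_zero, add_zero]
            exact mul_ne_zero (sub_pos.2 hs'.2).ne' hz
          · exact absurd h hyo
        refine (arm_subsingleton (q := t) hzy).anti fun x hx => ?_
        refine ⟨?_, orient_of_mem_openSegment hx.1.1⟩
        rcases hsub ⟨hx.1.2, hx.2⟩ with h | h
        · rwa [segment_symm]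
        · exact absurd (he ▸ h) (notMem_edge_of_mem_openSegment hz (openEdge_subset _ _ hze) hx.1.1)
    filter_upwards [hF.eventually_le hpy hpb hll (by simp) hnear] with z hz
    exact hz.trans (by exact_mod_cast Nat.succ_le_succ hcard)
  · push Not at hT
    obtain ⟨q, hq, hqT⟩ := hT
    obtain ⟨j, rfl, hj⟩ := (hclass q hq).resolve_left hqT
    have hyo : y ∈ openEdge poly i := by
      have : ∀ j', y ≠ poly j' := by
        rintro j' rfl
        exact no_vertex_behind_tang hP hk hp hj hq.1 (hv.trans (by exact_mod_cast Nat.le_succ k))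
      exact ((mem_edge_cases hy).resolve_left (this _)).resolve_left (this _)
    set F := hfin.toFinset.erase (poly j) with hFdef
    have hF : TransvOn poly p y F := fun q' hq' => by
      obtain ⟨h1, h2⟩ := Finset.mem_erase.1 hq'
      have h3 := hfin.mem_toFinset.1 h2
      refine ⟨h3.1, (hclass q' h3).resolve_right ?_⟩
      rintro ⟨j', rfl, hj'⟩
      rcases ray_trichotomy hq.1 h3.1 with h | h | h
      · exact hbehind j j' hj h3.1 h
      · exact h1 h.symm
      · exact hbehind j' j hj' hq.1 h
    have hsub : meets poly p y ⊆ insert (poly j) (F : Set Plane) := fun q hq => by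
      by_cases h : q = poly j
      · exact Or.inl h
      · exact Or.inr (Finset.mem_erase.2 ⟨h, hfin.mem_toFinset.2 hq⟩)
    have hFc : F.card + 1 ≤ k := by
      have h1 := Finset.card_erase_add_one (hfin.mem_toFinset.2 hq)
      rw [← hFdef] at h1
      omega
    obtain ⟨σ, hσ, ha, hb⟩ := hj.exists_side
    have h2 : ∃ N ∈ 𝓝 (poly j), ∀ᶠ z in l, (meets poly z.1 z.2 ∩ N).encard ≤ (2 : ℕ) := by
      obtain ⟨N, hN, h⟩ := (hs.isArms_vertex j).tangential_le_two (p := p) (y := y)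
        (fun h => by have := side_arm hq.1 ha; rw [h, mul_zero] at this; exact lt_irrefl _ this)
        (fun h => by have := side_arm hq.1 hb; rw [h, mul_zero] at this; exact lt_irrefl _ this)
      exact ⟨N, hN, hll h⟩
    have h3 : ∃ N ∈ 𝓝 y, ∀ᶠ z in l, (meets poly z.1 z.2 ∩ N).encard ≤ (0 : ℕ) := by
      obtain ⟨N, hN, h⟩ := exists_nhds_openEdge hs hi hyo
      refine ⟨N, hN, eventually_inf_principal.2 ?_⟩
      filter_upwards [h] with z hz hze
      rw [hz (openEdge_subset _ _ hze)]; simp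
    filter_upwards [hF.eventually_le_tang hpy hq.1 (Finset.notMem_erase _ _) hpb hll hsub h2 h3]
      with z hz
    refine hz.trans ?_
    -- The tangential vertex is already one of the at most `k` points, so doubling it costs one; the
    -- far end contributes nothing.
    have : F.card + 2 + 0 ≤ k + 1 := by omega
    exact_mod_cast this

/-- A hidden `y` would have hidden points of the edge arbitrarily close to it that are seen along
lines without vertices. Their count is exactly `k + 1`, which is odd, against `even_of_inner`. -/
lemma not_hidden_of_le_succ (hP : IsRegionOf P poly) (hk : Even k) (hp : p ∈ cellDomain poly P k)
    (hin : 0 < innerForm hP i p) (hy : y ∈ openEdge poly i)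
    (hle : ∀ᶠ y' in 𝓝 y, y' ∈ openEdge poly i → (meets poly p y').encard ≤ (k + 1 : ℕ)) :
    KVisible poly k p y := by
  by_contra hh
  have hs := hP.simple
  have hi : edgeForm poly i p ≠ 0 := fun h => hin.ne' ((innerForm_eq_zero hP).2 h)
  have hpv : ∀ j, p ≠ poly j := fun j => ne_of_mem_domain hP hp (vertex_mem_boundary poly j)
  obtain ⟨τ, hτ, hτy⟩ := mem_openSegment_iff_lineMap.1 (show y ∈ openSegment ℝ _ _ from hy)
  set L : ℝ → Plane := fun s => AffineMap.lineMap (poly i) (poly (finRotate n i)) s with hL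
  have hLc : Tendsto L (𝓝 τ) (𝓝 y) := by
    have : Continuous L := AffineMap.lineMap_continuous
    simpa only [hτy, hL] using this.tendsto τ
  have hedge : ∀ᶠ s in 𝓝 τ, L s ∈ openEdge poly i := by
    filter_upwards [isOpen_Ioo.mem_nhds hτ] with s hs'
    exact mem_openSegment_iff_lineMap.2 ⟨s, hs', rfl⟩
  -- hidden points on the edge, arbitrarily close to `y` and generic
  have hfreq : ∃ᶠ s in 𝓝[≠] τ, ¬ KVisible poly k p (L s) := by
    have hpair : Tendsto (fun s => (p, L s)) (𝓝 τ) (𝓝 (p, y)) := tendsto_const_nhds.prodMk_nhds hLc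
    rcases hidden_local hP hk hp hi (openEdge_subset _ _ hy) hh with h | ⟨j, σ, he, -⟩
    · exact ((hpair.eventually h).filter_mono nhdsWithin_le_nhds).frequently
    · have hev := (hpair.eventually he.locally_iff).and hedge
      have hg : ∀ s, orient p (poly j) (L s) = (1 - s) * orient p (poly j) (poly i) +
          s * orient p (poly j) (poly (finRotate n i)) := fun s => orient_lineMap_right _ _ _ _ _
      have h0 : orient p (poly j) (L τ) = 0 := by
        have : L τ = y := hτy
        rw [this, orient_swap, orient_of_mem_openSegment he.vertex_mem, neg_zero]
      set d := orient p (poly j) (poly (finRotate n i)) - orient p (poly j) (poly i) with hd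
      have hlin : ∀ s, orient p (poly j) (L s) = (s - τ) * d := fun s => by
        rw [hg] at h0 ⊢; rw [hd]; linear_combination h0
      have key : ∀ᶠ s in 𝓝 τ, 0 ≤ σ * ((s - τ) * d) → ¬ KVisible poly k p (L s) := by
        filter_upwards [hev] with s hs' h
        exact (hs'.1 (openEdge_subset _ _ hs'.2)).2 (by rw [hlin]; exact h)
      rcases le_total 0 (σ * d) with h | h
      · have : ∃ᶠ s in 𝓝[>] τ, ¬ KVisible poly k p (L s) := by
          refine Eventually.frequently ?_
          filter_upwards [key.filter_mono nhdsWithin_le_nhds, self_mem_nhdsWithin] with s hs' hs''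
          exact hs' (by nlinarith [mul_nonneg h (sub_pos.2 (mem_Ioi.1 hs'')).le])
        exact this.filter_mono (nhdsWithin_mono _ fun s hs' => (mem_Ioi.1 hs').ne')
      · have : ∃ᶠ s in 𝓝[<] τ, ¬ KVisible poly k p (L s) := by
          refine Eventually.frequently ?_
          filter_upwards [key.filter_mono nhdsWithin_le_nhds, self_mem_nhdsWithin] with s hs' hs''
          exact hs' (by nlinarith [mul_nonneg (neg_nonneg.2 h) (sub_pos.2 (mem_Iio.1 hs'')).le])
        exact this.filter_mono (nhdsWithin_mono _ fun s hs' => (mem_Iio.1 hs').ne)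
  obtain ⟨s, h1, ⟨h2, h3⟩, h4⟩ := (hfreq.and_eventually
    ((((hLc.eventually hle).and hedge).filter_mono nhdsWithin_le_nhds).and
      (eventually_generic hpv hi τ))).exists
  have hne : p ≠ L s := ne_of_mem_domain hP hp (edgeSet_subset_boundary _ _ (openEdge_subset _ _ h3))
  rw [kVisible_iff hne] at h1
  have h5 := h2 h3
  have hfin := finite_meets_of_le h5
  have hc := hfin.encard_eq_coe_toFinset_card
  rw [hc] at h1 h5
  have h6 : hfin.toFinset.card ≤ k + 1 := by exact_mod_cast h5
  have h7 : ¬ hfin.toFinset.card ≤ k := fun h => h1 (by exact_mod_cast h)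
  have h8 : hfin.toFinset.card = k + 1 := by omega
  have := even_of_inner hP hp.1 h3 hin h4 hc
  rw [h8, Nat.even_add_one] at this
  exact this hk

/-- Visibility is an open condition along an edge that is seen from its inner side. -/
lemma visible_local (hP : IsRegionOf P poly) (hk : Even k) (hp : p ∈ cellDomain poly P k)
    (hin : 0 < innerForm hP i p) (hy : y ∈ poly.edgeSet ℝ i) (hv : KVisible poly k p y) :
    ∀ᶠ z : Plane × Plane in 𝓝 (p, y), z.2 ∈ poly.edgeSet ℝ i → KVisible poly k z.1 z.2 := by
  have hi : edgeForm poly i p ≠ 0 := fun h => hin.ne' ((innerForm_eq_zero hP).2 h)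
  have t1 : Tendsto (fun z : Plane × Plane => z.1) (𝓝 (p, y)) (𝓝 p) := continuous_fst.tendsto _
  have t2 : Tendsto (fun z : Plane × Plane => z.2) (𝓝 (p, y)) (𝓝 y) := continuous_snd.tendsto _
  -- The parity argument works on the open edge only; at its ends visibility is stable by the cell
  -- condition.
  have hvert : ∀ j, ∀ᶠ z : Plane × Plane in 𝓝 (p, y), z.2 = poly j → KVisible poly k z.1 z.2 := by
    intro j
    by_cases hyj : y = poly j
    · filter_upwards [t1.eventually (eventually_vertex_iff hk hp j)] with z hz h
      rw [h]
      exact hz.2 (hyj ▸ hv)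
    · filter_upwards [t2.eventually (isOpen_ne.mem_nhds hyj)] with z hz h
      exact absurd h hz
  filter_upwards [(le_succ_local hP hk hp hi hy hv).eventually_nhds,
    t1.eventually (isOpen_cellDomain.mem_nhds hp),
    t1.eventually (((continuous_innerForm hP i).tendsto p).eventually (lt_mem_nhds hin)),
    hvert i, hvert (finRotate n i)] with z h1 h2 h3 h4 h5 hz
  rcases mem_edge_cases hz with h | h | h
  · exact h4 h
  · exact h5 h
  · refine not_hidden_of_le_succ hP hk h2 h3 h ?_
    have : Tendsto (fun y' : Plane => (z.1, y')) (𝓝 z.2) (𝓝 (z.1, z.2)) :=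
      tendsto_const_nhds.prodMk_nhds tendsto_id
    exact this.eventually h1

end Local

/-! ### Hidden intervals of an edge that are bounded by two tangential vertices -/

section Track

variable {poly : Polygon Plane n} {P : Set Plane} {k : ℕ} {p y : Plane} {i j : Fin n} {σ : ℝ}

lemma tendsto_lineMap_edge (poly : Polygon Plane n) (i : Fin n) (τ : ℝ) :
    Tendsto (fun s : ℝ => (AffineMap.lineMap (poly i) (poly (finRotate n i)) s : Plane)) (𝓝 τ)
      (𝓝 (AffineMap.lineMap (poly i) (poly (finRotate n i)) τ)) := by
  have : Continuous fun s : ℝ => (AffineMap.lineMap (poly i) (poly (finRotate n i)) s : Plane) :=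
    AffineMap.lineMap_continuous
  exact this.tendsto τ

lemma edge_line_unique {p v y y' : Plane} (hpv : p ≠ v) (hi : edgeForm poly i p ≠ 0)
    (hy : y ∈ poly.edgeSet ℝ i) (hy' : y' ∈ poly.edgeSet ℝ i) (h : orient p v y = 0)
    (h' : orient p v y' = 0) : y = y' := by
  rw [edgeSet_eq] at hy hy'
  obtain ⟨s, -, rfl⟩ := mem_segment_iff_lineMap.1 hy
  obtain ⟨s', -, rfl⟩ := mem_segment_iff_lineMap.1 hy'
  rw [orient_lineMap_right] at h h'
  have h2 : (s - s') * (orient p v (poly (finRotate n i)) - orient p v (poly i)) = 0 := by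
    linear_combination h - h'
  rcases mul_eq_zero.1 h2 with h3 | h3
  · rw [sub_eq_zero.1 h3]
  · exact absurd ⟨by linear_combination h - s * h3, by linear_combination h + (1 - s) * h3⟩
      (orient_edge_ne hpv hi)

namespace IsShadowEnd

variable (h : IsShadowEnd poly k i j σ p y)
include h

lemma mem_edge : y ∈ poly.edgeSet ℝ i := openEdge_subset _ _ h.mem

lemma orient_eq_zero : orient p (poly j) y = 0 := by
  rw [orient_swap, orient_of_mem_openSegment h.vertex_mem, neg_zero]

lemma hidden : ¬ KVisible poly k p y :=
  (h.locally_iff.self_of_nhds h.mem_edge).2 (by rw [h.orient_eq_zero, mul_zero])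

lemma ne (hs : IsSimple poly) : p ≠ y := by
  rintro rfl
  have := h.vertex_mem
  rw [openSegment_same] at this
  exact hs.vertex_notMem_openEdge j i (this ▸ h.mem)

lemma sign_ne_zero : σ ≠ 0 := by
  rcases h.sign with h | h <;> rw [h] <;> norm_num

/-- On one side of a shadow end there are visible points. -/
lemma frequently_visible (hs : IsSimple poly) (hi : edgeForm poly i p ≠ 0) :
    ∃ᶠ y' in 𝓝 y, y' ∈ poly.edgeSet ℝ i ∧ KVisible poly k p y' := by
  obtain ⟨τ, hτ, hτy⟩ := mem_openSegment_iff_lineMap.1 (show y ∈ openSegment ℝ _ _ from h.mem)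
  have hpv : p ≠ poly j := ne_of_mem_openSegment_left (h.ne hs) h.vertex_mem
  set a := orient p (poly j) (poly i) with ha
  set b := orient p (poly j) (poly (finRotate n i)) with hb
  have h0 : (1 - τ) * a + τ * b = 0 := by
    rw [ha, hb, ← orient_lineMap_right, hτy, h.orient_eq_zero]
  have hd : σ * (b - a) ≠ 0 := by
    refine mul_ne_zero h.sign_ne_zero fun h3 => ?_
    exact orient_edge_ne hpv hi ⟨by linear_combination h0 - τ * h3,
      by linear_combination h0 + (1 - τ) * h3⟩
  have ht := tendsto_lineMap_edge poly i τ
  rw [hτy] at ht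
  have hpair : Tendsto (fun s => (p, (AffineMap.lineMap (poly i) (poly (finRotate n i)) s : Plane)))
    (𝓝 τ) (𝓝 (p, y)) := tendsto_const_nhds.prodMk_nhds ht
  have hIcc : ∀ᶠ s in 𝓝 τ, s ∈ Icc (0 : ℝ) 1 := Icc_mem_nhds hτ.1 hτ.2
  refine ht.frequently ?_
  have key : ∀ᶠ s in 𝓝 τ, (s - τ) * (σ * (b - a)) < 0 →
      (AffineMap.lineMap (poly i) (poly (finRotate n i)) s : Plane) ∈ poly.edgeSet ℝ i ∧
      KVisible poly k p (AffineMap.lineMap (poly i) (poly (finRotate n i)) s) := by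
    filter_upwards [hpair.eventually h.locally_iff, hIcc] with s hs1 hs2 hs3
    have he : (AffineMap.lineMap (poly i) (poly (finRotate n i)) s : Plane) ∈ poly.edgeSet ℝ i := by
      rw [edgeSet_eq]; exact mem_segment_iff_lineMap.2 ⟨s, hs2, rfl⟩
    refine ⟨he, ?_⟩
    by_contra hv
    have h4 := (hs1 he).1 hv
    rw [orient_lineMap_right, ← ha, ← hb] at h4
    have : σ * ((1 - s) * a + s * b) = (s - τ) * (σ * (b - a)) := by linear_combination σ * h0
    linarith
  rcases lt_or_gt_of_ne hd with h5 | h5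
  · have : ∃ᶠ s in 𝓝[>] τ, (s - τ) * (σ * (b - a)) < 0 :=
      Eventually.frequently (by
        filter_upwards [self_mem_nhdsWithin] with s hs'
        exact mul_neg_of_pos_of_neg (sub_pos.2 hs') h5)
    exact ((this.filter_mono nhdsWithin_le_nhds).and_eventually key).mono fun s hs' => hs'.2 hs'.1
  · have : ∃ᶠ s in 𝓝[<] τ, (s - τ) * (σ * (b - a)) < 0 :=
      Eventually.frequently (by
        filter_upwards [self_mem_nhdsWithin] with s hs'
        exact mul_neg_of_neg_of_pos (sub_neg.2 hs') h5)
    exact ((this.filter_mono nhdsWithin_le_nhds).and_eventually key).mono fun s hs' => hs'.2 hs'.1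

lemma not_eventually_hidden (hs : IsSimple poly) (hi : edgeForm poly i p ≠ 0)
    (hh : ∀ᶠ z : Plane × Plane in 𝓝 (p, y), ¬ KVisible poly k z.1 z.2) : False := by
  have hpair : Tendsto (fun y' => (p, y')) (𝓝 y) (𝓝 (p, y)) :=
    tendsto_const_nhds.prodMk_nhds tendsto_id
  obtain ⟨y', h1, h2⟩ := ((h.frequently_visible hs hi).and_eventually (hpair.eventually hh)).exists
  exact h2 h1.2

lemma product_pos : 0 < orient p (poly j) (poly ((finRotate n).symm j)) *
    orient p (poly j) (poly (finRotate n j)) := mul_pos_of_sign h.prev_side h.next_side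

end IsShadowEnd

lemma sign_unique {σ σ' x : ℝ} (hσ : σ = 1 ∨ σ = -1) (hσ' : σ' = 1 ∨ σ' = -1) (h : 0 ≤ σ * x)
    (h' : 0 < σ' * x) : σ = σ' := by
  rcases hσ with rfl | rfl <;> rcases hσ' with rfl | rfl <;> first | rfl | (exfalso; linarith)

/-- A shadow end is not stably hidden, so `hidden_local` makes all but one of the vertices in front
of it transversal. The arms at that vertex determine the sign. -/
lemma IsShadowEnd.unique (hP : IsRegionOf P poly) (hk : Even k) (hp : p ∈ cellDomain poly P k)
    (hi : edgeForm poly i p ≠ 0) {j' : Fin n} {σ' : ℝ} (h : IsShadowEnd poly k i j σ p y)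
    (h' : IsShadowEnd poly k i j' σ' p y) : j = j' ∧ σ = σ' := by
  rcases hidden_local hP hk hp hi h.mem_edge h.hidden with ha | ⟨j₀, σ₀, -, hu⟩
  · exact (h.not_eventually_hidden hP.simple hi ha).elim
  · have h1 : j = j₀ := by
      by_contra hne
      exact (hu j h.vertex_mem hne).not_gt h.product_pos
    have h2 : j' = j₀ := by
      by_contra hne
      exact (hu j' h'.vertex_mem hne).not_gt h'.product_pos
    subst h1
    subst h2
    exact ⟨rfl, sign_unique h.sign h'.sign h.prev_side.le h'.prev_side⟩

/-! #### The moving end of a shadow -/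

/-- The point in which the line `p v` meets the line of the `i`-th edge. -/
noncomputable def hit (hP : IsRegionOf P poly) (i : Fin n) (v p : Plane) : Plane :=
  AffineMap.lineMap p v (innerForm hP i p / (innerForm hP i p - innerForm hP i v))

variable (hP : IsRegionOf P poly)

lemma innerForm_lt_of_mem_openSegment {v : Plane} (hin : 0 < innerForm hP i p)
    (hy : y ∈ poly.edgeSet ℝ i) (hv : v ∈ openSegment ℝ p y) :
    0 < innerForm hP i v ∧ innerForm hP i v < innerForm hP i p := by
  obtain ⟨t, ht, rfl⟩ := mem_openSegment_iff_lineMap.1 hv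
  rw [innerForm_lineMap, innerForm_of_mem hP hy]
  constructor <;> nlinarith [ht.1, ht.2]

lemma innerForm_hit {v : Plane} (h : innerForm hP i v ≠ innerForm hP i p) :
    innerForm hP i (hit hP i v p) = 0 := by
  have : innerForm hP i p - innerForm hP i v ≠ 0 := sub_ne_zero.2 h.symm
  rw [hit, innerForm_lineMap]; field_simp; ring

lemma hit_eq {v : Plane} (hin : 0 < innerForm hP i p) (hy : y ∈ poly.edgeSet ℝ i)
    (hv : v ∈ openSegment ℝ p y) : hit hP i v p = y := by
  obtain ⟨t, ht, rfl⟩ := mem_openSegment_iff_lineMap.1 hv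
  have h1 := ht.1.ne'
  have e : innerForm hP i p / (innerForm hP i p - innerForm hP i (AffineMap.lineMap p y t)) =
      1 / t := by
    rw [innerForm_lineMap, innerForm_of_mem hP hy]
    have : innerForm hP i p - ((1 - t) * innerForm hP i p + t * 0) = t * innerForm hP i p := by ring
    rw [this]
    field_simp
  rw [hit, e]
  apply plane_ext <;> simp only [lineMap_coord] <;> field_simp <;> ring

lemma tendsto_hit {v : Plane} (h : innerForm hP i v ≠ innerForm hP i p) :
    Tendsto (hit hP i v) (𝓝 p) (𝓝 (hit hP i v p)) := by
  have h1 : ContinuousAt (fun p => innerForm hP i p / (innerForm hP i p - innerForm hP i v)) p :=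
    (continuous_innerForm hP i).continuousAt.div
      ((continuous_innerForm hP i).continuousAt.sub continuousAt_const) (sub_ne_zero.2 h.symm)
  have h2 : ContinuousAt (hit hP i v) p := by
    have : hit hP i v = fun p => (1 - innerForm hP i p / (innerForm hP i p - innerForm hP i v)) • p +
        (innerForm hP i p / (innerForm hP i p - innerForm hP i v)) • v := by
      funext p
      rw [hit, AffineMap.lineMap_apply_module]
    rw [this]
    exact ((continuousAt_const.sub h1).smul continuousAt_id).add (h1.smul continuousAt_const)
  exact h2

lemma eventually_mem_openSegment_hit {v : Plane} (hin : 0 < innerForm hP i p)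
    (hv : 0 < innerForm hP i v) (hlt : innerForm hP i v < innerForm hP i p) :
    ∀ᶠ p' in 𝓝 p, v ∈ openSegment ℝ p' (hit hP i v p') := by
  have h1 := ((continuous_innerForm hP i).tendsto p).eventually (lt_mem_nhds hlt)
  have h2 := ((continuous_innerForm hP i).tendsto p).eventually (lt_mem_nhds hin)
  filter_upwards [h1, h2] with p' h3 h4
  have : 1 < innerForm hP i p' / (innerForm hP i p' - innerForm hP i v) := by
    rw [one_lt_div (sub_pos.2 h3)]; linarith
  have h5 := mem_openSegment_of_lt (p := p') (y := v) one_pos this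
  rwa [AffineMap.lineMap_apply_one] at h5

/-- The new end is where the line through the same vertex meets the edge; every defining condition
is open, the local description included. -/
lemma IsShadowEnd.eventually (hin : 0 < innerForm hP i p) (h : IsShadowEnd poly k i j σ p y) :
    ∀ᶠ p' in 𝓝 p, IsShadowEnd poly k i j σ p' (hit hP i (poly j) p') := by
  have hv := innerForm_lt_of_mem_openSegment hP hin h.mem_edge h.vertex_mem
  have he := hit_eq hP hin h.mem_edge h.vertex_mem
  have ht := tendsto_hit hP hv.2.ne
  rw [he] at ht
  have hpair : Tendsto (fun p' => (p', hit hP i (poly j) p')) (𝓝 p) (𝓝 (p, y)) :=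
    tendsto_id.prodMk_nhds ht
  have hside : ∀ a : Plane, 0 < σ * orient p (poly j) a →
      ∀ᶠ p' in 𝓝 p, 0 < σ * orient p' (poly j) a := fun a ha =>
    ((tendsto_orient tendsto_id tendsto_const_nhds tendsto_const_nhds).const_mul σ).eventually
      (lt_mem_nhds ha)
  have hne : ∀ᶠ p' in 𝓝 p, innerForm hP i (poly j) ≠ innerForm hP i p' :=
    ((continuous_innerForm hP i).tendsto p).eventually
      ((isOpen_ne (x := innerForm hP i (poly j))).mem_nhds hv.2.ne') |>.mono fun _ h => h.symm
  filter_upwards [ht.eventually (eventually_mem_openEdge hP.simple h.mem),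
    eventually_mem_openSegment_hit hP hin hv.1 hv.2, hside _ h.prev_side, hside _ h.next_side,
    hpair.eventually h.locally_iff.eventually_nhds, hne] with p' h1 h2 h3 h4 h5 h6
  exact ⟨h.sign, h1 ((innerForm_eq_zero hP).1 (innerForm_hit hP h6)), h2, h3, h4, h5⟩

/-- Seen from `p`, the part of edge `i` that lies between the lines to the tangential vertices `j₁`
and `j₂` is a connected component of the hidden part of the edge. -/
structure IsTrack (k : ℕ) (i j₁ j₂ : Fin n) (σ₁ σ₂ : ℝ) (p y₁ y₂ : Plane) : Prop where
  inner : 0 < innerForm hP i p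
  left : IsShadowEnd poly k i j₁ σ₁ p y₁
  right : IsShadowEnd poly k i j₂ σ₂ p y₂
  left_pos : 0 < σ₁ * orient p (poly j₁) y₂
  right_pos : 0 < σ₂ * orient p (poly j₂) y₁
  hidden : ∀ y ∈ poly.edgeSet ℝ i, 0 ≤ σ₁ * orient p (poly j₁) y → 0 ≤ σ₂ * orient p (poly j₂) y →
    ¬ KVisible poly k p y

variable {hP} {j₁ j₂ : Fin n} {σ₁ σ₂ : ℝ} {y₁ y₂ : Plane}

lemma IsTrack.edgeForm_ne (h : IsTrack hP k i j₁ j₂ σ₁ σ₂ p y₁ y₂) : edgeForm poly i p ≠ 0 :=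
  fun h0 => h.inner.ne' ((innerForm_eq_zero hP).2 h0)

lemma tendsto_side (σ : ℝ) (v p y : Plane) : Tendsto (fun z : Plane × Plane => σ * orient z.1 v z.2)
    (𝓝 (p, y)) (𝓝 (σ * orient p v y)) :=
  (by fun_prop : Continuous fun z : Plane × Plane => σ * orient z.1 v z.2).tendsto (p, y)

lemma IsShadowEnd.eq_of_side {y' : Plane} (h : IsShadowEnd poly k i j σ p y) (hs : IsSimple poly)
    (hi : edgeForm poly i p ≠ 0) (hy' : y' ∈ poly.edgeSet ℝ i)
    (h0 : σ * orient p (poly j) y' = 0) : y' = y :=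
  edge_line_unique (ne_of_mem_openSegment_left (h.ne hs) h.vertex_mem) hi hy' h.mem_edge
    ((mul_eq_zero.1 h0).resolve_left h.sign_ne_zero) h.orient_eq_zero

/-- The ends move continuously, near them their local description applies, and strictly between them
hiddenness is stable. Compactness of the edge makes this uniform. -/
lemma IsTrack.eventually (hk : Even k) (hp : p ∈ cellDomain poly P k)
    (h : IsTrack hP k i j₁ j₂ σ₁ σ₂ p y₁ y₂) :
    ∀ᶠ p' in 𝓝 p, IsTrack hP k i j₁ j₂ σ₁ σ₂ p' (hit hP i (poly j₁) p') (hit hP i (poly j₂) p') := by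
  have hs := hP.simple
  have hi := h.edgeForm_ne
  have hv₁ := innerForm_lt_of_mem_openSegment hP h.inner h.left.mem_edge h.left.vertex_mem
  have hv₂ := innerForm_lt_of_mem_openSegment hP h.inner h.right.mem_edge h.right.vertex_mem
  have t₁ := tendsto_hit hP hv₁.2.ne
  have t₂ := tendsto_hit hP hv₂.2.ne
  rw [hit_eq hP h.inner h.left.mem_edge h.left.vertex_mem] at t₁
  rw [hit_eq hP h.inner h.right.mem_edge h.right.vertex_mem] at t₂
  have e₁ := (tendsto_id.prodMk_nhds t₂).eventually
    ((tendsto_side σ₁ (poly j₁) p y₂).eventually (lt_mem_nhds h.left_pos))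
  have e₂ := (tendsto_id.prodMk_nhds t₁).eventually
    ((tendsto_side σ₂ (poly j₂) p y₁).eventually (lt_mem_nhds h.right_pos))
  have hloc : ∀ y ∈ poly.edgeSet ℝ i, ∀ᶠ z : Plane × Plane in 𝓝 (p, y), z.2 ∈ poly.edgeSet ℝ i →
      0 ≤ σ₁ * orient z.1 (poly j₁) z.2 → 0 ≤ σ₂ * orient z.1 (poly j₂) z.2 →
      ¬ KVisible poly k z.1 z.2 := by
    intro y hy
    rcases lt_trichotomy (σ₁ * orient p (poly j₁) y) 0 with h1 | h1 | h1
    · filter_upwards [(tendsto_side σ₁ (poly j₁) p y).eventually (gt_mem_nhds h1)] with z hz _ h2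
      exact absurd h2 (not_le.2 hz)
    · rw [h.left.eq_of_side hs hi hy h1]
      filter_upwards [h.left.locally_iff] with z hz hze h2 _ using (hz hze).2 h2
    rcases lt_trichotomy (σ₂ * orient p (poly j₂) y) 0 with h2 | h2 | h2
    · filter_upwards [(tendsto_side σ₂ (poly j₂) p y).eventually (gt_mem_nhds h2)] with z hz _ _ h3
      exact absurd h3 (not_le.2 hz)
    · rw [h.right.eq_of_side hs hi hy h2]
      filter_upwards [h.right.locally_iff] with z hz hze _ h3 using (hz hze).2 h3
    rcases hidden_local hP hk hp hi hy (h.hidden y hy h1.le h2.le) with ha | ⟨j, σ, he, -⟩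
    · exact ha.mono fun _ hz _ _ _ => hz
    -- A shadow end strictly between the two ends would have visible points next to it, still
    -- between them.
    · exfalso
      have hpair : Tendsto (fun y' => (p, y')) (𝓝 y) (𝓝 (p, y)) :=
        tendsto_const_nhds.prodMk_nhds tendsto_id
      obtain ⟨y', ⟨h3, h4⟩, h5, h6⟩ := ((he.frequently_visible hs hi).and_eventually
        (hpair.eventually (((tendsto_side σ₁ (poly j₁) p y).eventually (lt_mem_nhds h1)).and
          ((tendsto_side σ₂ (poly j₂) p y).eventually (lt_mem_nhds h2))))).exists
      exact h.hidden y' h3 h5.le h6.le h4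
  have hall := (isCompact_edgeSet poly i).eventually_forall_of_forall_eventually
    (x₀ := p) (P := fun p' y' => y' ∈ poly.edgeSet ℝ i → 0 ≤ σ₁ * orient p' (poly j₁) y' →
      0 ≤ σ₂ * orient p' (poly j₂) y' → ¬ KVisible poly k p' y') hloc
  filter_upwards [((continuous_innerForm hP i).tendsto p).eventually (lt_mem_nhds h.inner),
    h.left.eventually hP h.inner, h.right.eventually hP h.inner, e₁, e₂, hall]
    with p' a1 a2 a3 a4 a5 a6
  exact ⟨a1, a2, a3, a4, a5, fun y hy => a6 y hy hy⟩

/-- Limits of shadow ends are shadow ends. -/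
lemma IsShadowEnd.of_tendsto (hP : IsRegionOf P poly) (hk : Even k) (hp : p ∈ cellDomain poly P k)
    (hin : 0 < innerForm hP i p) {u w : ℕ → Plane} (hu : Tendsto u atTop (𝓝 p))
    (hw : Tendsto w atTop (𝓝 y)) (h : ∀ m, IsShadowEnd poly k i j σ (u m) (w m))
    (hum : ∀ m, edgeForm poly i (u m) ≠ 0) : IsShadowEnd poly k i j σ p y := by
  have hs := hP.simple
  have hi : edgeForm poly i p ≠ 0 := fun h0 => hin.ne' ((innerForm_eq_zero hP).2 h0)
  have hy : y ∈ poly.edgeSet ℝ i := (isCompact_edgeSet poly i).isClosed.mem_of_tendsto hw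
    (Eventually.of_forall fun m => (h m).mem_edge)
  have huw : Tendsto (fun m => (u m, w m)) atTop (𝓝 (p, y)) := hu.prodMk_nhds hw
  -- Hiddenness passes to the limit because visibility is open on an edge seen from inside.
  have hh : ¬ KVisible poly k p y := fun hv => by
    obtain ⟨m, hm⟩ := (huw.eventually (visible_local hP hk hp hin hy hv)).exists
    exact (h m).hidden (hm (h m).mem_edge)
  rcases hidden_local hP hk hp hi hy hh with ha | ⟨j', σ', he, hun⟩
  · obtain ⟨m, hm⟩ := (huw.eventually ha.eventually_nhds).exists
    exact ((h m).not_eventually_hidden hs (hum m) hm).elim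
  · have hseg : poly j ∈ segment ℝ p y := by
      by_contra hj
      have := eventually_segment_subset (p := p) (y := y) (isOpen_compl_singleton (x := poly j))
        (fun x hx hxj => hj (hxj ▸ hx))
      obtain ⟨m, hm⟩ := (huw.eventually this).exists
      exact hm (openSegment_subset_segment _ _ _ (h m).vertex_mem) rfl
    have hvm : poly j ∈ openSegment ℝ p y := by
      rw [← insert_endpoints_openSegment] at hseg
      rcases hseg with h1 | h1 | h1
      · exact absurd h1.symm (ne_of_mem_domain hP hp (vertex_mem_boundary poly j))
      · exact absurd (h1 ▸ he.mem) (hs.vertex_notMem_openEdge j i)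
      · exact h1
    have tside : ∀ a : Plane, Tendsto (fun m => orient (u m) (poly j) a) atTop
        (𝓝 (orient p (poly j) a)) := fun a =>
      tendsto_orient hu tendsto_const_nhds tendsto_const_nhds
    -- In the limit the product of sides at vertex `j` is nonnegative, whereas it is negative at
    -- every vertex in front other than `j'`.
    have hjj : j = j' := by
      by_contra hne
      refine (hun j hvm hne).not_ge (ge_of_tendsto ((tside _).mul (tside _))
        (Eventually.of_forall fun m => (h m).product_pos.le))
    subst hjj
    have hσ : σ = σ' := sign_unique (h 0).sign he.sign
      (ge_of_tendsto ((tside _).const_mul σ) (Eventually.of_forall fun m => (h m).prev_side.le))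
      he.prev_side
    exact hσ ▸ he

/-- Besides the ends, two degenerations must be excluded: the pursuer reaching the line of the edge,
and the ends running together. -/
lemma isTrack_of_tendsto (hk : Even k) (hp : p ∈ cellDomain poly P k)
    {u w₁ w₂ : ℕ → Plane} (hu : Tendsto u atTop (𝓝 p)) (hw₁ : Tendsto w₁ atTop (𝓝 y₁))
    (hw₂ : Tendsto w₂ atTop (𝓝 y₂))
    (h : ∀ m, IsTrack hP k i j₁ j₂ σ₁ σ₂ (u m) (w₁ m) (w₂ m)) :
    IsTrack hP k i j₁ j₂ σ₁ σ₂ p y₁ y₂ := by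
  have hs := hP.simple
  have hum := fun m => (h m).edgeForm_ne
  have hy₁ : y₁ ∈ poly.edgeSet ℝ i := (isCompact_edgeSet poly i).isClosed.mem_of_tendsto hw₁
    (Eventually.of_forall fun m => (h m).left.mem_edge)
  have hin : 0 < innerForm hP i p := by
    have h0 : 0 ≤ innerForm hP i p := ge_of_tendsto (((continuous_innerForm hP i).tendsto p).comp hu)
      (Eventually.of_forall fun m => (h m).inner.le)
    -- If `p` were on the line of the edge, the edge would be stably hidden near `y₁`, but every
    -- shadow end has visible points next to it.
    rcases h0.eq_or_lt with h1 | h1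
    · have ha := hidden_of_edgeForm_eq_zero hP hk hp ((innerForm_eq_zero hP).1 h1.symm) hy₁
      obtain ⟨m, hm⟩ := ((hu.prodMk_nhds hw₁).eventually ha.eventually_nhds).exists
      exact ((h m).left.not_eventually_hidden hs (hum m) hm).elim
    · exact h1
  have hi : edgeForm poly i p ≠ 0 := fun h0 => hin.ne' ((innerForm_eq_zero hP).2 h0)
  have hl := IsShadowEnd.of_tendsto hP hk hp hin hu hw₁ (fun m => (h m).left) hum
  have hr := IsShadowEnd.of_tendsto hP hk hp hin hu hw₂ (fun m => (h m).right) hum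
  -- Coinciding ends would have the same vertex and sign, which `left_pos` excludes before the
  -- limit.
  have hne : y₁ ≠ y₂ := by
    rintro rfl
    obtain ⟨hj, hσ⟩ := hl.unique hP hk hp hi hr
    have h1 := (h 0).left_pos
    rw [hj, hσ, (h 0).right.orient_eq_zero, mul_zero] at h1
    exact lt_irrefl _ h1
  have hlp : 0 ≤ σ₁ * orient p (poly j₁) y₂ :=
    ge_of_tendsto ((tendsto_side σ₁ (poly j₁) p y₂).comp (hu.prodMk_nhds hw₂))
      (Eventually.of_forall fun m => (h m).left_pos.le)
  have hrp : 0 ≤ σ₂ * orient p (poly j₂) y₁ :=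
    ge_of_tendsto ((tendsto_side σ₂ (poly j₂) p y₁).comp (hu.prodMk_nhds hw₁))
      (Eventually.of_forall fun m => (h m).right_pos.le)
  refine ⟨hin, hl, hr, lt_of_le_of_ne hlp fun h0 => ?_, lt_of_le_of_ne hrp fun h0 => ?_, ?_⟩
  · exact hne (hl.eq_of_side hs hi hr.mem_edge h0.symm).symm
  · exact hne (hr.eq_of_side hs hi hl.mem_edge h0.symm)
  · intro y hy h1 h2
    rcases h1.eq_or_lt with h1 | h1
    · rw [hl.eq_of_side hs hi hy h1.symm]; exact hl.hidden
    rcases h2.eq_or_lt with h2 | h2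
    · rw [hr.eq_of_side hs hi hy h2.symm]; exact hr.hidden
    intro hv
    have huy : Tendsto (fun m => (u m, y)) atTop (𝓝 (p, y)) := hu.prodMk_nhds tendsto_const_nhds
    obtain ⟨m, h3, h4, h5⟩ := (huy.eventually ((visible_local hP hk hp hin hy hv).and
      (((tendsto_side σ₁ (poly j₁) p y).eventually (lt_mem_nhds h1)).and
        ((tendsto_side σ₂ (poly j₂) p y).eventually (lt_mem_nhds h2))))).exists
    exact (h m).hidden y hy h4.le h5.le (h3 hy)

/-- A track that exists somewhere in a connected part of the domain exists everywhere in it. -/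
lemma IsTrack.forall_mem (hk : Even k) {C : Set Plane} (hC : IsPreconnected C)
    (hCO : C ⊆ cellDomain poly P k) (hpC : p ∈ C) (h : IsTrack hP k i j₁ j₂ σ₁ σ₂ p y₁ y₂) :
    ∀ p' ∈ C, ∃ y₁ y₂, IsTrack hP k i j₁ j₂ σ₁ σ₂ p' y₁ y₂ := by
  set G : Set Plane := {p' ∈ cellDomain poly P k | ∃ y₁ y₂, IsTrack hP k i j₁ j₂ σ₁ σ₂ p' y₁ y₂}
    with hG
  have hGo : IsOpen G := by
    rw [isOpen_iff_eventually]
    rintro q ⟨hq, z₁, z₂, hz⟩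
    filter_upwards [isOpen_cellDomain.mem_nhds hq, hz.eventually hk hq] with q' h1 h2
    exact ⟨h1, _, _, h2⟩
  have hGc : ∀ q ∈ cellDomain poly P k, q ∈ closure G → q ∈ G := by
    intro q hq hqG
    obtain ⟨u, huG, hu⟩ := mem_closure_iff_seq_limit.1 hqG
    choose _ w₁ w₂ hw using huG
    -- The ends range over the compact edge, so they converge along a subsequence; this gives
    -- relative closedness.
    obtain ⟨⟨z₁, z₂⟩, -, φ, hφ, hz⟩ := ((isCompact_edgeSet poly i).prod
      (isCompact_edgeSet poly i)).tendsto_subseq (x := fun m => (w₁ m, w₂ m))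
      fun m => ⟨(hw m).left.mem_edge, (hw m).right.mem_edge⟩
    have hz₁ := (continuous_fst.tendsto _).comp hz
    have hz₂ := (continuous_snd.tendsto _).comp hz
    exact ⟨hq, z₁, z₂, isTrack_of_tendsto hk hq (hu.comp hφ.tendsto_atTop) hz₁ hz₂
      fun m => hw (φ m)⟩
  intro p' hp'
  by_contra hcon
  have hp'G : p' ∉ G := fun h' => hcon h'.2
  obtain ⟨q, hqC, hqG, hq⟩ := hC G (closure G)ᶜ hGo isClosed_closure.isOpen_compl
    (fun q hq => by
      by_cases h' : q ∈ closure G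
      · exact Or.inl (hGc q (hCO hq) h')
      · exact Or.inr h') ⟨p, hpC, hCO hpC, y₁, y₂, h⟩
    ⟨p', hp', fun h' => hp'G (hGc p' (hCO hp') h')⟩
  exact hq (subset_closure hqG)

end Track

/-! ### Unobstructed segments that end in a given edge -/

section Segments

variable {poly : Polygon Plane n} {P : Set Plane} {k : ℕ} {p x y : Plane} {i j : Fin n}

lemma exists_vertex_of_edgeForm_eq_zero (hs : IsSimple poly) {q : Plane} (hq : q ∈ openEdge poly j)
    (hy : y ∉ poly.edgeSet ℝ j) (h0 : edgeForm poly j y = 0) :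
    ∃ j', poly j' ∈ openSegment ℝ y q := by
  rw [edgeForm_eq_orient] at h0
  rw [edgeSet_eq] at hy
  rcases mem_openSegment_of_collinear (hs.nondegenerate j) h0 hy with h | h
  · rcases eq_or_mem_openSegment h (openSegment_subset_segment _ _ _ hq) with h' | h'
    · exact absurd (h' ▸ hq) (hs.left_notMem_openEdge j)
    · exact ⟨_, h'⟩
  · have hq' := openSegment_subset_segment _ _ _ hq
    rw [segment_symm] at hq'
    rcases eq_or_mem_openSegment h hq' with h' | h'
    · exact absurd (h' ▸ hq) (hs.right_notMem_openEdge j)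
    · exact ⟨_, h'⟩

lemma tendsto_lineMap_param (a b : Plane) (t : ℝ) :
    Tendsto (fun s : ℝ => (AffineMap.lineMap a b s : Plane)) (𝓝 t)
      (𝓝 (AffineMap.lineMap a b t)) := by
  have : Continuous fun s : ℝ => (AffineMap.lineMap a b s : Plane) := AffineMap.lineMap_continuous
  exact this.tendsto t

lemma eventually_lineMap_mem_openSegment {q : Plane} (hq : q ∈ openSegment ℝ x y) :
    ∃ t : ℝ, AffineMap.lineMap x y t = q ∧
      ∀ᶠ s in 𝓝 t, (AffineMap.lineMap x y s : Plane) ∈ openSegment ℝ x y := by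
  obtain ⟨t, ht, rfl⟩ := mem_openSegment_iff_lineMap.1 hq
  refine ⟨t, rfl, ?_⟩
  filter_upwards [Ioo_mem_nhds ht.1 ht.2] with s hs
  exact mem_openSegment_iff_lineMap.2 ⟨s, hs, rfl⟩

/-- A segment in the region that contains no vertex and is not along an edge runs in the
interior. -/
lemma openSegment_subset_interior (hP : IsRegionOf P poly) (hxy : segment ℝ x y ⊆ P)
    (hy : y ∈ openEdge poly i) (hx : edgeForm poly i x ≠ 0)
    (hv : ∀ j, poly j ∉ openSegment ℝ x y) : openSegment ℝ x y ⊆ interior P := by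
  have hs := hP.simple
  intro q hq
  by_contra hqi
  have hqb : q ∈ poly.boundary ℝ :=
    hP.frontier_eq ▸ ⟨subset_closure (hxy (openSegment_subset_segment _ _ _ hq)), hqi⟩
  obtain ⟨j, hqj⟩ := mem_iUnion.1 hqb
  have hqo : q ∈ openEdge poly j := by
    rcases mem_edge_cases hqj with rfl | rfl | h
    · exact absurd hq (hv _)
    · exact absurd hq (hv _)
    · exact h
  obtain ⟨t, rfl, ht⟩ := eventually_lineMap_mem_openSegment hq
  have hij : y ∉ poly.edgeSet ℝ j := by
    intro hyj
    have := hs.eq_of_mem_openEdge hy hyj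
    subst this
    exact notMem_edge_of_mem_openSegment hx hyj hq hqj
  have hyj : edgeForm poly j y ≠ 0 := fun h0 => by
    obtain ⟨j', hj'⟩ := exists_vertex_of_edgeForm_eq_zero hs hqo hij h0
    rw [openSegment_symm] at hq
    exact hv j' (openSegment_symm ℝ x y ▸ openSegment_subset_of_mem hq hj')
  have h0 := innerForm_of_mem hP hqj
  rw [innerForm_lineMap] at h0
  have hyj' : innerForm hP j y ≠ 0 := fun h => hyj ((innerForm_eq_zero hP).1 h)
  set a := innerForm hP j x with ha
  set b := innerForm hP j y with hb
  have hab : b - a ≠ 0 := fun h => hyj' (by linear_combination h0 + (1 - t) * h)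
  -- The form of edge `j` has nonzero slope along the segment, so the segment would leave `P` at
  -- `q`; but it is contained in `P`.
  have key : ∀ᶠ s in 𝓝 t, ¬ (s - t) * (b - a) < 0 := by
    filter_upwards [ht, (tendsto_lineMap_param x y t).eventually (eventually_inner hP hqo)]
      with s h1 h2 h3
    apply h2.2 _ (hxy (openSegment_subset_segment _ _ _ h1))
    rw [innerForm_lineMap, ← ha, ← hb]
    linarith
  rcases lt_or_gt_of_ne hab with h5 | h5
  · obtain ⟨s, h6, h7⟩ := ((key.filter_mono nhdsWithin_le_nhds).and
      (self_mem_nhdsWithin (a := t) (s := Ioi t))).exists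
    exact h6 (mul_neg_of_pos_of_neg (sub_pos.2 h7) h5)
  · obtain ⟨s, h6, h7⟩ := ((key.filter_mono nhdsWithin_le_nhds).and
      (self_mem_nhdsWithin (a := t) (s := Iio t))).exists
    exact h6 (mul_neg_of_neg_of_pos (sub_neg.2 h7) h5)

lemma innerForm_nonneg_of_mem (hP : IsRegionOf P poly) (hx : x ∈ openEdge poly j) :
    ∀ᶠ x' in 𝓝 x, x' ∈ P → 0 ≤ innerForm hP j x' := by
  filter_upwards [eventually_inner hP hx] with x' h h'
  exact not_lt.1 fun h'' => h.2 h'' h'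

/-- A segment into the interior leaves an edge on the inner side. -/
lemma innerForm_pos_of_openSegment (hP : IsRegionOf P poly) (hx : x ∈ openEdge poly j)
    (hxy : openSegment ℝ x y ⊆ interior P) : 0 < innerForm hP j y := by
  have h1 := tendsto_lineMap_param x y 0
  rw [AffineMap.lineMap_apply_zero] at h1
  have h2 : ∀ᶠ s in 𝓝[>] (0 : ℝ), s ∈ Ioo (0 : ℝ) 1 := Ioo_mem_nhdsGT one_pos
  obtain ⟨s, ⟨h3, h4⟩, h5⟩ := (((h1.eventually ((innerForm_nonneg_of_mem hP hx).and
    (eventually_mem_openEdge hP.simple hx))).filter_mono nhdsWithin_le_nhds).and h2).exists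
  have h6 := hxy (mem_openSegment_iff_lineMap.2 ⟨s, h5, rfl⟩)
  have h7 := h3 (interior_subset h6)
  have h8 : innerForm hP j (AffineMap.lineMap x y s) ≠ 0 := fun h0 =>
    notMem_boundary_of_mem_interior hP h6
      (edgeSet_subset_boundary _ _ (openEdge_subset _ _ (h4 ((innerForm_eq_zero hP).1 h0))))
  rw [innerForm_lineMap, innerForm_of_mem hP (openEdge_subset _ _ hx)] at h7 h8
  have h9 := lt_of_le_of_ne h7 (Ne.symm h8)
  rw [mul_zero, zero_add] at h9
  exact pos_of_mul_pos_right h9 h5.1.le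

lemma innerForm_pos_of_mem_openSegment (hP : IsRegionOf P poly) {q : Plane}
    (hx : 0 ≤ innerForm hP j x) (hy : 0 ≤ innerForm hP j y)
    (h : 0 < innerForm hP j x ∨ 0 < innerForm hP j y) (hq : q ∈ openSegment ℝ x y) :
    0 < innerForm hP j q := by
  obtain ⟨t, ht, rfl⟩ := mem_openSegment_iff_lineMap.1 hq
  rw [innerForm_lineMap]
  have h1 : 0 < 1 - t := sub_pos.2 ht.2
  rcases h with h | h
  · exact add_pos_of_pos_of_nonneg (mul_pos h1 h) (mul_nonneg ht.1.le hy)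
  · exact add_pos_of_nonneg_of_pos (mul_nonneg h1.le hx) (mul_pos ht.1 h)

/-- The condition that segments from points of `A` near `x` to points near `y` do not meet the
curve close to `x`. -/
def LeavesFreely (poly : Polygon Plane n) (A : Set Plane) (x y : Plane) : Prop :=
  ∃ N ∈ 𝓝 x, ∀ᶠ z : Plane × Plane in 𝓝 (x, y), z.1 ∈ A → meets poly z.1 z.2 ∩ N = ∅

/-- On an open edge, points of `P` near `x` have nonnegative inner form and points near `y` positive
inner form, so the form is positive strictly between them, while near `x` the curve lies in its zero
set. -/
lemma leavesFreely_of_notMem_vertex (hP : IsRegionOf P poly)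
    (hxv : ∀ j, x ≠ poly j) (hxy : openSegment ℝ x y ⊆ interior P) : LeavesFreely poly P x y := by
  by_cases hxb : x ∈ poly.boundary ℝ
  · obtain ⟨j, hj⟩ := mem_iUnion.1 hxb
    have hxo : x ∈ openEdge poly j := by
      rcases mem_edge_cases hj with h | h | h
      · exact absurd h (hxv _)
      · exact absurd h (hxv _)
      · exact h
    refine ⟨_, eventually_mem_edge_of_boundary hP.simple hxo, ?_⟩
    have t1 : Tendsto (fun z : Plane × Plane => z.1) (𝓝 (x, y)) (𝓝 x) := continuous_fst.tendsto _
    have t2 : Tendsto (fun z : Plane × Plane => innerForm hP j z.2) (𝓝 (x, y))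
        (𝓝 (innerForm hP j y)) := ((continuous_innerForm hP j).comp continuous_snd).tendsto _
    filter_upwards [t1.eventually (innerForm_nonneg_of_mem hP hxo),
      t2.eventually (lt_mem_nhds (innerForm_pos_of_openSegment hP hxo hxy))] with z h1 h2 h3
    refine eq_empty_of_forall_notMem fun q hq => ?_
    exact (innerForm_pos_of_mem_openSegment hP (h1 h3) h2.le (Or.inr h2) hq.1.1).ne'
      (innerForm_of_mem hP (hq.2 hq.1.2))
  · obtain ⟨N, hN, h⟩ := exists_nhds_meets_empty hxb (𝓝 (x, y))
    exact ⟨N, hN, h.mono fun _ hz _ => hz⟩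

/-- The start is pinned to the vertex, because from other nearby points an arm could be in the way.
With the vertex as fixed end, `eventually_openSegment_inter_arm` applies to the reversed segment. -/
lemma leavesFreely_vertex (hs : IsSimple poly) (hy : poly j ≠ y)
    (hxy : ∀ q ∈ openSegment ℝ (poly j) y, q ∉ poly.boundary ℝ) :
    LeavesFreely poly {poly j} (poly j) y := by
  have h := hs.isArms_vertex j
  obtain ⟨N, hN, hsub⟩ := h.locally_eq
  have hmid : midpoint ℝ (poly j) y ∈ openSegment ℝ (poly j) y :=
    mem_openSegment_iff_lineMap.2 ⟨1 / 2, by norm_num, by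
      rw [midpoint]; norm_num⟩
  have hseg : ∀ a, segment ℝ (poly j) a ⊆ poly.boundary ℝ → y ∉ segment ℝ (poly j) a :=
    fun a ha hya => hxy _ hmid (ha ((convex_segment _ _).segment_subset (left_mem_segment _ _ _) hya
      (openSegment_subset_segment _ _ _ hmid)))
  have hopen : ∀ a, segment ℝ (poly j) a ⊆ poly.boundary ℝ → a ∉ openSegment ℝ y (poly j) :=
    fun a ha h' => hxy a (openSegment_symm ℝ y (poly j) ▸ h') (ha (right_mem_segment _ _ _))
  have hl := subset_union_left.trans h.subset
  have hr := subset_union_right.trans h.subset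
  have t2 : Tendsto (fun z : Plane × Plane => z.2) (𝓝 (poly j, y)) (𝓝 y) := continuous_snd.tendsto _
  refine ⟨N, hN, ?_⟩
  filter_upwards [t2.eventually (IsArms.eventually_openSegment_inter_arm hy.symm h.left_ne
    (hseg _ hl) (hopen _ hl)), t2.eventually (IsArms.eventually_openSegment_inter_arm hy.symm
    h.right_ne (hseg _ hr) (hopen _ hr))] with z h1 h2 h3
  refine eq_empty_of_forall_notMem fun q hq => ?_
  have hq1 := hq.1.1
  rw [mem_singleton_iff.1 h3, openSegment_symm] at hq1
  rcases hsub ⟨hq.1.2, hq.2⟩ with h4 | h4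
  · exact h1 q hq1 h4
  · exact h2 q hq1 h4

/-- Stability of unobstructed segments that end in an open edge. -/
lemma eventually_openSegment_subset_interior (hP : IsRegionOf P poly) {A : Set Plane}
    (hy : y ∈ openEdge poly i) (hxy : x ≠ y → openSegment ℝ x y ⊆ interior P)
    (hA : x ≠ y → LeavesFreely poly A x y) :
    ∀ᶠ z : Plane × Plane in 𝓝 (x, y), z.1 ∈ A → 0 < innerForm hP i z.1 → z.2 ∈ poly.edgeSet ℝ i →
      openSegment ℝ z.1 z.2 ⊆ interior P := by
  have t2 : Tendsto (fun z : Plane × Plane => z.2) (𝓝 (x, y)) (𝓝 y) := continuous_snd.tendsto _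
  set R : Set (Plane × Plane) := {z | z.1 ∈ A ∧ 0 < innerForm hP i z.1 ∧ z.2 ∈ poly.edgeSet ℝ i}
    with hR
  have hend : ∃ N ∈ 𝓝 y, ∀ᶠ z in 𝓝 (x, y) ⊓ 𝓟 R, meets poly z.1 z.2 ∩ N = ∅ := by
    refine ⟨_, eventually_mem_edge_of_boundary hP.simple hy, ?_⟩
    refine eventually_inf_principal.2 (Eventually.of_forall fun z hz => ?_)
    refine eq_empty_of_forall_notMem fun q hq => ?_
    exact (innerForm_pos_of_mem_openSegment hP hz.2.1.le (innerForm_of_mem hP hz.2.2).ge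
      (Or.inl hz.2.1) hq.1.1).ne' (innerForm_of_mem hP (hq.2 hq.1.2))
  have hempty : ∀ᶠ z in 𝓝 (x, y) ⊓ 𝓟 R, (meets poly z.1 z.2).encard ≤
      (∑ q ∈ (∅ : Finset Plane), (fun _ => 0) q : ℕ) := by
    refine eventually_encard_meets_le inf_le_left ∅ (fun _ => 0) (fun q hq _ => ?_) (by simp)
    by_cases hxy' : x = y
    · subst hxy'
      rw [segment_same] at hq
      rw [mem_singleton_iff.1 hq]
      exact hend
    rw [← insert_endpoints_openSegment] at hq
    rcases hq with rfl | rfl | hq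
    · obtain ⟨N, hN, h⟩ := hA hxy'
      refine ⟨N, hN, eventually_inf_principal.2 (h.mono fun z hz hzR => hz hzR.1)⟩
    · exact hend
    · exact exists_nhds_meets_empty (notMem_boundary_of_mem_interior hP (hxy hxy' hq)) _
  filter_upwards [eventually_inf_principal.1 hempty,
    t2.eventually (eventually_inner hP hy).eventually_nhds] with z h1 h2 hzA hz hze
  have h3 : meets poly z.1 z.2 = ∅ := by simpa using h1 ⟨hzA, hz, hze⟩
  -- The open segment misses the curve, so one of its points decides; a point close to `z.2` is
  -- inside since its inner form is positive.
  have h4 := tendsto_lineMap_param z.1 z.2 1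
  rw [AffineMap.lineMap_apply_one] at h4
  have h5 : ∀ᶠ s in 𝓝[<] (1 : ℝ), s ∈ Ioo (0 : ℝ) 1 := Ioo_mem_nhdsLT one_pos
  obtain ⟨s, h6, h7⟩ := (((h4.eventually h2).filter_mono nhdsWithin_le_nhds).and h5).exists
  have h8 : (AffineMap.lineMap z.1 z.2 s : Plane) ∈ openSegment ℝ z.1 z.2 :=
    mem_openSegment_iff_lineMap.2 ⟨s, h7, rfl⟩
  exact subset_interior_of_preconnected hP (convex_openSegment _ _).isPreconnected
    (fun q hq hqb => by
      have : q ∈ meets poly z.1 z.2 := ⟨hq, hqb⟩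
      rw [h3] at this; exact this) h8
    (interior_subset (h6.1 (innerForm_pos_of_mem_openSegment hP hz.le (innerForm_of_mem hP hze).ge
      (Or.inl hz) h8)))

end Segments

/-! ### The shadow that belongs to a track -/

section TrackShadow

variable {poly : Polygon Plane n} {P : Set Plane} {k : ℕ} {p x y : Plane} {i j j₁ j₂ : Fin n}
  {σ₁ σ₂ : ℝ} {y₁ y₂ : Plane}

/-- From `x` one can go straight away from `p`, inside `P`, to a point of edge `i` between the lines
from `p` to the vertices `j₁` and `j₂`. -/
def ReachesTrack (poly : Polygon Plane n) (P : Set Plane) (i j₁ j₂ : Fin n) (σ₁ σ₂ : ℝ)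
    (p x : Plane) : Prop :=
  ∃ y ∈ poly.edgeSet ℝ i, 0 ≤ σ₁ * orient p (poly j₁) y ∧ 0 ≤ σ₂ * orient p (poly j₂) y ∧
    x ∈ segment ℝ p y ∧ segment ℝ x y ⊆ P

/-- The hidden points in front of a track. -/
def trackShadow (poly : Polygon Plane n) (P : Set Plane) (k : ℕ) (i j₁ j₂ : Fin n) (σ₁ σ₂ : ℝ)
    (p : Plane) : Set Plane :=
  {x ∈ hidden poly P k p | ReachesTrack poly P i j₁ j₂ σ₁ σ₂ p x}

/-- The witnesses, a point of the edge and a parameter in `[0, 1]`, range over compact sets, and all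
conditions are closed. -/
lemma isClosed_reachesTrack (hP : IsClosed P) :
    IsClosed {z : Plane × Plane | ReachesTrack poly P i j₁ j₂ σ₁ σ₂ z.1 z.2} := by
  refine IsSeqClosed.isClosed fun z z₀ hz hlim => ?_
  choose y hye hy₁ hy₂ hxy hseg using hz
  choose t ht hty using fun m => mem_segment_iff_lineMap.1 (hxy m)
  obtain ⟨⟨y', t'⟩, ⟨hye', ht'⟩, φ, hφ, hlim'⟩ := ((isCompact_edgeSet poly i).prod
    (isCompact_Icc (a := (0 : ℝ)) (b := 1))).tendsto_subseq (x := fun m => (y m, t m))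
    fun m => ⟨hye m, ht m⟩
  have hy' := (continuous_fst.tendsto _).comp hlim'
  have ht'' := (continuous_snd.tendsto _).comp hlim'
  have hz := hlim.comp hφ.tendsto_atTop
  have hz₁ := (continuous_fst.tendsto _).comp hz
  have hz₂ := (continuous_snd.tendsto _).comp hz
  have hcont : Continuous fun w : Plane × Plane × ℝ => (AffineMap.lineMap w.1 w.2.1 w.2.2 : Plane) := by
    simp only [AffineMap.lineMap_apply_module]; fun_prop
  refine ⟨y', hye', ?_, ?_, ?_, ?_⟩
  · exact ge_of_tendsto ((tendsto_side σ₁ (poly j₁) z₀.1 y').comp (hz₁.prodMk_nhds hy'))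
      (Eventually.of_forall fun m => hy₁ (φ m))
  · exact ge_of_tendsto ((tendsto_side σ₂ (poly j₂) z₀.1 y').comp (hz₁.prodMk_nhds hy'))
      (Eventually.of_forall fun m => hy₂ (φ m))
  · refine mem_segment_iff_lineMap.2 ⟨t', ht', ?_⟩
    refine tendsto_nhds_unique ((hcont.tendsto (z₀.1, y', t')).comp
      (hz₁.prodMk_nhds (hy'.prodMk_nhds ht''))) (hz₂.congr fun m => ?_)
    exact (hty (φ m)).symm
  · intro q hq
    obtain ⟨s, hs, rfl⟩ := mem_segment_iff_lineMap.1 hq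
    refine hP.mem_of_tendsto ((hcont.tendsto (z₀.2, y', s)).comp
      (hz₂.prodMk_nhds (hy'.prodMk_nhds tendsto_const_nhds))) (Eventually.of_forall fun m => ?_)
    exact hseg (φ m) (mem_segment_iff_lineMap.2 ⟨s, hs, rfl⟩)

lemma kVisible_self (poly : Polygon Plane n) (k : ℕ) (p : Plane) : KVisible poly k p p := by
  rw [KVisible, crossings_self]; exact zero_le

/-- Hidden points stay hidden when they move away from `p`. -/
lemma hidden_of_mem_segment (hh : ¬ KVisible poly k p x) (hx : x ∈ segment ℝ p y) :
    ¬ KVisible poly k p y := by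
  rw [← insert_endpoints_openSegment] at hx
  rcases hx with rfl | rfl | hx
  · exact absurd (kVisible_self poly k x) hh
  · exact hh
  · have hpx : p ≠ x := fun h => hh (h ▸ kVisible_self poly k p)
    have hpy : p ≠ y := ne_of_mem_openSegment hx hpx.symm
    rw [kVisible_iff hpx] at hh
    rw [kVisible_iff hpy]
    exact fun h => hh ((encard_le_encard (meets_subset_of_mem hx)).trans h)

lemma mem_segment_between {q : Plane} (hx : x ∈ segment ℝ p y) (hq : q ∈ segment ℝ x y) :
    q ∈ segment ℝ p y ∧ x ∈ segment ℝ p q ∧ segment ℝ q y ⊆ segment ℝ x y := by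
  have h1 : Wbtw ℝ p x y := mem_segment_iff_wbtw.1 hx
  have h2 : Wbtw ℝ x q y := mem_segment_iff_wbtw.1 hq
  exact ⟨(convex_segment p y).segment_subset hx (right_mem_segment _ _ _) hq,
    mem_segment_iff_wbtw.2 (h1.trans_right_left h2),
    (convex_segment x y).segment_subset hq (right_mem_segment _ _ _)⟩

variable {hP : IsRegionOf P poly}

lemma trackShadow_subset : trackShadow poly P k i j₁ j₂ σ₁ σ₂ p ⊆ hidden poly P k p :=
  fun _ h => h.1

lemma segment_subset_trackShadow (hh : ¬ KVisible poly k p x) (hy : y ∈ poly.edgeSet ℝ i)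
    (h₁ : 0 ≤ σ₁ * orient p (poly j₁) y) (h₂ : 0 ≤ σ₂ * orient p (poly j₂) y)
    (hx : x ∈ segment ℝ p y) (hxy : segment ℝ x y ⊆ P) :
    segment ℝ x y ⊆ trackShadow poly P k i j₁ j₂ σ₁ σ₂ p := fun _ hq =>
  have h := mem_segment_between hx hq
  ⟨⟨hxy hq, hidden_of_mem_segment hh h.2.1⟩, y, hy, h₁, h₂, h.1, h.2.2.trans hxy⟩

lemma tendsto_hit_pair (hP : IsRegionOf P poly) (h : innerForm hP i x ≠ innerForm hP i p) :
    Tendsto (fun z : Plane × Plane => hit hP i z.2 z.1) (𝓝 (p, x)) (𝓝 (hit hP i x p)) := by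
  have c₁ : ContinuousAt (fun z : Plane × Plane => innerForm hP i z.1) (p, x) :=
    ((continuous_innerForm hP i).comp continuous_fst).continuousAt
  have c₂ : ContinuousAt (fun z : Plane × Plane => innerForm hP i z.2) (p, x) :=
    ((continuous_innerForm hP i).comp continuous_snd).continuousAt
  have c₃ := c₁.div (c₁.sub c₂) (sub_ne_zero.2 h.symm)
  have c₄ : ContinuousAt (fun z : Plane × Plane => hit hP i z.2 z.1) (p, x) := by
    simp only [hit, AffineMap.lineMap_apply_module]
    exact ((continuousAt_const.sub c₃).smul continuousAt_fst).add (c₃.smul continuousAt_snd)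
  exact c₄

lemma mem_segment_hit (hP : IsRegionOf P poly) (h0 : 0 ≤ innerForm hP i x)
    (h : innerForm hP i x < innerForm hP i p) : x ∈ segment ℝ p (hit hP i x p) := by
  have h1 : 0 < innerForm hP i p - innerForm hP i x := sub_pos.2 h
  have h2 : 0 < innerForm hP i p := h0.trans_lt h
  refine mem_segment_iff_lineMap.2 ⟨(innerForm hP i p - innerForm hP i x) / innerForm hP i p,
    ⟨(div_pos h1 h2).le, (div_le_one h2).2 (by linarith)⟩, ?_⟩
  apply plane_ext <;> simp only [hit, lineMap_coord] <;> field_simp <;> ring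

namespace IsTrack

lemma mem_trackShadow (h : IsTrack hP k i j₁ j₂ σ₁ σ₂ p y₁ y₂) (hy : y ∈ poly.edgeSet ℝ i)
    (h₁ : 0 ≤ σ₁ * orient p (poly j₁) y) (h₂ : 0 ≤ σ₂ * orient p (poly j₂) y) :
    y ∈ trackShadow poly P k i j₁ j₂ σ₁ σ₂ p := by
  have hyP : y ∈ P := hP.isCompact.isClosed.frontier_subset
    (hP.frontier_eq ▸ edgeSet_subset_boundary _ _ hy)
  refine segment_subset_trackShadow (h.hidden y hy h₁ h₂) hy h₁ h₂ (right_mem_segment _ _ _) ?_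
    (left_mem_segment _ _ _)
  rw [segment_same]
  exact singleton_subset_iff.2 hyP

lemma left_mem_trackShadow (h : IsTrack hP k i j₁ j₂ σ₁ σ₂ p y₁ y₂) :
    y₁ ∈ trackShadow poly P k i j₁ j₂ σ₁ σ₂ p :=
  h.mem_trackShadow h.left.mem_edge (by rw [h.left.orient_eq_zero, mul_zero]) h.right_pos.le

/-- Each point is joined by its own segment to the interval on the edge, which is convex. -/
lemma isPreconnected_trackShadow (h : IsTrack hP k i j₁ j₂ σ₁ σ₂ p y₁ y₂) :
    IsPreconnected (trackShadow poly P k i j₁ j₂ σ₁ σ₂ p) := by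
  set I : Set Plane := {y | y ∈ poly.edgeSet ℝ i ∧ 0 ≤ σ₁ * orient p (poly j₁) y ∧
    0 ≤ σ₂ * orient p (poly j₂) y} with hI
  have hIconv : Convex ℝ I := by
    intro u hu v hv a b ha hb hab
    have e : a • u + b • v = AffineMap.lineMap u v b := by
      rw [AffineMap.lineMap_apply_module, ← hab, add_sub_cancel_right]
    refine ⟨?_, ?_, ?_⟩
    · have h1 := hu.1
      have h2 := hv.1
      rw [edgeSet_eq] at h1 h2 ⊢
      exact convex_segment _ _ h1 h2 ha hb hab
    · have : 0 ≤ a * (σ₁ * orient p (poly j₁) u) + b * (σ₁ * orient p (poly j₁) v) :=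
        add_nonneg (mul_nonneg ha hu.2.1) (mul_nonneg hb hv.2.1)
      rw [e, orient_lineMap_right, ← hab, add_sub_cancel_right]
      linarith
    · have : 0 ≤ a * (σ₂ * orient p (poly j₂) u) + b * (σ₂ * orient p (poly j₂) v) :=
        add_nonneg (mul_nonneg ha hu.2.2) (mul_nonneg hb hv.2.2)
      rw [e, orient_lineMap_right, ← hab, add_sub_cancel_right]
      linarith
  have hy₁ : y₁ ∈ I :=
    ⟨h.left.mem_edge, by rw [h.left.orient_eq_zero, mul_zero], h.right_pos.le⟩
  refine isPreconnected_of_forall y₁ fun x hx => ?_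
  obtain ⟨y, hy, h₁, h₂, hxy, hseg⟩ := hx.2
  have hyI : y ∈ I := ⟨hy, h₁, h₂⟩
  refine ⟨segment ℝ x y ∪ I, union_subset
    (segment_subset_trackShadow hx.1.2 hy h₁ h₂ hxy hseg)
    fun q hq => h.mem_trackShadow hq.1 hq.2.1 hq.2.2, Or.inr hy₁, Or.inl (left_mem_segment _ _ _), ?_⟩
  exact (convex_segment x y).isPreconnected.union y (right_mem_segment _ _ _) hyI
    hIconv.isPreconnected

/-- Hidden points of the edge near the track belong to the track. -/
lemma eventually_mem (h : IsTrack hP k i j₁ j₂ σ₁ σ₂ p y₁ y₂) (hy : y ∈ poly.edgeSet ℝ i)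
    (h₁ : 0 ≤ σ₁ * orient p (poly j₁) y) (h₂ : 0 ≤ σ₂ * orient p (poly j₂) y) :
    ∀ᶠ z : Plane × Plane in 𝓝 (p, y), z.2 ∈ poly.edgeSet ℝ i → ¬ KVisible poly k z.1 z.2 →
      0 ≤ σ₁ * orient z.1 (poly j₁) z.2 ∧ 0 ≤ σ₂ * orient z.1 (poly j₂) z.2 := by
  have key : ∀ {j σ y'}, IsShadowEnd poly k i j σ p y' → 0 ≤ σ * orient p (poly j) y →
      ∀ᶠ z : Plane × Plane in 𝓝 (p, y), z.2 ∈ poly.edgeSet ℝ i → ¬ KVisible poly k z.1 z.2 →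
        0 ≤ σ * orient z.1 (poly j) z.2 := by
    intro j σ y' he hnn
    rcases hnn.eq_or_lt with h0 | h0
    · rw [he.eq_of_side hP.simple h.edgeForm_ne hy h0.symm]
      exact he.locally_iff.mono fun z hz h1 h2 => (hz h1).1 h2
    · exact ((tendsto_side σ (poly j) p y).eventually (lt_mem_nhds h0)).mono fun z hz _ _ => hz.le
  filter_upwards [key h.left h₁, key h.right h₂] with z h3 h4 h5 h6 using ⟨h3 h5 h6, h4 h5 h6⟩

/-- At the shadow end nearer to `e` its own form vanishes, yet it lies between `e`, where the form
is nonnegative, and the other end, where it is positive. Hence a track contains no endpoint of its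
edge. -/
lemma false_of_endpoint (h : IsTrack hP k i j₁ j₂ σ₁ σ₂ p y₁ y₂) {e e' : Plane}
    (he₁ : y₁ ∈ openSegment ℝ e e') (he₂ : y₂ ∈ openSegment ℝ e e')
    (h₁ : 0 ≤ σ₁ * orient p (poly j₁) e) (h₂ : 0 ≤ σ₂ * orient p (poly j₂) e) : False := by
  have key : ∀ {j : Fin n} {σ : ℝ} {u v : Plane}, 0 ≤ σ * orient p (poly j) e →
      0 < σ * orient p (poly j) v → orient p (poly j) u = 0 → u ∉ openSegment ℝ e v := by
    intro j σ u v h3 h4 h5 h6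
    obtain ⟨t, ht, rfl⟩ := mem_openSegment_iff_lineMap.1 h6
    rw [orient_lineMap_right] at h5
    have : 0 < (1 - t) * (σ * orient p (poly j) e) + t * (σ * orient p (poly j) v) :=
      add_pos_of_nonneg_of_pos (mul_nonneg (sub_pos.2 ht.2).le h3) (mul_pos ht.1 h4)
    have h7 : (1 - t) * (σ * orient p (poly j) e) + t * (σ * orient p (poly j) v) = 0 := by
      linear_combination σ * h5
    exact this.ne' h7
  rcases ray_trichotomy he₁ he₂ with h3 | h3 | h3
  · exact key h₁ h.left_pos h.left.orient_eq_zero h3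
  · have := h.left_pos
    rw [← h3, h.left.orient_eq_zero, mul_zero] at this
    exact lt_irrefl _ this
  · exact key h₂ h.right_pos h.right.orient_eq_zero h3

lemma mem_openEdge (h : IsTrack hP k i j₁ j₂ σ₁ σ₂ p y₁ y₂) (hy : y ∈ poly.edgeSet ℝ i)
    (h₁ : 0 ≤ σ₁ * orient p (poly j₁) y) (h₂ : 0 ≤ σ₂ * orient p (poly j₂) y) :
    y ∈ openEdge poly i := by
  rcases mem_edge_cases hy with rfl | rfl | h'
  · exact (h.false_of_endpoint h.left.mem h.right.mem h₁ h₂).elim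
  · have hl := h.left.mem
    have hr := h.right.mem
    rw [openEdge, openSegment_symm] at hl hr
    exact (h.false_of_endpoint hl hr h₁ h₂).elim
  · exact h'

/-- Hidden points near an unobstructed hidden point of the track shadow reach the track. -/
lemma eventually_reachesTrack (h : IsTrack hP k i j₁ j₂ σ₁ σ₂ p y₁ y₂)
    (hx : ¬ KVisible poly k p x) (hy : y ∈ poly.edgeSet ℝ i)
    (h₁ : 0 ≤ σ₁ * orient p (poly j₁) y) (h₂ : 0 ≤ σ₂ * orient p (poly j₂) y)
    (hxy : x ∈ segment ℝ p y) (hfree : x ≠ y → openSegment ℝ x y ⊆ interior P)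
    {A : Set Plane} (hAP : A ⊆ P) (hA : x ≠ y → LeavesFreely poly A x y) :
    ∀ᶠ z : Plane × Plane in 𝓝 (p, x), z.2 ∈ A → ¬ KVisible poly k z.1 z.2 →
      ReachesTrack poly P i j₁ j₂ σ₁ σ₂ z.1 z.2 := by
  have hyo := h.mem_openEdge hy h₁ h₂
  have hpx : p ≠ x := fun e => hx (e ▸ kVisible_self poly k p)
  have t₁ : Tendsto (fun z : Plane × Plane => z.1) (𝓝 (p, x)) (𝓝 p) := continuous_fst.tendsto _
  have t₂ : Tendsto (fun z : Plane × Plane => z.2) (𝓝 (p, x)) (𝓝 x) := continuous_snd.tendsto _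
  have hxcases : x = y ∨ x ∈ openSegment ℝ p y := by
    rw [← insert_endpoints_openSegment] at hxy
    rcases hxy with e | e | e
    · exact absurd e.symm hpx
    · exact Or.inl e
    · exact Or.inr e
  have hlt : innerForm hP i x < innerForm hP i p := by
    rcases hxcases with e | e
    · rw [e, innerForm_of_mem hP hy]; exact h.inner
    · exact (innerForm_lt_of_mem_openSegment hP h.inner hy e).2
  have hhit : hit hP i x p = y := by
    rcases hxcases with e | e
    · rw [hit, e, innerForm_of_mem hP hy, sub_zero, div_self h.inner.ne',
        AffineMap.lineMap_apply_one]
    · exact hit_eq hP h.inner hy e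
  have thit : Tendsto (fun z : Plane × Plane => hit hP i z.2 z.1) (𝓝 (p, x)) (𝓝 y) :=
    hhit ▸ tendsto_hit_pair hP hlt.ne
  have hnn : ∀ᶠ x' in 𝓝 x, x' ∈ P → 0 ≤ innerForm hP i x' := by
    rcases hxcases with e | e
    · rw [e]; exact innerForm_nonneg_of_mem hP hyo
    · filter_upwards [((continuous_innerForm hP i).tendsto x).eventually
        (lt_mem_nhds (innerForm_lt_of_mem_openSegment hP h.inner hy e).1)] with x' hx' _
      exact hx'.le
  have tlt : ∀ᶠ z : Plane × Plane in 𝓝 (p, x), innerForm hP i z.2 < innerForm hP i z.1 :=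
    (((continuous_innerForm hP i).tendsto x).comp t₂).eventually_lt
      (((continuous_innerForm hP i).tendsto p).comp t₁) hlt
  filter_upwards [tlt, t₂.eventually hnn, thit.eventually (eventually_mem_openEdge hP.simple hyo),
    (t₁.prodMk_nhds thit).eventually (h.eventually_mem hy h₁ h₂),
    (t₂.prodMk_nhds thit).eventually (eventually_openSegment_subset_interior hP hyo hfree hA)]
    with z a1 a2 a3 a4 a5 hzA hzh
  have hzP := hAP hzA
  have a6 := a2 hzP
  have hze := openEdge_subset _ _ (a3 ((innerForm_eq_zero hP).1 (innerForm_hit hP a1.ne)))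
  have hseg : z.2 ∈ segment ℝ z.1 (hit hP i z.2 z.1) := mem_segment_hit hP a6 a1
  -- The landing point on the edge is behind a hidden point, hence hidden, and is close to the
  -- track, hence on it.
  obtain ⟨a7, a8⟩ := a4 hze (hidden_of_mem_segment hzh hseg)
  refine ⟨_, hze, a7, a8, hseg, ?_⟩
  rcases a6.eq_or_lt with a9 | a9
  · have : hit hP i z.2 z.1 = z.2 := by
      rw [← a9] at a1
      rw [hit, ← a9, sub_zero, div_self a1.ne', AffineMap.lineMap_apply_one]
    rw [this, segment_same]
    exact singleton_subset_iff.2 hzP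
  · have hyP : hit hP i z.2 z.1 ∈ P := hP.isCompact.isClosed.frontier_subset
      (hP.frontier_eq ▸ edgeSet_subset_boundary _ _ hze)
    rw [← insert_endpoints_openSegment]
    exact insert_subset hzP (insert_subset hyP ((a5 hzA a9 hze).trans interior_subset))

lemma edgeForm_ne_of_mem (h : IsTrack hP k i j₁ j₂ σ₁ σ₂ p y₁ y₂) (hy : y ∈ poly.edgeSet ℝ i)
    (hh : ¬ KVisible poly k p x) (hx : x ∈ segment ℝ p y) (hxy : x ≠ y) :
    edgeForm poly i x ≠ 0 := by
  rw [← insert_endpoints_openSegment] at hx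
  rcases hx with rfl | rfl | hx
  · exact absurd (kVisible_self poly k x) hh
  · exact absurd rfl hxy
  · exact fun h0 => (innerForm_lt_of_mem_openSegment hP h.inner hy hx).1.ne'
      ((innerForm_eq_zero hP).2 h0)

/-- If the track shadow contains no vertex, it is stable under perturbation. -/
lemma eventually_reachesTrack_of_isTypeTwo (h : IsTrack hP k i j₁ j₂ σ₁ σ₂ p y₁ y₂)
    (hT : IsTypeTwo poly (trackShadow poly P k i j₁ j₂ σ₁ σ₂ p))
    (hx : x ∈ trackShadow poly P k i j₁ j₂ σ₁ σ₂ p) :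
    ∀ᶠ z : Plane × Plane in 𝓝 (p, x), z.2 ∈ P → ¬ KVisible poly k z.1 z.2 →
      ReachesTrack poly P i j₁ j₂ σ₁ σ₂ z.1 z.2 := by
  obtain ⟨y, hy, h₁, h₂, hxy, hseg⟩ := hx.2
  have hfree : x ≠ y → openSegment ℝ x y ⊆ interior P := fun hne =>
    openSegment_subset_interior hP hseg (h.mem_openEdge hy h₁ h₂)
      (h.edgeForm_ne_of_mem hy hx.1.2 hxy hne) fun j hj => hT j
        (segment_subset_trackShadow hx.1.2 hy h₁ h₂ hxy hseg (openSegment_subset_segment _ _ _ hj))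
  exact h.eventually_reachesTrack hx.1.2 hy h₁ h₂ hxy hfree subset_rfl fun hne =>
    leavesFreely_of_notMem_vertex hP (fun j e => hT j (e ▸ hx)) (hfree hne)

/-- From the last vertex before the edge the way is free of vertices, as the stability lemmas need.
-/
lemma exists_last_vertex (hy : ∀ j, poly j ≠ y) (j : Fin n) :
    ∃ j', poly j' ∈ segment ℝ (poly j) y ∧ ∀ j'', poly j'' ∉ openSegment ℝ (poly j') y := by
  obtain ⟨j', hj', hmin⟩ := Set.exists_min_image {j' | poly j' ∈ segment ℝ (poly j) y}
    (fun j' => dist y (poly j')) (Set.toFinite _) ⟨j, left_mem_segment _ _ _⟩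
  refine ⟨j', hj', fun j'' hj'' => ?_⟩
  have h1 : poly j'' ∈ segment ℝ (poly j) y := (convex_segment _ _).segment_subset hj'
    (right_mem_segment _ _ _) (openSegment_subset_segment _ _ _ hj'')
  rw [openSegment_symm] at hj''
  exact (hmin j'' h1).not_gt (dist_lt_of_mem_openSegment (hy j').symm hj'')

/-- The last vertex on the way to the track stays hidden by the cell condition and keeps reaching
the track, since its segment is unobstructed. -/
lemma eventually_exists_vertex (h : IsTrack hP k i j₁ j₂ σ₁ σ₂ p y₁ y₂) (hk : Even k)
    (hp : p ∈ cellDomain poly P k)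
    (hT : ¬ IsTypeTwo poly (trackShadow poly P k i j₁ j₂ σ₁ σ₂ p)) :
    ∀ᶠ p' in 𝓝 p, ¬ IsTypeTwo poly (trackShadow poly P k i j₁ j₂ σ₁ σ₂ p') := by
  simp only [IsTypeTwo, not_forall, not_not] at hT ⊢
  obtain ⟨j, hj⟩ := hT
  obtain ⟨y, hy, h₁, h₂, hxy, hseg⟩ := hj.2
  have hyo := h.mem_openEdge hy h₁ h₂
  have hyv : ∀ j', poly j' ≠ y := fun j' e => hP.simple.vertex_notMem_openEdge j' i (e ▸ hyo)
  obtain ⟨j', hj', hlast⟩ := exists_last_vertex hyv j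
  have hsub := segment_subset_trackShadow hj.1.2 hy h₁ h₂ hxy hseg
  obtain ⟨hxy', -, hseg'⟩ := mem_segment_between hxy hj'
  have hh := (hsub hj').1.2
  have hfree := openSegment_subset_interior hP (hseg'.trans hseg) hyo
    (h.edgeForm_ne_of_mem hy hh hxy' (hyv j')) hlast
  have hev := h.eventually_reachesTrack (A := {poly j'}) hh hy h₁ h₂ hxy' (fun _ => hfree)
    (singleton_subset_iff.2 (hsub hj').1.1) fun hne => leavesFreely_vertex hP.simple hne
      fun q hq => notMem_boundary_of_mem_interior hP (hfree hq)
  have t : Tendsto (fun p' => (p', poly j')) (𝓝 p) (𝓝 (p, poly j')) :=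
    tendsto_id.prodMk_nhds tendsto_const_nhds
  filter_upwards [t.eventually hev, eventually_vertex_iff hk hp j'] with p' h3 h4
  have h5 : ¬ KVisible poly k p' (poly j') := fun hv => hh (h4.1 hv)
  exact ⟨j', ⟨(hsub hj').1.1, h5⟩, h3 rfl h5⟩

/-- Visible vertices stay visible by the cell condition; hidden ones fail to reach the track, and
reaching is a closed condition. -/
lemma eventually_isTypeTwo (hP : IsRegionOf P poly) (hk : Even k)
    (hp : p ∈ cellDomain poly P k)
    (hT : IsTypeTwo poly (trackShadow poly P k i j₁ j₂ σ₁ σ₂ p)) :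
    ∀ᶠ p' in 𝓝 p, IsTypeTwo poly (trackShadow poly P k i j₁ j₂ σ₁ σ₂ p') := by
  refine eventually_all.2 fun j => ?_
  by_cases hv : KVisible poly k p (poly j)
  · filter_upwards [eventually_vertex_iff hk hp j] with p' h4 h5 using h5.1.2 (h4.2 hv)
  · have hjP : poly j ∈ P := hP.isCompact.isClosed.frontier_subset
      (hP.frontier_eq ▸ vertex_mem_boundary poly j)
    have hr : ¬ ReachesTrack poly P i j₁ j₂ σ₁ σ₂ p (poly j) := fun hr => hT j ⟨⟨hjP, hv⟩, hr⟩
    have t : Tendsto (fun p' => (p', poly j)) (𝓝 p) (𝓝 (p, poly j)) :=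
      tendsto_id.prodMk_nhds tendsto_const_nhds
    filter_upwards [t.eventually
      ((isClosed_reachesTrack hP.isCompact.isClosed).isOpen_compl.mem_nhds hr)] with p' h1 h2
    exact h1 h2.2

/-- Whether the track shadow contains a vertex does not depend on the position within a connected
part of the domain. -/
lemma isTypeTwo_of_mem (hk : Even k) {C : Set Plane} (hC : IsPreconnected C)
    (hCO : C ⊆ cellDomain poly P k)
    (hall : ∀ p ∈ C, ∃ y₁ y₂, IsTrack hP k i j₁ j₂ σ₁ σ₂ p y₁ y₂) (hp : p ∈ C)
    (hT : IsTypeTwo poly (trackShadow poly P k i j₁ j₂ σ₁ σ₂ p)) {p' : Plane} (hp' : p' ∈ C) :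
    IsTypeTwo poly (trackShadow poly P k i j₁ j₂ σ₁ σ₂ p') := by
  refine (hC.induction₂ (fun q q' => (IsTypeTwo poly (trackShadow poly P k i j₁ j₂ σ₁ σ₂ q) ↔
    IsTypeTwo poly (trackShadow poly P k i j₁ j₂ σ₁ σ₂ q'))) (fun q hq => ?_)
    (fun _ _ _ _ _ _ => Iff.trans) (fun _ _ _ _ => Iff.symm) hp hp').1 hT
  refine Eventually.filter_mono nhdsWithin_le_nhds ?_
  by_cases hq2 : IsTypeTwo poly (trackShadow poly P k i j₁ j₂ σ₁ σ₂ q)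
  · exact (eventually_isTypeTwo hP hk (hCO hq) hq2).mono fun _ h' => iff_of_true hq2 h'
  · obtain ⟨z₁, z₂, hz⟩ := hall q hq
    exact (hz.eventually_exists_vertex hk (hCO hq) hq2).mono fun _ h' => iff_of_false hq2 h'

/-- Membership in a track shadow without vertices is locally constant among hidden points. -/
lemma eventually_mem_trackShadow_iff (h : IsTrack hP k i j₁ j₂ σ₁ σ₂ p y₁ y₂)
    (hT : IsTypeTwo poly (trackShadow poly P k i j₁ j₂ σ₁ σ₂ p)) (hx : x ∈ KModem.hidden poly P k p) :
    ∀ᶠ z : Plane × Plane in 𝓝 (p, x), z.2 ∈ KModem.hidden poly P k z.1 →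
      (x ∈ trackShadow poly P k i j₁ j₂ σ₁ σ₂ p ↔
        z.2 ∈ trackShadow poly P k i j₁ j₂ σ₁ σ₂ z.1) := by
  by_cases hxS : x ∈ trackShadow poly P k i j₁ j₂ σ₁ σ₂ p
  · filter_upwards [h.eventually_reachesTrack_of_isTypeTwo hT hxS] with z h1 h2
    exact iff_of_true hxS ⟨h2, h1 h2.1 h2.2⟩
  · have hr : ¬ ReachesTrack poly P i j₁ j₂ σ₁ σ₂ p x := fun hr => hxS ⟨hx, hr⟩
    filter_upwards [(isClosed_reachesTrack hP.isCompact.isClosed).isOpen_compl.mem_nhds hr]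
      with z h1 h2
    exact iff_of_false hxS fun h3 => h1 h3.2

/-- A track shadow without vertices is a connected component of the hidden points. -/
lemma subset_trackShadow (h : IsTrack hP k i j₁ j₂ σ₁ σ₂ p y₁ y₂)
    (hT : IsTypeTwo poly (trackShadow poly P k i j₁ j₂ σ₁ σ₂ p)) {S : Set Plane}
    (hS : IsPreconnected S) (hSh : S ⊆ KModem.hidden poly P k p) (hxS : x ∈ S)
    (hx : x ∈ trackShadow poly P k i j₁ j₂ σ₁ σ₂ p) :
    S ⊆ trackShadow poly P k i j₁ j₂ σ₁ σ₂ p := by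
  intro x' hx'
  refine (hS.induction₂ (fun q q' => (q ∈ trackShadow poly P k i j₁ j₂ σ₁ σ₂ p ↔
    q' ∈ trackShadow poly P k i j₁ j₂ σ₁ σ₂ p)) (fun q hq => ?_)
    (fun _ _ _ _ _ _ => Iff.trans) (fun _ _ _ _ => Iff.symm) hxS hx').1 hx
  have t : Tendsto (fun q' => (p, q')) (𝓝 q) (𝓝 (p, q)) :=
    tendsto_const_nhds.prodMk_nhds tendsto_id
  filter_upwards [nhdsWithin_le_nhds (t.eventually (h.eventually_mem_trackShadow_iff hT (hSh hq))),
    self_mem_nhdsWithin] with q' h1 h2 using h1 (hSh h2)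

lemma isShadow (h : IsTrack hP k i j₁ j₂ σ₁ σ₂ p y₁ y₂)
    (hT : IsTypeTwo poly (trackShadow poly P k i j₁ j₂ σ₁ σ₂ p)) :
    IsShadow poly P k p (trackShadow poly P k i j₁ j₂ σ₁ σ₂ p) := by
  have hy := h.left_mem_trackShadow
  refine ⟨y₁, hy.1, subset_antisymm
    (h.isPreconnected_trackShadow.subset_connectedComponentIn hy trackShadow_subset) ?_⟩
  exact h.subset_trackShadow hT isPreconnected_connectedComponentIn
    (connectedComponentIn_subset _ _) (mem_connectedComponentIn hy.1) hy

/-- Membership in the track shadow is preserved by continuous motions of the pursuer and of a hidden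
point. -/
lemma mem_trackShadow_iff_of_continuousOn {γ η : ℝ → Plane} {s t : ℝ} (hst : s ≤ t)
    (hγ : ContinuousOn γ (Icc s t)) (hη : ContinuousOn η (Icc s t))
    (hall : ∀ r ∈ Icc s t, ∃ y₁ y₂, IsTrack hP k i j₁ j₂ σ₁ σ₂ (γ r) y₁ y₂)
    (hT : ∀ r ∈ Icc s t, IsTypeTwo poly (trackShadow poly P k i j₁ j₂ σ₁ σ₂ (γ r)))
    (hh : ∀ r ∈ Icc s t, η r ∈ KModem.hidden poly P k (γ r)) :
    η s ∈ trackShadow poly P k i j₁ j₂ σ₁ σ₂ (γ s) ↔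
      η t ∈ trackShadow poly P k i j₁ j₂ σ₁ σ₂ (γ t) := by
  refine isPreconnected_Icc.induction₂ (fun r r' =>
    (η r ∈ trackShadow poly P k i j₁ j₂ σ₁ σ₂ (γ r) ↔
      η r' ∈ trackShadow poly P k i j₁ j₂ σ₁ σ₂ (γ r'))) (fun r hr => ?_)
    (fun _ _ _ _ _ _ => Iff.trans) (fun _ _ _ _ => Iff.symm) (left_mem_Icc.2 hst)
    (right_mem_Icc.2 hst)
  obtain ⟨z₁, z₂, hz⟩ := hall r hr
  have t' : Tendsto (fun r => (γ r, η r)) (𝓝[Icc s t] r) (𝓝 (γ r, η r)) :=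
    (hγ r hr).tendsto.prodMk_nhds (hη r hr).tendsto
  filter_upwards [t'.eventually (hz.eventually_mem_trackShadow_iff (hT r hr) (hh r hr)),
    self_mem_nhdsWithin] with r' h1 h2 using h1 (hh r' h2)

end IsTrack

end TrackShadow

/-! ### Every type 2 shadow belongs to a track -/

section Existence

variable {poly : Polygon Plane n} {P : Set Plane} {k : ℕ} {p x y : Plane} {i : Fin n}

lemma exists_maximal_interval {K : Set ℝ} (hK : IsClosed K) (hb : BddAbove K) {a : ℝ} (ha : a ∈ K) :
    ∃ b, a ≤ b ∧ Icc a b ⊆ K ∧ ∃ᶠ s in 𝓝[>] b, s ∉ K := by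
  set A : Set ℝ := {b | a ≤ b ∧ Icc a b ⊆ K} with hA
  have haA : a ∈ A := ⟨le_rfl, by rw [Icc_self]; exact singleton_subset_iff.2 ha⟩
  have hAb : BddAbove A := hb.mono fun b h => h.2 (right_mem_Icc.2 h.1)
  have hab : a ≤ sSup A := le_csSup hAb haA
  have hlt : Ico a (sSup A) ⊆ K := fun s hs => by
    obtain ⟨b', hb', h⟩ := exists_lt_of_lt_csSup ⟨a, haA⟩ hs.2
    exact hb'.2 ⟨hs.1, h.le⟩
  have hsub : Icc a (sSup A) ⊆ K := by
    rcases hab.eq_or_lt with h | h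
    · rw [← h]; exact haA.2
    · rw [← closure_Ico h.ne]; exact closure_minimal hlt hK
  refine ⟨_, hab, hsub, fun hcon => ?_⟩
  simp only [not_not] at hcon
  obtain ⟨u, hu, h⟩ := mem_nhdsGT_iff_exists_Ioo_subset.1 hcon
  have hu' : sSup A < u := hu
  have : (sSup A + u) / 2 ∈ A := by
    refine ⟨by linarith, fun s hs => ?_⟩
    rcases le_or_gt s (sSup A) with h1 | h1
    · exact hsub ⟨hs.1, h1⟩
    · exact h ⟨h1, by linarith [hs.2]⟩
  linarith [le_csSup hAb this]

/-- Compactness stops the ray; beyond the end of its maximal piece in `P` there are points outside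
`P` arbitrarily close. -/
lemma exists_last_point (hP : IsCompact P) (hpx : p ≠ x) (hx : x ∈ P) :
    ∃ y, x ∈ segment ℝ p y ∧ segment ℝ x y ⊆ P ∧
      ∃ᶠ s in 𝓝[>] (1 : ℝ), (AffineMap.lineMap p y s : Plane) ∉ P := by
  have hc : Continuous fun s : ℝ => (AffineMap.lineMap p x s : Plane) :=
    AffineMap.lineMap_continuous
  obtain ⟨M, hM⟩ := hP.isBounded.subset_closedBall p
  obtain ⟨b, hb, hsub, hfreq⟩ := exists_maximal_interval
    (K := (fun s : ℝ => (AffineMap.lineMap p x s : Plane)) ⁻¹' P) (hP.isClosed.preimage hc)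
    ⟨M / dist p x, fun s hs => by
      have h1 := hM hs
      rw [Metric.mem_closedBall, dist_lineMap_left] at h1
      rw [le_div_iff₀ (dist_pos.2 hpx)]
      exact (mul_le_mul_of_nonneg_right (le_abs_self s) dist_nonneg).trans h1⟩
    (a := 1) (by simpa using hx)
  have hb0 : 0 < b := one_pos.trans_le hb
  have hscale : ∀ s : ℝ, (AffineMap.lineMap p (AffineMap.lineMap p x b : Plane) s : Plane) =
      AffineMap.lineMap p x (s * b) := fun s => by
    apply plane_ext <;> simp only [lineMap_coord] <;> ring
  refine ⟨AffineMap.lineMap p x b, ?_, ?_, ?_⟩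
  · refine mem_segment_iff_lineMap.2 ⟨1 / b, ⟨by positivity, (div_le_one hb0).2 hb⟩, ?_⟩
    rw [hscale, one_div_mul_cancel hb0.ne', AffineMap.lineMap_apply_one]
  · intro q hq
    obtain ⟨s, hs, rfl⟩ := mem_segment_iff_lineMap.1 hq
    have e : (AffineMap.lineMap x (AffineMap.lineMap p x b : Plane) s : Plane) =
        AffineMap.lineMap p x (1 + s * (b - 1)) := by
      apply plane_ext <;> simp only [lineMap_coord] <;> ring
    rw [e]
    exact hsub ⟨by nlinarith [hs.1], by nlinarith [hs.2]⟩
  · have t : Tendsto (fun s : ℝ => s / b) (𝓝[>] b) (𝓝[>] 1) := by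
      refine tendsto_nhdsWithin_iff.2 ⟨?_, ?_⟩
      · have : Tendsto (fun s : ℝ => s / b) (𝓝 b) (𝓝 (b / b)) := tendsto_id.div_const b
        rw [div_self hb0.ne'] at this
        exact this.mono_left nhdsWithin_le_nhds
      · filter_upwards [self_mem_nhdsWithin] with s hs
        exact (one_lt_div hb0).2 hs
    refine t.frequently (hfreq.mono fun s hs h => hs ?_)
    rw [hscale, div_mul_cancel₀ _ hb0.ne'] at h
    exact h

/-- The point where a ray leaves the region lies on an edge that the ray meets from inside, unless it
is a vertex. -/
lemma innerForm_pos_of_last_point (hP : IsRegionOf P poly)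
    (hy : y ∈ openEdge poly i)
    (hlast : ∃ᶠ s in 𝓝[>] (1 : ℝ), (AffineMap.lineMap p y s : Plane) ∉ P) :
    0 < innerForm hP i p := by
  have t := tendsto_lineMap_param p y 1
  rw [AffineMap.lineMap_apply_one] at t
  have hev := (t.eventually ((eventually_inner hP hy).and
    (eventually_mem_openEdge hP.simple hy))).filter_mono (nhdsWithin_le_nhds (s := Ioi 1))
  obtain ⟨s, hs, ⟨⟨h1, -⟩, h2⟩, h3⟩ := (hlast.and_eventually
    (hev.and (self_mem_nhdsWithin (a := (1 : ℝ)) (s := Ioi 1)))).exists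
  have h3' : 1 < s := h3
  have hval : innerForm hP i (AffineMap.lineMap p y s) = (1 - s) * innerForm hP i p := by
    rw [innerForm_lineMap, innerForm_of_mem hP (openEdge_subset _ _ hy)]; ring
  -- From the outer side the ray would enter the interior just past `y`; on the line of the edge it
  -- would continue along the edge, inside `P`.
  rcases lt_trichotomy (innerForm hP i p) 0 with h | h | h
  · refine absurd (interior_subset (h1 ?_)) hs
    rw [hval]
    exact mul_pos_of_neg_of_neg (by linarith) h
  · refine absurd ?_ hs
    rw [h, mul_zero] at hval
    exact hP.isCompact.isClosed.frontier_subset (hP.frontier_eq ▸ edgeSet_subset_boundary _ _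
      (openEdge_subset _ _ (h2 ((innerForm_eq_zero hP).1 hval))))
  · exact h

/-- Going along an edge from a hidden point towards an end, the hidden part stops at a tangential
vertex if it does not contain the end. -/
lemma exists_shadowEnd (hP : IsRegionOf P poly) (hk : Even k) (hp : p ∈ cellDomain poly P k)
    (hin : 0 < innerForm hP i p) {e : Plane} (he : segment ℝ y e ⊆ poly.edgeSet ℝ i)
    (hy : ¬ KVisible poly k p y)
    (hne : ∃ q ∈ segment ℝ y e, KVisible poly k p q) :
    ∃ (s c : ℝ) (j : Fin n) (σ : ℝ), 0 ≤ s ∧ 0 < c ∧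
      IsShadowEnd poly k i j σ p (AffineMap.lineMap y e s) ∧
      (∀ r ∈ Icc 0 s, ¬ KVisible poly k p (AffineMap.lineMap y e r)) ∧
      ∀ r, σ * orient p (poly j) (AffineMap.lineMap y e r) = c * (s - r) := by
  have hi : edgeForm poly i p ≠ 0 := fun h0 => hin.ne' ((innerForm_eq_zero hP).2 h0)
  set D : ℝ → Plane := fun s => AffineMap.lineMap y e s with hD
  have hDe : ∀ s ∈ Icc (0 : ℝ) 1, D s ∈ poly.edgeSet ℝ i := fun s hs =>
    he (mem_segment_iff_lineMap.2 ⟨s, hs, rfl⟩)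
  have hDt : ∀ s, Tendsto (fun r => (p, D r)) (𝓝 s) (𝓝 (p, D s)) := fun s =>
    tendsto_const_nhds.prodMk_nhds (tendsto_lineMap_param y e s)
  set K : Set ℝ := {s | s ∈ Icc (0 : ℝ) 1 ∧ ¬ KVisible poly k p (D s)} with hK
  -- Openness of visibility along the edge makes the set of hidden parameters closed, so its maximal
  -- interval from 0 has a hidden last point.
  have hKc : IsClosed K := by
    rw [← isOpen_compl_iff, isOpen_iff_eventually]
    intro s hs
    by_cases hs' : s ∈ Icc (0 : ℝ) 1
    · have hv : KVisible poly k p (D s) := not_not.1 fun h => hs ⟨hs', h⟩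
      filter_upwards [(hDt s).eventually (visible_local hP hk hp hin (hDe s hs') hv)] with r h1 h2
      exact h2.2 (h1 (hDe r h2.1))
    · filter_upwards [isClosed_Icc.isOpen_compl.mem_nhds hs'] with r h1 h2 using h1 h2.1
  have h0K : (0 : ℝ) ∈ K := ⟨by norm_num, by simpa [hD] using hy⟩
  obtain ⟨s, hs0, hsub, hfreq⟩ := exists_maximal_interval hKc ⟨1, fun _ h => h.1.2⟩ h0K
  have hsK := hsub (right_mem_Icc.2 hs0)
  have hs1 : s < 1 := by
    refine lt_of_le_of_ne hsK.1.2 fun h1 => ?_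
    obtain ⟨q, hq, hv⟩ := hne
    obtain ⟨r, hr, rfl⟩ := mem_segment_iff_lineMap.1 hq
    exact (hsub (h1 ▸ hr)).2 hv
  have hfreq' : ∃ᶠ r in 𝓝[>] s, s < r ∧ D r ∈ poly.edgeSet ℝ i ∧ KVisible poly k p (D r) := by
    refine (hfreq.and_eventually (Ioo_mem_nhdsGT hs1)).mono fun r hr => ?_
    have hr' : r ∈ Icc (0 : ℝ) 1 := ⟨hs0.trans hr.2.1.le, hr.2.2.le⟩
    exact ⟨hr.2.1, hDe r hr', not_not.1 fun h => hr.1 ⟨hr', h⟩⟩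
  rcases hidden_local hP hk hp hi (hDe s hsK.1) hsK.2 with ha | ⟨j, σ, hend, -⟩
  · obtain ⟨r, h1, h2⟩ := (hfreq'.and_eventually
      (nhdsWithin_le_nhds ((hDt s).eventually ha))).exists
    exact absurd h1.2.2 h2
  · obtain ⟨r, h1, h2⟩ := (hfreq'.and_eventually
      (nhdsWithin_le_nhds ((hDt s).eventually hend.locally_iff))).exists
    have h3 : σ * orient p (poly j) (D r) < 0 := not_le.1 fun h => (h2 h1.2.1).2 h h1.2.2
    have hzero := hend.orient_eq_zero
    have hval : ∀ r, orient p (poly j) (D r) =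
        (1 - r) * orient p (poly j) y + r * orient p (poly j) e := fun r =>
      orient_lineMap_right _ _ _ _ _
    rw [hval] at hzero
    have hform : ∀ r, σ * orient p (poly j) (D r) =
        (σ * (orient p (poly j) y - orient p (poly j) e)) * (s - r) := fun r => by
      rw [hval]; linear_combination σ * hzero
    -- The form vanishes at `s` and is negative at a visible point beyond it, so `c`, minus its
    -- slope, is positive.
    refine ⟨s, σ * (orient p (poly j) y - orient p (poly j) e), j, σ, hs0, ?_, hend,
      fun r hr => (hsub hr).2, hform⟩
    rw [hform] at h3
    by_contra! h4
    exact h3.not_ge (mul_nonneg_of_nonpos_of_nonpos h4 (by linarith [h1.1]))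

/-- A hidden point of an edge such that the hidden part of the edge around it contains none of the
ends lies on a track. -/
lemma exists_isTrack (hP : IsRegionOf P poly) (hk : Even k) (hp : p ∈ cellDomain poly P k)
    (hin : 0 < innerForm hP i p) (hyi : y ∈ openEdge poly i) (hy : ¬ KVisible poly k p y)
    (hl : ∃ q ∈ segment ℝ y (poly i), KVisible poly k p q)
    (hr : ∃ q ∈ segment ℝ y (poly (finRotate n i)), KVisible poly k p q) :
    ∃ j₁ j₂ σ₁ σ₂ y₁ y₂, IsTrack hP k i j₁ j₂ σ₁ σ₂ p y₁ y₂ ∧ 0 ≤ σ₁ * orient p (poly j₁) y ∧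
      0 ≤ σ₂ * orient p (poly j₂) y := by
  have hi : edgeForm poly i p ≠ 0 := fun h0 => hin.ne' ((innerForm_eq_zero hP).2 h0)
  have hye := openEdge_subset _ _ hyi
  have hyseg := hye
  have hle := left_mem_edge poly i
  have hre := right_mem_edge poly i
  rw [edgeSet_eq] at hle hre hyseg
  obtain ⟨s₁, c₁, j₁, σ₁, hs₁, hc₁, hend₁, hhid₁, hform₁⟩ := exists_shadowEnd hP hk hp hin
    (edgeSet_eq poly i ▸ (convex_segment (poly i) _).segment_subset hyseg hle) hy hl
  obtain ⟨s₂, c₂, j₂, σ₂, hs₂, hc₂, hend₂, hhid₂, hform₂⟩ := exists_shadowEnd hP hk hp hin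
    (edgeSet_eq poly i ▸ (convex_segment (poly i) _).segment_subset hyseg hre) hy hr
  obtain ⟨τ, hτ, hτy⟩ := mem_openSegment_iff_lineMap.1 (show y ∈ openSegment ℝ _ _ from hyi)
  set A := poly i
  set B := poly (finRotate n i)
  have hτ1 : 0 < 1 - τ := sub_pos.2 hτ.2
  have hτ0 := hτ.1
  -- `κ` is the ratio of the distances from `y` to the two ends of the edge; it converts parameters
  -- towards `B` into negative parameters towards `A`.
  set κ := (1 - τ) / τ with hκ
  have hκ0 : 0 < κ := div_pos hτ1 hτ0
  have hconv : ∀ r, (AffineMap.lineMap y B r : Plane) = AffineMap.lineMap y A (-(κ * r)) := fun r => by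
    rw [← hτy, hκ]
    apply plane_ext <;> simp only [lineMap_coord] <;> field_simp <;> ring
  have hconv' : ∀ r, (AffineMap.lineMap y A r : Plane) = AffineMap.lineMap y B (-(r / κ)) := fun r => by
    rw [hconv]; congr 1; field_simp
  have hline : ∀ z ∈ poly.edgeSet ℝ i, ∃ r : ℝ, (AffineMap.lineMap y A r : Plane) = z := by
    intro z hz
    rw [edgeSet_eq] at hz
    obtain ⟨s, -, rfl⟩ := mem_segment_iff_lineMap.1 hz
    refine ⟨(τ - s) / τ, ?_⟩
    rw [← hτy]
    apply plane_ext <;> simp only [lineMap_coord] <;> field_simp <;> ring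
  -- If both ends were at `y`, they would share vertex and sign, but a single affine form cannot
  -- decrease in both directions.
  have hpos : 0 < s₁ + κ * s₂ := by
    refine lt_of_le_of_ne (add_nonneg hs₁ (mul_nonneg hκ0.le hs₂)) fun h0 => ?_
    have h1 : s₁ = 0 := by nlinarith [mul_nonneg hκ0.le hs₂]
    have h2 : s₂ = 0 := by
      have : κ * s₂ = 0 := by linarith
      exact (mul_eq_zero.1 this).resolve_left hκ0.ne'
    subst h1 h2
    rw [AffineMap.lineMap_apply_zero] at hend₁ hend₂
    obtain ⟨rfl, rfl⟩ := hend₁.unique hP hk hp hi hend₂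
    have h3 := hform₂ 1
    rw [hconv, hform₁] at h3
    nlinarith [mul_pos hc₁ hκ0]
  refine ⟨j₁, j₂, σ₁, σ₂, _, _, ⟨hin, hend₁, hend₂, ?_, ?_, ?_⟩, ?_, ?_⟩
  · rw [hconv, hform₁]
    exact mul_pos hc₁ (by linarith)
  · rw [hconv', hform₂]
    refine mul_pos hc₂ ?_
    have : s₂ - -(s₁ / κ) = (s₁ + κ * s₂) / κ := by field_simp; ring
    rw [this]
    exact div_pos hpos hκ0
  · intro z hz h1 h2
    obtain ⟨r, rfl⟩ := hline z hz
    rcases le_or_gt 0 r with hr | hr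
    · rw [hform₁] at h1
      exact hhid₁ r ⟨hr, sub_nonneg.1 (nonneg_of_mul_nonneg_right h1 hc₁)⟩
    · rw [hconv'] at h2 ⊢
      rw [hform₂] at h2
      exact hhid₂ _ ⟨neg_nonneg.2 (div_nonpos_of_nonpos_of_nonneg hr.le hκ0.le),
        sub_nonneg.1 (nonneg_of_mul_nonneg_right h2 hc₂)⟩
  · have := hform₁ 0
    rw [AffineMap.lineMap_apply_zero, sub_zero] at this
    rw [this]; exact mul_nonneg hc₁.le hs₁
  · have := hform₂ 0
    rw [AffineMap.lineMap_apply_zero, sub_zero] at this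
    rw [this]; exact mul_nonneg hc₂.le hs₂

lemma IsShadow.eq_of_mem {S S' : Set Plane} (h : IsShadow poly P k p S) (h' : IsShadow poly P k p S')
    (hx : x ∈ S) (hx' : x ∈ S') : S = S' := by
  obtain ⟨z, -, rfl⟩ := h
  obtain ⟨z', -, rfl⟩ := h'
  rw [connectedComponentIn_eq hx, connectedComponentIn_eq hx']

lemma IsShadow.subset_of_mem {S s : Set Plane} (h : IsShadow poly P k p S) (hs : IsPreconnected s)
    (hsh : s ⊆ hidden poly P k p) (hx : x ∈ S) (hxs : x ∈ s) : s ⊆ S := by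
  obtain ⟨z, -, rfl⟩ := h
  rw [connectedComponentIn_eq hx]
  exact hs.subset_connectedComponentIn hxs hsh

/-- Every type 2 shadow is the shadow of a track. -/
lemma exists_eq_trackShadow (hP : IsRegionOf P poly) (hk : Even k) (hp : p ∈ cellDomain poly P k)
    {S : Set Plane} (hS : IsShadow poly P k p S) (hT : IsTypeTwo poly S) :
    ∃ i j₁ j₂ σ₁ σ₂ y₁ y₂, IsTrack hP k i j₁ j₂ σ₁ σ₂ p y₁ y₂ ∧
      S = trackShadow poly P k i j₁ j₂ σ₁ σ₂ p := by
  obtain ⟨x, hx, hSx⟩ := id hS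
  have hxS : x ∈ S := hSx ▸ mem_connectedComponentIn hx
  have hpx : p ≠ x := fun e => hx.2 (e ▸ kVisible_self poly k p)
  have hclosed := hP.isCompact.isClosed
  obtain ⟨y, hxy, hseg, hlast⟩ := exists_last_point hP.isCompact hpx hx.1
  have hhid : segment ℝ x y ⊆ hidden poly P k p := fun q hq =>
    ⟨hseg hq, hidden_of_mem_segment hx.2 (mem_segment_between hxy hq).2.1⟩
  have hyS : y ∈ S := hS.subset_of_mem (convex_segment x y).isPreconnected hhid hxS
    (left_mem_segment _ _ _) (right_mem_segment _ _ _)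
  have hyh := hhid (right_mem_segment _ _ _)
  have hyb : y ∈ poly.boundary ℝ := by
    refine hP.frontier_eq ▸ ⟨subset_closure hyh.1, fun hyi => ?_⟩
    have t := tendsto_lineMap_param p y 1
    rw [AffineMap.lineMap_apply_one] at t
    obtain ⟨s, h1, h2⟩ := (hlast.and_eventually (nhdsWithin_le_nhds
      (t.eventually (isOpen_interior.mem_nhds hyi)))).exists
    exact h1 (interior_subset h2)
  obtain ⟨i, hi⟩ := mem_iUnion.1 hyb
  have hyo : y ∈ openEdge poly i := by
    rcases mem_edge_cases hi with h | h | h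
    · exact absurd (h ▸ hyS) (hT _)
    · exact absurd (h ▸ hyS) (hT _)
    · exact h
  have hin := innerForm_pos_of_last_point hP hyo hlast
  -- If the edge were hidden all the way from `y` to one of its ends, that vertex would belong to
  -- `S`.
  have hvis : ∀ j, poly j ∈ poly.edgeSet ℝ i → ∃ q ∈ segment ℝ y (poly j), KVisible poly k p q := by
    intro j hj
    by_contra! hall
    have hsub : segment ℝ y (poly j) ⊆ poly.edgeSet ℝ i := by
      rw [edgeSet_eq] at hi hj ⊢
      exact (convex_segment _ _).segment_subset hi hj
    exact hT j (hS.subset_of_mem (convex_segment y (poly j)).isPreconnected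
      (fun q hq => ⟨hclosed.frontier_subset (hP.frontier_eq ▸ edgeSet_subset_boundary _ _ (hsub hq)),
        hall q hq⟩) hyS (left_mem_segment _ _ _) (right_mem_segment _ _ _))
  obtain ⟨j₁, j₂, σ₁, σ₂, y₁, y₂, htr, h₁, h₂⟩ := exists_isTrack hP hk hp hin hyo hyh.2
    (hvis _ (left_mem_edge poly i)) (hvis _ (right_mem_edge poly i))
  refine ⟨i, j₁, j₂, σ₁, σ₂, y₁, y₂, htr, ?_⟩
  have hyt := htr.mem_trackShadow hi h₁ h₂
  have hsub : trackShadow poly P k i j₁ j₂ σ₁ σ₂ p ⊆ S :=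
    hS.subset_of_mem htr.isPreconnected_trackShadow trackShadow_subset hyS hyt
  -- The track shadow lies in `S`, so it contains no vertex, so it is itself a shadow.
  exact hS.eq_of_mem (htr.isShadow fun j hj => hT j (hsub hj)) hyS hyt

/-- A type 2 shadow of a pursuer that moves inside a connected part of the domain extends to a
continuous family of shadows that hidden points can neither enter nor leave. -/
lemma exists_shadow_family (hP : IsRegionOf P poly) (hk : Even k) {C : Set Plane}
    (hC : IsPreconnected C) (hCO : C ⊆ cellDomain poly P k) {γ : ℝ → Plane} {s t : ℝ} (hst : s ≤ t)
    (hγ : ContinuousOn γ (Icc s t)) (hγC : MapsTo γ (Icc s t) C) {r : ℝ} (hr : r ∈ Icc s t)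
    {S : Set Plane} (hS : IsShadow poly P k (γ r) S) (hT : IsTypeTwo poly S) :
    ∃ F : ℝ → Set Plane, F r = S ∧ (∀ r ∈ Icc s t, IsShadow poly P k (γ r) (F r)) ∧
      (∃ η : ℝ → Plane, ContinuousOn η (Icc s t) ∧
        (∀ r ∈ Icc s t, η r ∈ hidden poly P k (γ r) ∧ η r ∈ F r)) ∧
      ∀ η : ℝ → Plane, ContinuousOn η (Icc s t) →
        (∀ r ∈ Icc s t, η r ∈ hidden poly P k (γ r)) → (η s ∈ F s ↔ η t ∈ F t) := by
  obtain ⟨i, j₁, j₂, σ₁, σ₂, y₁, y₂, htr, hSeq⟩ :=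
    exists_eq_trackShadow hP hk (hCO (hγC hr)) hS hT
  have hall := htr.forall_mem hk hC hCO (hγC hr)
  have htwo : ∀ r' ∈ Icc s t, IsTypeTwo poly (trackShadow poly P k i j₁ j₂ σ₁ σ₂ (γ r')) :=
    fun r' hr' => IsTrack.isTypeTwo_of_mem hk hC hCO hall (hγC hr) (hSeq ▸ hT) (hγC hr')
  have hhit : ∀ r' ∈ Icc s t, innerForm hP i (poly j₁) ≠ innerForm hP i (γ r') ∧
      hit hP i (poly j₁) (γ r') ∈ trackShadow poly P k i j₁ j₂ σ₁ σ₂ (γ r') := fun r' hr' => by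
    obtain ⟨z₁, z₂, hz⟩ := hall _ (hγC hr')
    refine ⟨(innerForm_lt_of_mem_openSegment hP hz.inner hz.left.mem_edge hz.left.vertex_mem).2.ne,
      ?_⟩
    rw [hit_eq hP hz.inner hz.left.mem_edge hz.left.vertex_mem]
    exact hz.left_mem_trackShadow
  -- The continuous selection is the shadow end on the line through vertex `j₁`.
  refine ⟨fun r' => trackShadow poly P k i j₁ j₂ σ₁ σ₂ (γ r'), hSeq.symm, fun r' hr' => ?_,
    ⟨fun r' => hit hP i (poly j₁) (γ r'), fun r' hr' => ?_, fun r' hr' => ?_⟩, fun η hη hh => ?_⟩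
  · obtain ⟨z₁, z₂, hz⟩ := hall _ (hγC hr')
    exact hz.isShadow (htwo r' hr')
  · exact (tendsto_hit hP (hhit r' hr').1).comp (hγ r' hr')
  · exact ⟨(hhit r' hr').2.1, (hhit r' hr').2⟩
  · exact IsTrack.mem_trackShadow_iff_of_continuousOn hst hγ hη (fun r' hr' => hall _ (hγC hr'))
      htwo hh

end Existence

end KModem

/-! ### The four events -/

theorem theorem2 {n : ℕ} (poly : Polygon Plane n) (P : Set Plane)
    (hP : KModem.IsRegionOf P poly) (k : ℕ) (hk : Even k)
    (C : Set Plane) (hC : KModem.IsCell poly P k C)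
    (a b : ℝ) (γ : ℝ → Plane) (hγ : ContinuousOn γ (Set.Icc a b))
    (hγC : Set.MapsTo γ (Set.Icc a b) C)
    (s t : ℝ) (has : a ≤ s) (hst : s ≤ t) (htb : t ≤ b) :
    ¬ KModem.AppearEvent poly P k γ s t ∧ ¬ KModem.DisappearEvent poly P k γ s t ∧
      ¬ KModem.MergeEvent poly P k γ s t ∧ ¬ KModem.SplitEvent poly P k γ s t := by
  obtain ⟨x₀, -, rfl⟩ := hC
  have hsub : Icc s t ⊆ Icc a b := Icc_subset_Icc has htb
  have hs : s ∈ Icc s t := left_mem_Icc.2 hst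
  have ht : t ∈ Icc s t := right_mem_Icc.2 hst
  have key := fun {r : ℝ} (hr : r ∈ Icc s t) {S : Set Plane} =>
    KModem.exists_shadow_family (S := S) hP hk isPreconnected_connectedComponentIn
      (connectedComponentIn_subset _ _) hst (hγ.mono hsub) (hγC.mono_left hsub) hr
  refine ⟨?_, ?_, ?_, ?_⟩
  · rintro ⟨T, hT, hT2, hno⟩
    obtain ⟨F, rfl, hF, ⟨η, hη, hηF⟩, -⟩ := key ht hT hT2
    exact hno _ (hF s hs) ⟨η, hη, fun r hr => (hηF r hr).1, (hηF s hs).2, (hηF t ht).2⟩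
  · rintro ⟨S, hS, hS2, hno⟩
    obtain ⟨F, rfl, hF, ⟨η, hη, hηF⟩, -⟩ := key hs hS hS2
    exact hno _ (hF t ht) ⟨η, hη, fun r hr => (hηF r hr).1, (hηF s hs).2, (hηF t ht).2⟩
  · rintro ⟨S₁, S₂, T, hS₁, hS₂, hne, hT, h2, ⟨η₁, hη₁, hh₁, hs₁, ht₁⟩, ⟨η₂, hη₂, hh₂, hs₂, ht₂⟩⟩
    rcases h2 with h2 | h2 | h2
    -- The first path carries the family to time `t`, so `T` is its member there; the second path,
    -- read backwards, then starts in `S₁`.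
    · obtain ⟨F, rfl, hF, -, hiff⟩ := key hs hS₁ h2
      have := hT.eq_of_mem (hF t ht) ht₁ ((hiff η₁ hη₁ hh₁).1 hs₁)
      exact hne (hS₁.eq_of_mem hS₂ ((hiff η₂ hη₂ hh₂).2 (this ▸ ht₂)) hs₂)
    · obtain ⟨F, rfl, hF, -, hiff⟩ := key hs hS₂ h2
      have := hT.eq_of_mem (hF t ht) ht₂ ((hiff η₂ hη₂ hh₂).1 hs₂)
      exact hne (hS₁.eq_of_mem hS₂ hs₁ ((hiff η₁ hη₁ hh₁).2 (this ▸ ht₁)))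
    · obtain ⟨F, rfl, hF, -, hiff⟩ := key ht hT h2
      exact hne ((hS₁.eq_of_mem (hF s hs) hs₁ ((hiff η₁ hη₁ hh₁).2 ht₁)).trans
        ((hF s hs).eq_of_mem hS₂ ((hiff η₂ hη₂ hh₂).2 ht₂) hs₂))
  · rintro ⟨S, T₁, T₂, hS, hT₁, hT₂, hne, h2, ⟨η₁, hη₁, hh₁, hs₁, ht₁⟩, ⟨η₂, hη₂, hh₂, hs₂, ht₂⟩⟩
    rcases h2 with h2 | h2 | h2
    · obtain ⟨F, rfl, hF, -, hiff⟩ := key hs hS h2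
      exact hne ((hT₁.eq_of_mem (hF t ht) ht₁ ((hiff η₁ hη₁ hh₁).1 hs₁)).trans
        ((hF t ht).eq_of_mem hT₂ ((hiff η₂ hη₂ hh₂).1 hs₂) ht₂))
    · obtain ⟨F, rfl, hF, -, hiff⟩ := key ht hT₁ h2
      have := hS.eq_of_mem (hF s hs) hs₁ ((hiff η₁ hη₁ hh₁).2 ht₁)
      exact hne (hT₁.eq_of_mem hT₂ ((hiff η₂ hη₂ hh₂).1 (this ▸ hs₂)) ht₂)
    · obtain ⟨F, rfl, hF, -, hiff⟩ := key ht hT₂ h2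
      have := hS.eq_of_mem (hF s hs) hs₂ ((hiff η₂ hη₂ hh₂).2 ht₂)
      exact hne (hT₁.eq_of_mem hT₂ ht₁ ((hiff η₁ hη₁ hh₁).1 (this ▸ hs₁)))
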